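/- **Setting.** Let $M$ be a smooth (Hausdorff) $n$-manifold and $(E,[\cdot,\cdot]_E,\sigma)$ a Lie algebroid over $M$: $\pi:E\to M$ is a smooth vector bundle of rank $m$, $[\cdot,\cdot]_E$ a Lie bracket on $\Gamma(E)$, and $\sigma:E\to TM$ a smooth bundle map inducing a Lie algebra homomorphism $\Gamma(E)\to\mathfrak X(M)$ with $[s,ft]_E=f[s,t]_E+(\sigma(s)f)\,t$. Its prolongation $\mathcal TE\to E$ has the fibres $\mathcal T_wE=\{(u,v)\in E_{\pi(w)}\times T_wE:\sigma(u)=T_w\pi(v)\}$, the anchor $\sigma^1(u,v)=v$, and the bracket $[\cdot,\cdot]$ that extends $[(s\circ\pi,X),(t\circ\pi,Y)]=([s,t]_E\circ\pi,[X,Y])$ by the Leibniz rule; $d$ is its exterior derivative, and $\rho(f):=\sigma^1(\rho)f$ for a section $\rho$ of $\mathcal TE$. The vertical bundle $V\mathcal TE$ consists of the pairs $(0,v)$. For $a\in E_{\pi(w)}$ let $a^v_w\in T_wE$ be the velocity of $t\mapsto w+ta$ at $t=0$; put $J(u,v)=(0,u^v_w)$ and $C(w)=(0,w^v_w)$. Let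 $W\subseteq E$ be open (for instance $W=E\setminus\{0\}$ or $W=E$) and let $L$ be a smooth function on $W$ that is a regular Lagrangian there, i.e. its Hessian $g=\big(\partial^2L/\partial y^\alpha\partial y^\beta\big)$ along the fibres of $E$ has rank $m$ at each point of $W$; $g$ is regarded as a pseudo-Riemannian metric on $V\mathcal TE|_W$. Put $\theta_L(\rho)=dL(J\rho)$, $\omega_L=d\theta_L$, $E_L=C(L)-L$. All sections below are smooth sections of $\mathcal TE$ over $W$. A *nonlinear connection* (over $W$) is a smooth bundle endomorphism $\mathcal N$ of $\mathcal TE|_W$ with $\mathcal N^2=\mathrm{Id}$ and $\ker(\mathrm{Id}+\mathcal N)=V\mathcal TE$; put $h=\frac12(\mathrm{Id}+\mathcal N)$ and $v=\frac12(\mathrm{Id}-\mathcal N)$. Given a section $\mathcal S$, its dynamical covariant derivative is $\nabla\rho=h[\mathcal S,h\rho]+v[\mathcal S,v\rho]$. $\mathcal N$ is *metric* if $\nabla g=0$, i.e. $\mathcal S(g(\rho,\nu))=g(\nabla\rho,\nu)+g(\rho,\nabla\nu)$ for all vertical sections $\rho,\nu$, and *compatible with* $\omega_L$ if $\omega_L(h\rho,h\nu)=0$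 for all sections $\rho,\nu$. In a local frame $(s_\alpha)$ of $E$ over an open $U\subseteq M$, with coordinates $x^i$ on $M$ and fibre coordinates $y^\alpha$, write $\sigma(s_\alpha)=\sigma^i_\alpha\,\partial/\partial x^i$, $[s_\alpha,s_\beta]_E=L^\gamma_{\alpha\beta}s_\gamma$, $\mathcal X_\alpha=(s_\alpha\circ\pi,\sigma^i_\alpha\,\partial/\partial x^i)$, $\mathcal V_\alpha=(0,\partial/\partial y^\alpha)$, $h(\mathcal X_\beta)=\mathcal X_\beta-\mathcal N^\alpha_\beta\mathcal V_\alpha$ and $\mathcal N_{\alpha\beta}=g_{\alpha\gamma}\mathcal N^\gamma_\beta$. **Theorem.** There is a unique section $\mathcal S$ of $\mathcal TE$ over $W$ with $i_{\mathcal S}\omega_L=-dE_L$, and it is a semispray: $J\mathcal S=C$. The formula $\mathcal N(\rho)=-[\mathcal S,J\rho]+J[\mathcal S,\rho]$ defines a nonlinear connection over $W$ (the canonical one), whose coefficients in every local frame are $$\mathcal N^\alpha_\beta=\tfrac12g^{\alpha\varepsilon}\Big[\mathcal S(g_{\varepsilon\beta})+\sigma^i_\beta\frac{\partial^2L}{\partial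 x^i\partial y^\varepsilon}-\sigma^i_\varepsilon\frac{\partial^2L}{\partial x^i\partial y^\beta}-L^\gamma_{\beta\varepsilon}\frac{\partial L}{\partial y^\gamma}+\big(g_{\gamma\varepsilon}L^\gamma_{\beta\theta}+g_{\gamma\beta}L^\gamma_{\varepsilon\theta}\big)y^\theta\Big].$$ With $\nabla$ induced by $\mathcal S$, the canonical connection is metric and compatible with $\omega_L$, and it is the only nonlinear connection over $W$ with these two properties. Moreover, an arbitrary nonlinear connection over $W$ is metric if and only if in every local frame $$\tfrac12(\mathcal N_{\alpha\beta}+\mathcal N_{\beta\alpha})=\tfrac12\Big(\mathcal S(g_{\alpha\beta})+\big(g_{\gamma\beta}L^\gamma_{\alpha\varepsilon}+g_{\gamma\alpha}L^\gamma_{\beta\varepsilon}\big)y^\varepsilon\Big),$$ and it is compatible with $\omega_L$ if and only if in every local frame $$\tfrac12(\mathcal N_{\alpha\beta}-\mathcal N_{\beta\alpha})=\tfrac12\Big(\sigma^i_\beta\frac{\partial^2L}{\partial x^i\partial y^\alpha}-\sigma^i_\alpha\frac{\partial^2L}{\partial x^i\partial y^\beta}+L^\gamma_{\alpha\beta}\frac{\partial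 L}{\partial y^\gamma}\Big).$$ -/

import Mathlib

open Bundle Set Filter Topology
open scoped Manifold ContDiff

noncomputable section

/-- The model fibre `ℝ^m` of a vector bundle of rank `m`. -/
abbrev Fib (m : ℕ) := EuclideanSpace ℝ (Fin m)

/-- The model with corners of the total space of a rank `m` bundle over an `n`-manifold. -/
abbrev IE (n m : ℕ) := (𝓡 n).prod 𝓘(ℝ, Fib m)

section LieAlgebroid

variable (n m : ℕ) {M : Type*} [TopologicalSpace M] [ChartedSpace (EuclideanSpace ℝ (Fin n)) M]
  (E : M → Type*) [TopologicalSpace (TotalSpace (Fib m) E)]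
  [∀ x, AddCommGroup (E x)] [∀ x, Module ℝ (E x)] [∀ x, TopologicalSpace (E x)]
  [FiberBundle (Fib m) E] [VectorBundle ℝ (Fib m) E]
  [IsManifold (𝓡 n) ∞ M] [ContMDiffVectorBundle ∞ (Fib m) E (𝓡 n)]

/-- A Lie algebroid structure on the smooth vector bundle `E → M`: a Lie bracket on the smooth
sections and a smooth bundle map `σ : E → TM` (the anchor), which is a Lie algebra homomorphism
on sections and satisfies the Leibniz rule. -/
structure LieAlgebroid where
  bracket : Cₛ^∞⟮𝓡 n; Fib m, E⟯ → Cₛ^∞⟮𝓡 n; Fib m, E⟯ → Cₛ^∞⟮𝓡 n; Fib m, E⟯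
  add_bracket : ∀ s s' t, bracket (s + s') t = bracket s t + bracket s' t
  smul_bracket : ∀ (c : ℝ) s t, bracket (c • s) t = c • bracket s t
  skew : ∀ s t, bracket s t = -bracket t s
  jacobi : ∀ s₁ s₂ s₃, bracket s₁ (bracket s₂ s₃) + bracket s₂ (bracket s₃ s₁)
    + bracket s₃ (bracket s₁ s₂) = 0
  anchor : ∀ x : M, E x →ₗ[ℝ] TangentSpace (𝓡 n) x
  anchor_smooth : ContMDiff (IE n m) (𝓡 n).tangent ∞
    (fun u : TotalSpace (Fib m) E =>
      (⟨u.proj, anchor u.proj u.2⟩ : TangentBundle (𝓡 n) M))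
  anchor_bracket : ∀ s t (x : M), anchor x (bracket s t x) =
    VectorField.mlieBracket (𝓡 n) (fun y => anchor y (s y)) (fun y => anchor y (t y)) x
  leibniz : ∀ (f : M → ℝ), ContMDiff (𝓡 n) 𝓘(ℝ, ℝ) ∞ f →
    ∀ s t t' : Cₛ^∞⟮𝓡 n; Fib m, E⟯, (∀ x, t' x = f x • t x) →
    ∀ x, bracket s t' x =
      f x • bracket s t x + (mvfderiv (𝓡 n) f x (anchor x (s x))) • t x

end LieAlgebroid

section Vertical

variable {n m : ℕ} {M : Type*} [TopologicalSpace M] [ChartedSpace (EuclideanSpace ℝ (Fin n)) M]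
  {E : M → Type*} [TopologicalSpace (TotalSpace (Fib m) E)]
  [∀ x, AddCommGroup (E x)] [∀ x, Module ℝ (E x)] [∀ x, TopologicalSpace (E x)]
  [FiberBundle (Fib m) E] [VectorBundle ℝ (Fib m) E]

/-- The straight line `t ↦ w + t a` in the fibre through `w`. -/
def fiberLine (w : TotalSpace (Fib m) E) (a : E w.proj) (t : ℝ) : TotalSpace (Fib m) E :=
  ⟨w.proj, w.2 + t • a⟩

variable (n) in
/-- The vertical lift of `a ∈ E_{π(w)}` to `w`: the velocity of `t ↦ w + t a` at `t = 0`. -/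
def vlift (w : TotalSpace (Fib m) E) (a : E w.proj) : TangentSpace (IE n m) w :=
  mfderiv 𝓘(ℝ, ℝ) (IE n m) (fiberLine w a) 0 (1 : ℝ)

variable (n) in
/-- The inverse of `vlift` on vertical tangent vectors, computed in a trivialization (only used for
vertical vectors, on which it does not depend on the trivialization). -/
def fiberPart (w : TotalSpace (Fib m) E) (v : TangentSpace (IE n m) w) : E w.proj :=
  (trivializationAt (Fib m) E w.proj).symm w.proj
    (mvfderiv (IE n m) (fun w' => (trivializationAt (Fib m) E w.proj w').2) w v)

/-- The Hessian `(∂²L/∂y^α∂y^β) a^α b^β` of `L` along the fibre, at `w`. -/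
def fiberHess (L : TotalSpace (Fib m) E → ℝ) (w : TotalSpace (Fib m) E) (a b : E w.proj) : ℝ :=
  deriv (fun s : ℝ => deriv (fun t : ℝ => L ⟨w.proj, w.2 + s • a + t • b⟩) 0) 0

/-- `L` is a regular Lagrangian on `W`: its fibre Hessian has full rank at every point of `W`. -/
def IsRegularOn (L : TotalSpace (Fib m) E → ℝ) (W : Set (TotalSpace (Fib m) E)) : Prop :=
  ∀ w ∈ W, ∀ a : E w.proj, (∀ b, fiberHess L w a b = 0) → a = 0

lemma mfderiv_proj_vlift [IsManifold (𝓡 n) ∞ M] [ContMDiffVectorBundle ∞ (Fib m) E (𝓡 n)]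
    (w : TotalSpace (Fib m) E) (a : E w.proj) :
    mfderiv (IE n m) (𝓡 n) (TotalSpace.proj : TotalSpace (Fib m) E → M) w (vlift n w a) = 0 := by
  by_cases h : MDifferentiableAt 𝓘(ℝ, ℝ) (IE n m) (fiberLine w a) 0
  · have h0 : fiberLine w a 0 = w := by simp [fiberLine]
    have hp : MDifferentiableAt (IE n m) (𝓡 n)
        (TotalSpace.proj : TotalSpace (Fib m) E → M) (fiberLine w a 0) :=
      (contMDiff_proj (n := ∞) E).mdifferentiable (by simp) _
    have hc := mfderiv_comp (0 : ℝ) hp h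
    have hk : (TotalSpace.proj : TotalSpace (Fib m) E → M) ∘ fiberLine w a
        = fun _ => w.proj := rfl
    rw [hk, mfderiv_const] at hc
    have := congrArg (fun T => T (1 : ℝ)) hc
    rw [h0] at this
    exact this.symm
  · simp only [vlift, mfderiv_zero_of_not_mdifferentiableAt h]
    exact map_zero _

end Vertical

namespace LieAlgebroid

variable {n m : ℕ} {M : Type*} [TopologicalSpace M] [ChartedSpace (EuclideanSpace ℝ (Fin n)) M]
  {E : M → Type*} [TopologicalSpace (TotalSpace (Fib m) E)]
  [∀ x, AddCommGroup (E x)] [∀ x, Module ℝ (E x)] [∀ x, TopologicalSpace (E x)]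
  [FiberBundle (Fib m) E] [VectorBundle ℝ (Fib m) E]
  [IsManifold (𝓡 n) ∞ M] [ContMDiffVectorBundle ∞ (Fib m) E (𝓡 n)]
  (A : LieAlgebroid n m E)

open Classical in
/-- The bracket of sections that are only defined and smooth near `x`, evaluated at `x`: the bracket
of any global smooth sections with the same germs at `x`. -/
def localBracket (s t : ∀ x, E x) (x : M) : E x :=
  if h : ∃ p : Cₛ^∞⟮𝓡 n; Fib m, E⟯ × Cₛ^∞⟮𝓡 n; Fib m, E⟯,
      (∀ᶠ y in 𝓝 x, p.1 y = s y) ∧ (∀ᶠ y in 𝓝 x, p.2 y = t y)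
  then A.bracket h.choose.1 h.choose.2 x
  else 0

/-- The fibre at `w` of the prolongation `𝒯E`: pairs `(u, v) ∈ E_{π(w)} × T_w E` with
`σ(u) = T_w π (v)`. -/
def prolong (w : TotalSpace (Fib m) E) :
    Submodule ℝ (E w.proj × TangentSpace (IE n m) w) :=
  LinearMap.eqLocus ((A.anchor w.proj).comp (LinearMap.fst ℝ _ _))
    ((mfderiv (IE n m) (𝓡 n) (TotalSpace.proj : TotalSpace (Fib m) E → M) w).toLinearMap.comp
      (LinearMap.snd ℝ _ _))

/-- (Not necessarily smooth) sections of `𝒯E → E`. -/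
abbrev Sec := ∀ w : TotalSpace (Fib m) E, A.prolong w

variable {A}

/-- The section `ρ` of `𝒯E` is smooth on `W`: both of its components, the map `π₁ ∘ ρ : E → E` and
the vector field `σ¹(ρ)` on `E`, are smooth on `W`. -/
def SmoothOn (ρ : A.Sec) (W : Set (TotalSpace (Fib m) E)) : Prop :=
  ContMDiffOn (IE n m) (IE n m) ∞
      (fun w => (⟨w.proj, (ρ w).1.1⟩ : TotalSpace (Fib m) E)) W ∧
    ContMDiffOn (IE n m) (IE n m).tangent ∞
      (fun w => (⟨w, (ρ w).1.2⟩ : TangentBundle (IE n m) (TotalSpace (Fib m) E))) W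

/-- `z ∈ 𝒯_w E` is vertical if `π₁ z = 0`. -/
def IsVertical {w : TotalSpace (Fib m) E} (z : A.prolong w) : Prop := z.1.1 = 0

/-- `σ¹(ρ)(f)`: the derivative of the function `f` along the section `ρ` of `𝒯E`; also
`(d^E f)(ρ)`. -/
def D (ρ : A.Sec) (f : TotalSpace (Fib m) E → ℝ) (w : TotalSpace (Fib m) E) : ℝ :=
  mvfderiv (IE n m) f w (ρ w).1.2

/-- The `E`-component of the section `ρ`, read in the trivialization of `E` around `x`. -/
def trivComp (ρ : A.Sec) (x : M) (w : TotalSpace (Fib m) E) : Fib m :=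
  (trivializationAt (Fib m) E x (⟨w.proj, (ρ w).1.1⟩ : TotalSpace (Fib m) E)).2

/-- The `E`-component of the bracket of `𝒯E`. In the frame `s_α` of constant sections of a
trivialization around `π(w)`, the bracket of `u₁^α s_α ∘ π` and `u₂^α s_α ∘ π` has the components
`σ¹(ρ₁)(u₂^γ) - σ¹(ρ₂)(u₁^γ) + u₁^α u₂^β L^γ_{αβ}`. -/
def bracketFst (ρ ν : A.Sec) (w : TotalSpace (Fib m) E) : E w.proj :=
  (trivializationAt (Fib m) E w.proj).symm w.proj
      (mvfderiv (IE n m) (trivComp ν w.proj) w (ρ w).1.2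
        - mvfderiv (IE n m) (trivComp ρ w.proj) w (ν w).1.2)
    + A.localBracket
      (fun x => (trivializationAt (Fib m) E w.proj).symm x (trivComp ρ w.proj w))
      (fun x => (trivializationAt (Fib m) E w.proj).symm x (trivComp ν w.proj w)) w.proj

/-- The `TE`-component of the bracket of `𝒯E`: the Lie bracket of the vector fields `σ¹(ρ)` and
`σ¹(ν)` on `E`. -/
def bracketSnd (ρ ν : A.Sec) (w : TotalSpace (Fib m) E) : TangentSpace (IE n m) w :=
  VectorField.mlieBracket (IE n m) (fun w' => (ρ w').1.2) (fun w' => (ν w').1.2) w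

open Classical in
/-- The Lie algebroid bracket `[ρ, ν]` of the prolongation `𝒯E`: the extension by the Leibniz rule
(for the anchor `σ¹`) of `[(s ∘ π, X), (t ∘ π, Y)] = ([s, t] ∘ π, [X, Y])`. (The pair of components
lies in `𝒯_w E` whenever `ρ` and `ν` are smooth around `w`.) -/
def br (ρ ν : A.Sec) : A.Sec := fun w =>
  if h : (bracketFst ρ ν w, bracketSnd ρ ν w) ∈ A.prolong w then ⟨_, h⟩ else 0

variable (A) in
/-- The vertical element `(0, a_w^v)` of `𝒯_w E`. -/
def vert (w : TotalSpace (Fib m) E) (a : E w.proj) : A.prolong w :=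
  ⟨(0, vlift n w a), by
    simp only [prolong, LinearMap.mem_eqLocus, LinearMap.comp_apply, LinearMap.fst_apply,
      LinearMap.snd_apply, map_zero]
    exact (mfderiv_proj_vlift w a).symm⟩

/-- The vertical endomorphism `J(u, v) = (0, u^v)`. -/
def J (ρ : A.Sec) : A.Sec := fun w => A.vert w (ρ w).1.1

variable (A) in
/-- The Euler section `C(w) = (0, w_w^v)`. -/
def euler : A.Sec := fun w => A.vert w w.2

/-- `S` is a semispray on `W`: `J S = C`. -/
def IsSemispray (S : A.Sec) (W : Set (TotalSpace (Fib m) E)) : Prop :=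
  ∀ w ∈ W, J S w = A.euler w

/-- The Cartan 1-section `θ_L = J(d^E L)`, i.e. `θ_L(ρ) = d^E L (J ρ)`. -/
def theta (L : TotalSpace (Fib m) E → ℝ) (ρ : A.Sec) : TotalSpace (Fib m) E → ℝ :=
  D (J ρ) L

/-- The Cartan 2-section `ω_L = d^E θ_L`. -/
def omega (L : TotalSpace (Fib m) E → ℝ) (ρ ν : A.Sec) (w : TotalSpace (Fib m) E) : ℝ :=
  D ρ (theta L ν) w - D ν (theta L ρ) w - theta L (br ρ ν) w

variable (A) in
/-- The energy `E_L = C(L) - L`. -/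
def energy (L : TotalSpace (Fib m) E → ℝ) (w : TotalSpace (Fib m) E) : ℝ :=
  D A.euler L w - L w

/-- `S` is a smooth solution on `W` of the symplectic equation `i_S ω_L = - d^E E_L`. -/
structure IsEulerLagrange (L : TotalSpace (Fib m) E → ℝ) (S : A.Sec)
    (W : Set (TotalSpace (Fib m) E)) : Prop where
  smooth : SmoothOn S W
  eq : ∀ ν : A.Sec, SmoothOn ν W → ∀ w ∈ W, omega L S ν w = -D ν (A.energy L) w

variable (A) in
/-- A nonlinear connection on `𝒯E` over `W ⊆ E`: a bundle endomorphism `N` of `𝒯E`, smooth over `W`,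
with `N² = Id` and `ker (Id + N) = V𝒯E`. (The values off `W` are irrelevant.) -/
structure NonlinearConnection (W : Set (TotalSpace (Fib m) E)) where
  toFun : ∀ w : TotalSpace (Fib m) E, A.prolong w →ₗ[ℝ] A.prolong w
  sq : ∀ w ∈ W, ∀ z, toFun w (toFun w z) = z
  ker : ∀ w ∈ W, ∀ z, z + toFun w z = 0 ↔ IsVertical z
  smooth : ∀ ρ : A.Sec, SmoothOn ρ W → SmoothOn (fun w => toFun w (ρ w)) W

namespace NonlinearConnection

variable {W : Set (TotalSpace (Fib m) E)}

/-- The horizontal projector `h = (Id + N) / 2`. -/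
def h (N : A.NonlinearConnection W) (ρ : A.Sec) : A.Sec :=
  fun w => (1 / 2 : ℝ) • (ρ w + N.toFun w (ρ w))

/-- The vertical projector `v = (Id - N) / 2`. -/
def v (N : A.NonlinearConnection W) (ρ : A.Sec) : A.Sec :=
  fun w => (1 / 2 : ℝ) • (ρ w - N.toFun w (ρ w))

/-- The dynamical covariant derivative `∇ρ = h[S, hρ] + v[S, vρ]` induced by `S` and `N`. -/
def nabla (N : A.NonlinearConnection W) (S ρ : A.Sec) : A.Sec :=
  N.h (br S (N.h ρ)) + N.v (br S (N.v ρ))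

end NonlinearConnection

/-- The metric `g = (∂²L/∂y^α∂y^β) 𝒱^α ⊗ 𝒱^β` on the vertical bundle `V𝒯E`. -/
def metric (L : TotalSpace (Fib m) E → ℝ) (ρ ν : A.Sec) (w : TotalSpace (Fib m) E) : ℝ :=
  fiberHess L w (fiberPart n w (ρ w).1.2) (fiberPart n w (ν w).1.2)

namespace NonlinearConnection

variable {W : Set (TotalSpace (Fib m) E)}

/-- `∇g = 0`: for vertical sections, `S(g(ρ, ν)) = g(∇ρ, ν) + g(ρ, ∇ν)`. -/
def IsMetric (N : A.NonlinearConnection W) (L : TotalSpace (Fib m) E → ℝ) (S : A.Sec) : Prop :=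
  ∀ ρ ν : A.Sec, SmoothOn ρ W → SmoothOn ν W →
    (∀ w ∈ W, IsVertical (ρ w)) → (∀ w ∈ W, IsVertical (ν w)) →
    ∀ w ∈ W, D S (metric L ρ ν) w = metric L (N.nabla S ρ) ν w + metric L ρ (N.nabla S ν) w

/-- Compatibility with the Cartan 2-section: `ω_L(hρ, hν) = 0`. -/
def IsSymplectic (N : A.NonlinearConnection W) (L : TotalSpace (Fib m) E → ℝ) : Prop :=
  ∀ ρ ν : A.Sec, SmoothOn ρ W → SmoothOn ν W → ∀ w ∈ W, omega L (N.h ρ) (N.h ν) w = 0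

/-- `N = - ℒ_S J`, i.e. `N(ρ) = -[S, Jρ] + J[S, ρ]`. -/
def IsInducedBy (N : A.NonlinearConnection W) (S : A.Sec) : Prop :=
  ∀ ρ : A.Sec, SmoothOn ρ W → ∀ w ∈ W,
    N.toFun w (ρ w) = -br S (J ρ) w + J (br S ρ) w

end NonlinearConnection

/-! ### Local expressions

`s` is a local frame of `E` over `U ⊆ M` and `y^α` are the fibre coordinates it defines. -/

section Local

variable {s : Fin m → ∀ x, E x} {U : Set M} (hs : IsLocalFrameOn (𝓡 n) (Fib m) ∞ s U)

/-- The fibre coordinate `y^α`. -/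
def fibCoord (α : Fin m) (w : TotalSpace (Fib m) E) : ℝ := hs.coeff α w.proj w.2

/-- The local section `x ↦ y^β(w) s_β(x)` through `w`, with constant fibre coordinates. -/
def constSec (w : TotalSpace (Fib m) E) (x : M) : TotalSpace (Fib m) E :=
  ⟨x, ∑ β, fibCoord hs β w • s β x⟩

/-- The structure functions `L^γ_{αβ}`: `[s_α, s_β] = L^γ_{αβ} s_γ`. -/
def structFun (A : LieAlgebroid n m E) (γ α β : Fin m) (x : M) : ℝ :=
  hs.coeff γ x (A.localBracket (s α) (s β) x)

/-- `σ_α^i ∂f/∂x^i`: the derivative of `f` in the direction `σ(s_α)` at constant `y`. -/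
def dX (A : LieAlgebroid n m E) (α : Fin m) (f : TotalSpace (Fib m) E → ℝ)
    (w : TotalSpace (Fib m) E) : ℝ :=
  mvfderiv (𝓡 n) (f ∘ constSec hs w) w.proj (A.anchor w.proj (s α w.proj))

variable (s) in
/-- `∂f/∂y^α`. -/
def dY (α : Fin m) (f : TotalSpace (Fib m) E → ℝ) (w : TotalSpace (Fib m) E) : ℝ :=
  deriv (fun t : ℝ => f ⟨w.proj, w.2 + t • s α w.proj⟩) 0

variable (s) in
/-- The matrix `g_{αβ} = ∂²L/∂y^α∂y^β`. -/
def gMat (L : TotalSpace (Fib m) E → ℝ) (w : TotalSpace (Fib m) E) :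
    Matrix (Fin m) (Fin m) ℝ :=
  Matrix.of fun α β => fiberHess L w (s α w.proj) (s β w.proj)

open Classical in
variable (A) in
/-- The local section `𝒳_α(w) = (s_α(π(w)), σ_α^i ∂/∂x^i|_w)` of `𝒯E` (over `π⁻¹(U)`, where the
pair does lie in `𝒯_w E`). -/
def frameX (α : Fin m) : A.Sec := fun w =>
  if h : ((s α w.proj, mfderiv (𝓡 n) (IE n m) (constSec hs w) w.proj
      (A.anchor w.proj (s α w.proj))) : E w.proj × TangentSpace (IE n m) w) ∈ A.prolong w
  then ⟨_, h⟩ else 0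

namespace NonlinearConnection

variable {W : Set (TotalSpace (Fib m) E)} (N : A.NonlinearConnection W)

/-- The local coefficient `N^α_β` (upper index first), given by
`h(𝒳_β) = 𝒳_β - N^α_β 𝒱_α`, that is `N^α_β = - dy^α(h(𝒳_β))`. -/
def coeff (α β : Fin m) (w : TotalSpace (Fib m) E) : ℝ :=
  -D (N.h (frameX A hs β)) (fibCoord hs α) w

/-- `N_{αβ} = g_{αγ} N^γ_β`. -/
def low (L : TotalSpace (Fib m) E → ℝ) (α β : Fin m) (w : TotalSpace (Fib m) E) : ℝ :=
  ∑ γ, gMat s L w α γ * N.coeff hs γ β w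

end NonlinearConnection

/-- `S(g_{αβ}) + (g_{γβ} L^γ_{αε} + g_{γα} L^γ_{βε}) y^ε`. -/
def symPart (L : TotalSpace (Fib m) E → ℝ) (S : A.Sec) (α β : Fin m)
    (w : TotalSpace (Fib m) E) : ℝ :=
  D S (fun w' => gMat s L w' α β) w
    + ∑ ε, ∑ γ, (gMat s L w γ β * structFun hs A γ α ε w.proj
        + gMat s L w γ α * structFun hs A γ β ε w.proj) * fibCoord hs ε w

/-- `σ_β^i ∂²L/∂x^i∂y^α - σ_α^i ∂²L/∂x^i∂y^β + L^γ_{αβ} ∂L/∂y^γ`. -/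
def skewPart (A : LieAlgebroid n m E) (L : TotalSpace (Fib m) E → ℝ) (α β : Fin m)
    (w : TotalSpace (Fib m) E) : ℝ :=
  dX hs A β (dY s α L) w - dX hs A α (dY s β L) w
    + ∑ γ, structFun hs A γ α β w.proj * dY s γ L w

end Local

end LieAlgebroid

end

/-! ### Derivatives of functions along vector fields on manifolds. -/

section Calculus

variable {𝔼 : Type*} [NormedAddCommGroup 𝔼] [NormedSpace ℝ 𝔼]
  {H : Type*} [TopologicalSpace H] {I : ModelWithCorners ℝ 𝔼 H}
  {N : Type*} [TopologicalSpace N] [ChartedSpace H N]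

/-! Over a frame domain an element of `𝒯_w E` is determined by its components `uc` along `𝒳_α` and
`vc` along `𝒱_α` (`prolong_ext`, `prolong_decomp`), and the bracket has the expected components
(`uc_br`, `vc_br`). Write `∂_α` for `∂/∂y^α`. The derivatives of the components cancel in `ω_L`, and
with `ρ^α = uc ρ`, `ν^α = uc ν` there remains the tensorial formula `ω_L(ρ, ν) = ν^β ρ(∂_β L) - ρ^α
ν(∂_α L) - ρ^α ν^β L^γ_{αβ} ∂_γ L` (`omega_eq`).

Testing `i_S ω_L = -dE_L` on `𝒱_δ` gives `g (uc S - y) = 0`, so `S` is a semispray; testing on `𝒳_β`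
gives the Euler–Lagrange equations `S(∂_β L) = 𝒳_β L + y^α L^γ_{αβ} ∂_γ L`. Since `g` is invertible,
they determine the vertical components of `S`. The local solutions agree on overlaps because the
equation they solve is frame-free.

For a semispray, `-ℒ_S J` acts on components by `(u, v) ↦ (u, -v + B u)` with `B^γ_β = ∂_β S^γ + y^α
L^γ_{αβ}` (`inducedCoeff`); this is an involution with the vertical bundle as its `-1`-eigenspace,
and `N^γ_β = -B^γ_β / 2`. The link with `L` comes from differentiating the Euler–Lagrange equations
along the fibres (`D_frameV_eulerLagrange`): this yields `g_{αγ} B^γ_β = -(symPart + skewPart)_{αβ}`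
(`sum_inducedCoeff_mul_gMat`), that is `N_{αβ} = (symPart + skewPart)_{αβ} / 2`, with one symmetric
and one skew summand.

For an arbitrary connection, the failure of `∇g = 0` has the coefficients `N_{αβ} + N_{βα} -
symPart_{αβ}` (`D_metric_sub`, `metric_defect`), and `ω_L(h𝒳_α, h𝒳_β) = N_{αβ} - N_{βα} -
skewPart_{αβ}` (`omega_h_h`). So each property prescribes exactly one half of the matrix `N_{αβ}`.
The canonical connection has both, and as `g` is invertible no other connection does. -/

lemma Filter.EventuallyEq.mvfderiv_eq {F : Type*} [NormedAddCommGroup F] [NormedSpace ℝ F]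
    {f g : N → F} {x : N} (h : f =ᶠ[𝓝 x] g) (v : TangentSpace I x) :
    mvfderiv I f x v = mvfderiv I g x v := by
  have := h.mfderiv_eq (I := I) (I' := 𝓘(ℝ, F))
  show (mfderiv I 𝓘(ℝ, F) f x) v = (mfderiv I 𝓘(ℝ, F) g x) v
  exact congrArg (fun T : 𝔼 →L[ℝ] F => T v) this

/-- Here `Z` is a vector field along the map `p`. The cases needed are `p = id` and the projection
`E → M`. -/
lemma ContMDiffAt.mvfderiv_comp_apply {𝔼' : Type*} [NormedAddCommGroup 𝔼'] [NormedSpace ℝ 𝔼']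
    {H' : Type*} [TopologicalSpace H'] {I' : ModelWithCorners ℝ 𝔼' H'}
    {N' : Type*} [TopologicalSpace N'] [ChartedSpace H' N'] [IsManifold I ∞ N] [IsManifold I' ∞ N']
    {f : N' → ℝ} {p : N → N'} {x : N} {Z : ∀ y : N, TangentSpace I' (p y)}
    (hf : ContMDiffAt I' 𝓘(ℝ, ℝ) ∞ f (p x))
    (hZ : ContMDiffAt I I'.tangent ∞ (fun y => (⟨p y, Z y⟩ : TangentBundle I' N')) x) :
    ContMDiffAt I 𝓘(ℝ, ℝ) ∞ (fun y => mvfderiv I' f (p y) (Z y)) x := by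
  have : IsManifold I' (∞ + 1) N' := by simpa
  have : IsManifold I' 1 N' := IsManifold.of_le (n := ∞) (by simp)
  have hp : ContMDiffAt I I' ∞ p x := (contMDiffAt_totalSpace.1 hZ).1
  have h1 := ContMDiffAt.mfderiv (x₀ := x) (fun _ : N => f) p
    (ContMDiffAt.comp (x, p x) hf contMDiffAt_snd) hp (m := ∞) (by simp)
  have h2 : ContMDiffAt I 𝓘(ℝ, ℝ).tangent ∞
      (fun y => (⟨f (p y), mfderiv I' 𝓘(ℝ, ℝ) f (p y) (Z y)⟩ : TangentBundle 𝓘(ℝ, ℝ) ℝ)) x :=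
    ContMDiffAt.clm_apply_of_inCoordinates (b₁ := p) (b₂ := f ∘ p) h1 hZ (hf.comp x hp)
  exact (contMDiff_snd_tangentBundle_modelSpace ℝ 𝓘(ℝ, ℝ)).contMDiffAt.comp x h2

lemma ContMDiffAt.mvfderiv_apply [IsManifold I ∞ N] {f : N → ℝ} {x : N}
    {Y : ∀ y : N, TangentSpace I y}
    (hf : ContMDiffAt I 𝓘(ℝ, ℝ) ∞ f x)
    (hY : ContMDiffAt I I.tangent ∞ (fun y => (⟨y, Y y⟩ : TangentBundle I N)) x) :
    ContMDiffAt I 𝓘(ℝ, ℝ) ∞ (fun y => mvfderiv I f y (Y y)) x :=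
  ContMDiffAt.mvfderiv_comp_apply (p := id) hf hY

/-- The identity `[X, Y] f = X(Y f) - Y(X f)`. In a chart it is the symmetry of the second
derivative of `f`. -/
lemma mvfderiv_mlieBracket [IsManifold I ∞ N] [I.Boundaryless] [CompleteSpace 𝔼] {f : N → ℝ} {x : N}
    {X Y : ∀ y : N, TangentSpace I y}
    (hf : ContMDiffAt I 𝓘(ℝ, ℝ) ∞ f x)
    (hX : ContMDiffAt I I.tangent ∞ (fun y => (⟨y, X y⟩ : TangentBundle I N)) x)
    (hY : ContMDiffAt I I.tangent ∞ (fun y => (⟨y, Y y⟩ : TangentBundle I N)) x) :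
    mvfderiv I f x (VectorField.mlieBracket I X Y x) =
      mvfderiv I (fun y => mvfderiv I f y (Y y)) x (X x)
        - mvfderiv I (fun y => mvfderiv I f y (X y)) x (Y x) := by
  have i2 : IsManifold I 2 N := IsManifold.of_le (n := ∞) (by norm_cast)
  have i1 : IsManifold I 1 N := IsManifold.of_le (n := ∞) (by simp)
  set φ := extChartAt I x with hφ
  have key : ∀ (g : N → ℝ), MDifferentiableAt I 𝓘(ℝ, ℝ) g x → ∀ v : TangentSpace I x,
      mvfderiv I g x v = fderiv ℝ (g ∘ φ.symm) (φ x) v := by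
    intro g hg v
    rw [hg.mvfderiv]
    simp [writtenInExtChartAt, I.range_eq_univ]
    rfl
  -- Near the centre of the chart, differentiating `f` along `Z` commutes with passing to the chart.
  -- A whole neighbourhood is needed because the result is differentiated again.
  have pull : ∀ (Z : ∀ y : N, TangentSpace I y),
      (fun y => fderiv ℝ (f ∘ φ.symm) y (VectorField.mpullbackWithin 𝓘(ℝ, 𝔼) I φ.symm Z (range I) y))
        =ᶠ[𝓝 (φ x)] (fun y => mvfderiv I f y (Z y)) ∘ φ.symm := by
    intro Z
    have hf1 : ∀ᶠ y in 𝓝 x, MDifferentiableAt I 𝓘(ℝ, ℝ) f y := by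
      have := (contMDiffAt_iff_contMDiffAt_nhds (n := 1) (by simp)).1 (hf.of_le (by simp))
      exact this.mono fun y hy => hy.mdifferentiableAt one_ne_zero
    have hc : ContinuousAt φ.symm (φ x) := continuousAt_extChartAt_symm x
    have hf2 := hc.eventually (by rw [hφ, extChartAt_to_inv]; exact hf1)
    filter_upwards [hf2, extChartAt_target_mem_nhds x] with y hy hyt
    have hsymm : MDifferentiableAt 𝓘(ℝ, 𝔼) I φ.symm y :=
      (contMDiffWithinAt_extChartAt_symm_range (n := 1) x hyt).contMDiffAt
        (by simp [I.range_eq_univ]) |>.mdifferentiableAt one_ne_zero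
    have := mfderiv_comp_apply y hy hsymm
      (VectorField.mpullbackWithin 𝓘(ℝ, 𝔼) I φ.symm Z (range I) y)
    rw [mfderiv_eq_fderiv] at this
    refine this.trans ?_
    have hinv := isInvertible_mfderivWithin_extChartAt_symm hyt
    have h3 : mfderiv 𝓘(ℝ, 𝔼) I φ.symm y
        (VectorField.mpullbackWithin 𝓘(ℝ, 𝔼) I φ.symm Z (range I) y) = Z (φ.symm y) := by
      rw [VectorField.mpullbackWithin_apply]
      rw [I.range_eq_univ, mfderivWithin_univ] at hinv ⊢
      exact hinv.self_apply_inverse _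
    rw [h3]
    rfl
  -- The chart at `x` has the identity as its differential at `x`, so the pulled-back field has the
  -- value `Z x` there.
  have hsub : ∀ (Z : ∀ y : N, TangentSpace I y),
      VectorField.mpullbackWithin 𝓘(ℝ, 𝔼) I φ.symm Z (range I) (φ x) = Z x := by
    intro Z
    rw [VectorField.mpullbackWithin_apply]
    have h := mfderivWithin_extChartAt_symm_inverse_apply (Z x)
    have e : φ.symm (φ x) = x := extChartAt_to_inv x
    have e2 : (Z (φ.symm (φ x)) : 𝔼) = Z x := congrArg (fun y => (Z y : 𝔼)) e
    exact (congrArg (fun v : 𝔼 => ((mfderivWithin 𝓘(ℝ, 𝔼) I φ.symm (range I) (φ x)).inverse :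
      𝔼 → 𝔼) v) e2).trans h
  have hdf : ∀ (Z : ∀ y : N, TangentSpace I y)
      (hZ : ContMDiffAt I I.tangent ∞ (fun y => (⟨y, Z y⟩ : TangentBundle I N)) x),
      MDifferentiableAt I 𝓘(ℝ, ℝ) (fun y => mvfderiv I f y (Z y)) x := fun Z hZ =>
    (hf.mvfderiv_apply hZ).mdifferentiableAt (by simp)
  have hdp : ∀ (Z : ∀ y : N, TangentSpace I y)
      (hZ : ContMDiffAt I I.tangent ∞ (fun y => (⟨y, Z y⟩ : TangentBundle I N)) x),
      DifferentiableAt ℝ (VectorField.mpullbackWithin 𝓘(ℝ, 𝔼) I φ.symm Z (range I)) (φ x) := by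
    intro Z hZ
    have := (hZ.mdifferentiableAt (by simp)).mdifferentiableWithinAt (s := univ)
      |>.differentiableWithinAt_mpullbackWithin_vectorField
    rw [preimage_univ, univ_inter] at this
    exact this.differentiableAt (by simp [I.range_eq_univ])
  have hfc : ContDiffAt ℝ ∞ (f ∘ φ.symm) (φ x) := by
    have := (contMDiffAt_iff.1 hf).2
    simp [I.range_eq_univ, contDiffWithinAt_univ] at this
    exact this
  rw [key f (hf.mdifferentiableAt (by simp)), key _ (hdf Y hY), key _ (hdf X hX),
    ← (pull Y).fderiv_eq, ← (pull X).fderiv_eq, ← hsub X, ← hsub Y]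
  rw [← VectorField.fderiv_apply_lieBracket hfc (by simp; norm_cast) (hdp Y hY) (hdp X hX)]
  congr 1
  have hid : mfderiv I 𝓘(ℝ, 𝔼) φ x = ContinuousLinearMap.id ℝ 𝔼 := mfderiv_extChartAt_self
  have hid' : (mfderiv I 𝓘(ℝ, 𝔼) φ x).inverse = ContinuousLinearMap.id ℝ 𝔼 :=
    (congrArg (fun T : 𝔼 →L[ℝ] 𝔼 => T.inverse) hid).trans ContinuousLinearMap.inverse_id
  rw [← VectorField.mlieBracketWithin_univ, VectorField.mlieBracketWithin_apply]
  refine (congrArg (fun T : 𝔼 →L[ℝ] 𝔼 => T _) hid').trans ?_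
  rw [preimage_univ, univ_inter, I.range_eq_univ]
  exact congrFun VectorField.lieBracketWithin_univ _

lemma mdifferentiableAt_extChartAt_center [IsManifold I 1 N] (x : N) :
    MDifferentiableAt I 𝓘(ℝ, 𝔼) (extChartAt I x) x :=
  (contMDiffAt_extChartAt (n := 1)).mdifferentiableAt one_ne_zero

/-- The derivative of a linear function of a vector-valued map. -/
lemma mvfderiv_clm_comp {F : Type*} [NormedAddCommGroup F] [NormedSpace ℝ F] (l : F →L[ℝ] ℝ)
    {G : N → F} {x : N} (hG : MDifferentiableAt I 𝓘(ℝ, F) G x) (v : TangentSpace I x) :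
    mvfderiv I (fun y => l (G y)) x v = l (mvfderiv I G x v) := by
  have h1 := mfderiv_comp_apply (I' := 𝓘(ℝ, F)) (I'' := 𝓘(ℝ, ℝ)) x
    (l.differentiableAt.mdifferentiableAt) hG v
  refine h1.trans ?_
  rw [mfderiv_eq_fderiv, l.fderiv]
  rfl

/-- A tangent vector is determined by the derivatives of the coordinate functions along it. -/
lemma tangent_ext_of_mvfderiv [IsManifold I ∞ N] {x : N} {v v' : TangentSpace I x}
    (h : ∀ l : 𝔼 →L[ℝ] ℝ, mvfderiv I (fun y => l (extChartAt I x y)) x v =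
      mvfderiv I (fun y => l (extChartAt I x y)) x v') :
    v = v' := by
  have i1 : IsManifold I 1 N := IsManifold.of_le (n := ∞) (by simp)
  -- The chart centred at `x` has identity differential at `x`, so these derivatives are the values
  -- of the linear forms on the vector.
  have key : ∀ (l : 𝔼 →L[ℝ] ℝ) (v : 𝔼),
      mvfderiv I (fun y => l (extChartAt I x y)) x v = l v := by
    intro l v
    have hid : mfderiv I 𝓘(ℝ, 𝔼) (extChartAt I x) x = ContinuousLinearMap.id ℝ 𝔼 :=
      mfderiv_extChartAt_self
    refine (mvfderiv_clm_comp l (mdifferentiableAt_extChartAt_center (I := I) x) v).trans ?_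
    exact congrArg (fun T : 𝔼 →L[ℝ] 𝔼 => l (T v)) hid
  refine (SeparatingDual.eq_iff_forall_dual_eq (R := ℝ) (V := 𝔼)).2 fun l => ?_
  exact (key l v).symm.trans ((h l).trans (key l v'))

/-- A vector field is smooth if the derivatives of the coordinate functions along it are. -/
lemma contMDiffAt_vectorField_of_mvfderiv [IsManifold I ∞ N] [FiniteDimensional ℝ 𝔼] {x : N}
    {Y : ∀ y : N, TangentSpace I y}
    (h : ∀ l : 𝔼 →L[ℝ] ℝ, ContMDiffAt I 𝓘(ℝ, ℝ) ∞
      (fun z => mvfderiv I (fun y => l (extChartAt I x y)) z (Y z)) x) :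
    ContMDiffAt I I.tangent ∞ (fun y => (⟨y, Y y⟩ : TangentBundle I N)) x := by
  have i1 : IsManifold I 1 N := IsManifold.of_le (n := ∞) (by simp)
  refine (Bundle.contMDiffAt_section x).2 ?_
  let b := Module.finBasis ℝ 𝔼
  have hsum : ContMDiffAt I 𝓘(ℝ, 𝔼) ∞ (fun z => ∑ i,
      mvfderiv I (fun y => (b.coord i).toContinuousLinearMap (extChartAt I x y)) z (Y z) • b i) x :=
    ContMDiffAt.sum fun i _ => (h _).smul contMDiffAt_const
  refine hsum.congr_of_eventuallyEq ?_
  filter_upwards [(chartAt H x).open_source.mem_nhds (mem_chart_source H x)] with z hz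
  have hd : MDifferentiableAt I 𝓘(ℝ, 𝔼) (extChartAt I x) z :=
    (contMDiffAt_extChartAt' (n := 1) hz).mdifferentiableAt one_ne_zero
  have h1 : (trivializationAt 𝔼 (TangentSpace I) x ⟨z, Y z⟩).2
      = mvfderiv I (extChartAt I x) z (Y z) := by
    have h2 := TangentBundle.continuousLinearMapAt_trivializationAt (I := I) hz
    refine Eq.trans ?_ (congrArg (fun T : 𝔼 →L[ℝ] 𝔼 => T (Y z)) h2)
    have := Trivialization.continuousLinearMapAt_apply_of_mem (R := ℝ)
      (trivializationAt 𝔼 (TangentSpace I) x) (b := z) (by simpa using hz) (Y z)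
    exact this.symm
  rw [h1]
  refine (b.sum_repr _).symm.trans (Finset.sum_congr rfl fun i _ => ?_)
  rw [mvfderiv_clm_comp _ hd]
  rfl

end Calculus

/-! ### Smoothness of the inverse matrix. -/

section Matrix

lemma ContDiff.matrix_det {V : Type*} [NormedAddCommGroup V] [NormedSpace ℝ V] {m : ℕ}
    {B : V → Matrix (Fin m) (Fin m) ℝ} (hB : ∀ i j, ContDiff ℝ ∞ fun x => B x i j) :
    ContDiff ℝ ∞ fun x => (B x).det := by
  simp only [Matrix.det_apply]
  refine ContDiff.sum fun τ _ => ContDiff.const_smul _ (contDiff_prod fun i _ => hB _ _)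

/-- Cramer's rule: the inverse is the adjugate over the determinant, both polynomial in the entries.
-/
lemma ContMDiffAt.matrix_inv_apply {𝔼 : Type*} [NormedAddCommGroup 𝔼] [NormedSpace ℝ 𝔼]
    {H : Type*} [TopologicalSpace H] {I : ModelWithCorners ℝ 𝔼 H}
    {N : Type*} [TopologicalSpace N] [ChartedSpace H N] {m : ℕ}
    {B : N → Matrix (Fin m) (Fin m) ℝ} {x : N}
    (hB : ∀ i j, ContMDiffAt I 𝓘(ℝ, ℝ) ∞ (fun y => B y i j) x) (h0 : (B x).det ≠ 0)
    (i j : Fin m) : ContMDiffAt I 𝓘(ℝ, ℝ) ∞ (fun y => (B y)⁻¹ i j) x := by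
  have hB' : ContMDiffAt I 𝓘(ℝ, Fin m → Fin m → ℝ) ∞ (fun y i j => B y i j) x :=
    contMDiffAt_pi_space.2 fun i => contMDiffAt_pi_space.2 fun j => hB i j
  have hd : ContDiff ℝ ∞ (fun C : Fin m → Fin m → ℝ => (Matrix.of C).det) :=
    ContDiff.matrix_det fun i j => by
      simp only [Matrix.of_apply]; fun_prop
  have ha : ContDiff ℝ ∞ (fun C : Fin m → Fin m → ℝ => (Matrix.of C).adjugate i j) := by
    simp only [Matrix.adjugate_apply]
    refine ContDiff.matrix_det fun k l => ?_
    by_cases hk : k = j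
    · subst hk; simp only [Matrix.updateRow_self]; fun_prop
    · simp only [Matrix.updateRow_ne hk, Matrix.of_apply]; fun_prop
  have hq : ContDiffAt ℝ ∞ (fun C : Fin m → Fin m → ℝ => (Matrix.of C)⁻¹ i j) (B x) := by
    simp only [Matrix.inv_def, Ring.inverse_eq_inv', Matrix.smul_apply, smul_eq_mul]
    exact (hd.contDiffAt.inv h0).mul ha.contDiffAt
  exact ContMDiffAt.comp (I' := 𝓘(ℝ, Fin m → Fin m → ℝ)) (f := fun y i j => B y i j) x hq.contMDiffAt hB'

end Matrix


noncomputable section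

set_option linter.unusedSectionVars false

namespace LieAlgebroid

variable {n m : ℕ} {M : Type*} [TopologicalSpace M] [ChartedSpace (EuclideanSpace ℝ (Fin n)) M]
  {E : M → Type*} [TopologicalSpace (TotalSpace (Fib m) E)]
  [∀ x, AddCommGroup (E x)] [∀ x, Module ℝ (E x)] [∀ x, TopologicalSpace (E x)]
  [FiberBundle (Fib m) E] [VectorBundle ℝ (Fib m) E]
  [IsManifold (𝓡 n) ∞ M] [ContMDiffVectorBundle ∞ (Fib m) E (𝓡 n)]
  {A : LieAlgebroid n m E}

/-! ### Locality of the bracket and its extension to germs of sections. -/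

section LocalBracket

variable (n m) in
/-- The germ of `s` at `x` is the germ of a global smooth section. -/
def HasSmoothGerm (s : ∀ x, E x) (x : M) : Prop :=
  ∃ p : Cₛ^∞⟮𝓡 n; Fib m, E⟯, ∀ᶠ y in 𝓝 x, p y = s y

/-- The germ of `f` at `x` is the germ of a global smooth function. -/
def HasSmoothFunGerm (n : ℕ) {M : Type*} [TopologicalSpace M]
    [ChartedSpace (EuclideanSpace ℝ (Fin n)) M] (f : M → ℝ) (x : M) : Prop :=
  ∃ g : M → ℝ, ContMDiff (𝓡 n) 𝓘(ℝ, ℝ) ∞ g ∧ g =ᶠ[𝓝 x] f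

lemma exists_bump [T2Space M] {U : Set M} {x : M} (hU : U ∈ 𝓝 x) :
    ∃ χ : M → ℝ, ContMDiff (𝓡 n) 𝓘(ℝ, ℝ) ∞ χ ∧ tsupport χ ⊆ U ∧ χ =ᶠ[𝓝 x] 1 := by
  obtain ⟨f, -, hf⟩ := (SmoothBumpFunction.nhds_basis_tsupport (I := 𝓡 n) x).mem_iff.1 hU
  exact ⟨f, f.contMDiff, hf, f.eventuallyEq_one⟩

lemma hasSmoothGerm_of_contMDiffOn [T2Space M] {s : ∀ x, E x} {U : Set M} (hU : IsOpen U)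
    (hs : ContMDiffOn (𝓡 n) (IE n m) ∞ (fun x => (⟨x, s x⟩ : TotalSpace (Fib m) E)) U)
    {x : M} (hx : x ∈ U) : HasSmoothGerm n m s x := by
  obtain ⟨χ, h1, h2, h3⟩ := exists_bump (n := n) (hU.mem_nhds hx)
  refine ⟨⟨χ • s, ContMDiffOn.smul_section_of_tsupport h1.contMDiffOn hU h2 hs⟩, ?_⟩
  filter_upwards [h3] with y hy
  show χ y • s y = s y
  rw [hy]; simp

lemma hasSmoothFunGerm_of_contMDiffOn [T2Space M] {f : M → ℝ} {U : Set M} (hU : IsOpen U)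
    (hf : ContMDiffOn (𝓡 n) 𝓘(ℝ, ℝ) ∞ f U)
    {x : M} (hx : x ∈ U) : HasSmoothFunGerm n f x := by
  obtain ⟨χ, h1, h2, h3⟩ := exists_bump (n := n) (hU.mem_nhds hx)
  refine ⟨fun y => χ y * f y, contMDiff_of_tsupport fun y hy => ?_, ?_⟩
  · have : y ∈ U := h2 (tsupport_mul_subset_left hy)
    exact h1.contMDiffAt.mul (hf.contMDiffAt (hU.mem_nhds this))
  · filter_upwards [h3] with y hy
    rw [hy]; simp

variable (A) in
lemma bracket_add (s t t' : Cₛ^∞⟮𝓡 n; Fib m, E⟯) :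
    A.bracket s (t + t') = A.bracket s t + A.bracket s t' := by
  rw [A.skew, A.add_bracket, A.skew t, A.skew t', neg_add, neg_neg, neg_neg]

variable (A) in
lemma bracket_zero (s : Cₛ^∞⟮𝓡 n; Fib m, E⟯) : A.bracket s 0 = 0 := by
  have := A.bracket_add s 0 0
  simpa using this

variable (A) in
lemma bracket_sum {ι : Type*} (F : Finset ι) (s : Cₛ^∞⟮𝓡 n; Fib m, E⟯)
    (t : ι → Cₛ^∞⟮𝓡 n; Fib m, E⟯) :
    A.bracket s (∑ i ∈ F, t i) = ∑ i ∈ F, A.bracket s (t i) := by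
  classical
  induction F using Finset.induction_on with
  | empty => simpa using A.bracket_zero s
  | insert a F ha ih => rw [Finset.sum_insert ha, Finset.sum_insert ha, A.bracket_add, ih]

lemma section_sum_apply {ι : Type*} (F : Finset ι) (t : ι → Cₛ^∞⟮𝓡 n; Fib m, E⟯) (x : M) :
    (∑ i ∈ F, t i) x = ∑ i ∈ F, t i x := by
  classical
  induction F using Finset.induction_on with
  | empty => simp
  | insert a F ha ih => rw [Finset.sum_insert ha, Finset.sum_insert ha, ← ih]; rfl

variable (A) in
-- Locality of the bracket, forced by the Leibniz rule. Being Hausdorff enters through the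
-- smoothness of bump functions on all of `M`.
lemma bracket_eq_zero_of_eventually [T2Space M] (s t : Cₛ^∞⟮𝓡 n; Fib m, E⟯) {x : M}
    (h : ∀ᶠ y in 𝓝 x, t y = 0) : A.bracket s t x = 0 := by
  obtain ⟨χ, h1, h2, h3⟩ := exists_bump (n := n) h
  -- With `χ` equal to `1` near `x` and supported where `t = 0`, one has `t = (1 - χ) t`. The
  -- Leibniz rule at `x` then has the coefficients `1 - χ x = 0` and `t x = 0`.
  have := A.leibniz (fun y => 1 - χ y) (contMDiff_const.sub h1) s t t (fun y => by
    by_cases hy : y ∈ tsupport χ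
    · have h4 : t y = 0 := h2 hy
      rw [h4, smul_zero]
    · rw [image_eq_zero_of_notMem_tsupport hy]; simp) x
  rw [this, h3.eq_of_nhds, h.self_of_nhds]
  simp

variable (A) in
lemma bracket_congr_right [T2Space M] (s t t' : Cₛ^∞⟮𝓡 n; Fib m, E⟯) {x : M}
    (h : ∀ᶠ y in 𝓝 x, t y = t' y) : A.bracket s t x = A.bracket s t' x := by
  have h1 : A.bracket s (t - t') x = 0 := A.bracket_eq_zero_of_eventually s _ (h.mono fun y hy => by
    show t y - t' y = 0
    rw [hy, sub_self])
  have h2 := A.bracket_add s (t - t') t'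
  rw [sub_add_cancel] at h2
  rw [h2]
  show A.bracket s (t - t') x + A.bracket s t' x = _
  rw [h1, zero_add]

variable (A) in
lemma bracket_congr [T2Space M] {s s' t t' : Cₛ^∞⟮𝓡 n; Fib m, E⟯} {x : M}
    (hs : ∀ᶠ y in 𝓝 x, s y = s' y) (ht : ∀ᶠ y in 𝓝 x, t y = t' y) :
    A.bracket s t x = A.bracket s' t' x := by
  rw [A.bracket_congr_right s t t' ht, A.skew s, A.skew s']
  show -A.bracket t' s x = -A.bracket t' s' x
  rw [A.bracket_congr_right t' s s' hs]

variable (A) in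
-- By locality the choice of global representatives in `localBracket` is immaterial.
lemma localBracket_eq [T2Space M] {s t : ∀ x, E x} {x : M} {p q : Cₛ^∞⟮𝓡 n; Fib m, E⟯}
    (hp : ∀ᶠ y in 𝓝 x, p y = s y) (hq : ∀ᶠ y in 𝓝 x, q y = t y) :
    A.localBracket s t x = A.bracket p q x := by
  have h : ∃ p : Cₛ^∞⟮𝓡 n; Fib m, E⟯ × Cₛ^∞⟮𝓡 n; Fib m, E⟯,
      (∀ᶠ y in 𝓝 x, p.1 y = s y) ∧ (∀ᶠ y in 𝓝 x, p.2 y = t y) := ⟨(p, q), hp, hq⟩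
  rw [localBracket, dif_pos h]
  refine A.bracket_congr ?_ ?_
  · filter_upwards [h.choose_spec.1, hp] with y h1 h2 using h1.trans h2.symm
  · filter_upwards [h.choose_spec.2, hq] with y h1 h2 using h1.trans h2.symm

variable (A) in
lemma localBracket_skew [T2Space M] {s t : ∀ x, E x} {x : M} (hs : HasSmoothGerm n m s x)
    (ht : HasSmoothGerm n m t x) : A.localBracket s t x = -A.localBracket t s x := by
  obtain ⟨p, hp⟩ := hs
  obtain ⟨q, hq⟩ := ht
  rw [A.localBracket_eq hp hq, A.localBracket_eq hq hp, A.skew]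
  rfl

variable (A) in
-- The Leibniz rule for germs, in the form needed to expand a section in a frame that exists only
-- locally.
lemma localBracket_sum_smul_right [T2Space M] {ι : Type*} [Fintype ι] {s : ∀ x, E x}
    {t : ι → ∀ x, E x} {c : ι → M → ℝ} {u : ∀ x, E x} {x : M} (hs : HasSmoothGerm n m s x)
    (ht : ∀ i, HasSmoothGerm n m (t i) x) (hc : ∀ i, HasSmoothFunGerm n (c i) x)
    (hu : ∀ᶠ y in 𝓝 x, u y = ∑ i, c i y • t i y) :
    A.localBracket s u x = ∑ i, (c i x • A.localBracket s (t i) x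
      + mvfderiv (𝓡 n) (c i) x (A.anchor x (s x)) • t i x) := by
  obtain ⟨p, hp⟩ := hs
  choose q hq using ht
  choose g hg hgc using hc
  let r : ι → Cₛ^∞⟮𝓡 n; Fib m, E⟯ := fun i => ⟨g i • q i, (hg i).smul_section (q i).contMDiff⟩
  have hr : ∀ i y, r i y = g i y • q i y := fun i y => rfl
  have hsum : ∀ᶠ y in 𝓝 x, (∑ i, r i) y = u y := by
    filter_upwards [hu, eventually_all.2 hq, eventually_all.2 hgc] with y h1 h2 h3
    rw [h1, section_sum_apply]
    exact Finset.sum_congr rfl fun i _ => by rw [hr, h2, h3]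
  rw [A.localBracket_eq hp hsum, A.bracket_sum, section_sum_apply]
  refine Finset.sum_congr rfl fun i _ => ?_
  rw [A.leibniz (g i) (hg i) p (q i) (r i) (hr i) x, A.localBracket_eq hp (hq i),
    (hgc i).eq_of_nhds, (hq i).self_of_nhds, hp.self_of_nhds, (hgc i).mvfderiv_eq]

variable (A) in
lemma localBracket_sum_smul_left [T2Space M] {ι : Type*} [Fintype ι] {s : ∀ x, E x}
    {t : ι → ∀ x, E x} {c : ι → M → ℝ} {u : ∀ x, E x} {x : M} (hs : HasSmoothGerm n m s x)
    (ht : ∀ i, HasSmoothGerm n m (t i) x) (hc : ∀ i, HasSmoothFunGerm n (c i) x)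
    (hu' : HasSmoothGerm n m u x)
    (hu : ∀ᶠ y in 𝓝 x, u y = ∑ i, c i y • t i y) :
    A.localBracket u s x = ∑ i, (c i x • A.localBracket (t i) s x
      - mvfderiv (𝓡 n) (c i) x (A.anchor x (s x)) • t i x) := by
  rw [A.localBracket_skew hu' hs, A.localBracket_sum_smul_right hs ht hc hu,
    ← Finset.sum_neg_distrib]
  refine Finset.sum_congr rfl fun i _ => ?_
  rw [A.localBracket_skew (ht i) hs, smul_neg, neg_add, sub_eq_add_neg]

variable (A) in
lemma anchor_localBracket [T2Space M] {s t : ∀ x, E x} {x : M} (hs : HasSmoothGerm n m s x)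
    (ht : HasSmoothGerm n m t x) :
    A.anchor x (A.localBracket s t x) =
      VectorField.mlieBracket (𝓡 n) (fun y => A.anchor y (s y)) (fun y => A.anchor y (t y)) x := by
  obtain ⟨p, hp⟩ := hs
  obtain ⟨q, hq⟩ := ht
  rw [A.localBracket_eq hp hq, A.anchor_bracket]
  exact Filter.EventuallyEq.mlieBracket_vectorField_eq (hp.mono fun y hy => congrArg (A.anchor y) hy)
    (hq.mono fun y hy => congrArg (A.anchor y) hy)

variable (A) in
lemma contMDiffAt_localBracket [T2Space M] {s t : ∀ x, E x} {x : M}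
    (hs : HasSmoothGerm n m s x) (ht : HasSmoothGerm n m t x) :
    ContMDiffAt (𝓡 n) (IE n m) ∞
      (fun x => (⟨x, A.localBracket s t x⟩ : TotalSpace (Fib m) E)) x := by
  obtain ⟨p, hp⟩ := hs
  obtain ⟨q, hq⟩ := ht
  refine (A.bracket p q).contMDiff.contMDiffAt.congr_of_eventuallyEq ?_
  -- Having `p` and `q` as representatives near `x` is an open condition on the point, so one pair
  -- computes the local bracket on a neighbourhood.
  filter_upwards [hp.eventually_nhds, hq.eventually_nhds] with y h1 h2
  rw [A.localBracket_eq h1 h2]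

end LocalBracket

/-! ### Local frames, their coefficients, and coordinates on the total space. -/

section Frames

/-- A real function on the total space is smooth at `w`. -/
abbrev Sm (f : TotalSpace (Fib m) E → ℝ) (w : TotalSpace (Fib m) E) : Prop :=
  ContMDiffAt (IE n m) 𝓘(ℝ, ℝ) ∞ f w

variable {s : Fin m → ∀ x, E x} {U : Set M} (hs : IsLocalFrameOn (𝓡 n) (Fib m) ∞ s U)

lemma frame_coeff_self {x : M} (hx : x ∈ U) (α β : Fin m) :
    hs.coeff α x (s β x) = if α = β then 1 else 0 := by
  have h := hs.coeff_apply_of_mem hx (s β) α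
  rw [h, ← hs.toBasisAt_coe hx β, Module.Basis.repr_self, Finsupp.single_apply]
  simp [eq_comm]

lemma frame_sum_coeff {x : M} (hx : x ∈ U) (v : E x) : ∑ α, hs.coeff α x v • s α x = v := by
  have := (hs.toBasisAt hx).sum_repr v
  simpa [IsLocalFrameOn.coeff, hx] using this

lemma frame_coeff_sum {x : M} (hx : x ∈ U) (c : Fin m → ℝ) (α : Fin m) :
    hs.coeff α x (∑ β, c β • s β x) = c α := by
  simp [map_sum, frame_coeff_self hs hx]

lemma frame_ext {x : M} (hx : x ∈ U) {v v' : E x} (h : ∀ α, hs.coeff α x v = hs.coeff α x v') :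
    v = v' := by
  rw [← frame_sum_coeff hs hx v, ← frame_sum_coeff hs hx v']
  simp [h]

lemma triv_sum (e : Trivialization (Fib m) (TotalSpace.proj : TotalSpace (Fib m) E → M))
    [MemTrivializationAtlas e] {x : M} (hx : x ∈ e.baseSet) {ι : Type*} [Fintype ι]
    (c : ι → ℝ) (t : ι → E x) :
    (e (⟨x, ∑ i, c i • t i⟩ : TotalSpace (Fib m) E)).2 =
      ∑ i, c i • (e (⟨x, t i⟩ : TotalSpace (Fib m) E)).2 := by
  simp only [← e.continuousLinearMapAt_apply_of_mem (R := ℝ) hx, map_sum, map_smul]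

/-- A vector in the kernel of the matrix would be a linear relation among the frame vectors. -/
lemma frame_det_ne_zero (hs : IsLocalFrameOn (𝓡 n) (Fib m) ∞ s U)
    (e : Trivialization (Fib m) (TotalSpace.proj : TotalSpace (Fib m) E → M))
    [MemTrivializationAtlas e] {x : M} (hx : x ∈ e.baseSet) (hxU : x ∈ U) :
    (Matrix.of fun a α => (e (⟨x, s α x⟩ : TotalSpace (Fib m) E)).2 a :
      Matrix (Fin m) (Fin m) ℝ).det ≠ 0 := by
  intro h
  obtain ⟨c, hc, h0⟩ := Matrix.exists_mulVec_eq_zero_iff.2 h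
  apply hc
  have h1 : (e (⟨x, ∑ i, c i • s i x⟩ : TotalSpace (Fib m) E)).2 = 0 := by
    rw [triv_sum e hx]
    ext a
    have := congrFun h0 a
    simp only [Matrix.mulVec, dotProduct, Matrix.of_apply, Pi.zero_apply] at this
    simp only [WithLp.ofLp_sum, Finset.sum_apply, PiLp.smul_apply, smul_eq_mul, PiLp.zero_apply]
    rw [← this]
    exact Finset.sum_congr rfl fun i _ => mul_comm _ _
  rw [← e.continuousLinearMapAt_apply_of_mem (R := ℝ) hx] at h1
  have h2 := e.symmL_continuousLinearMapAt (R := ℝ) hx (∑ i, c i • s i x)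
  rw [h1, map_zero] at h2
  ext α
  rw [← frame_coeff_sum hs hxU c α, ← h2, map_zero]
  rfl

section Along

variable {𝔼 : Type*} [NormedAddCommGroup 𝔼] [NormedSpace ℝ 𝔼]
  {H : Type*} [TopologicalSpace H] {I : ModelWithCorners ℝ 𝔼 H}
  {N : Type*} [TopologicalSpace N] [ChartedSpace H N]

lemma contMDiffAt_triv_frame (hs : IsLocalFrameOn (𝓡 n) (Fib m) ∞ s U) (hU : IsOpen U)
    (e : Trivialization (Fib m) (TotalSpace.proj : TotalSpace (Fib m) E → M))
    [MemTrivializationAtlas e] {x : M} (hx : x ∈ e.baseSet) (hxU : x ∈ U) (α : Fin m) :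
    ContMDiffAt (𝓡 n) 𝓘(ℝ, Fib m) ∞ (fun x => (e (⟨x, s α x⟩ : TotalSpace (Fib m) E)).2) x :=
  (e.contMDiffAt_section_iff hx).1 (hs.contMDiffAt hU hxU α)

lemma contMDiffAt_frame_coeff (hU : IsOpen U) {f : N → TotalSpace (Fib m) E} {y : N}
    (hf : ContMDiffAt I (IE n m) ∞ f y) (hy : (f y).proj ∈ U) (α : Fin m) :
    ContMDiffAt I 𝓘(ℝ, ℝ) ∞ (fun z => hs.coeff α (f z).proj (f z).2) y := by
  let e := trivializationAt (Fib m) E (f y).proj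
  have hp : ContMDiffAt I (𝓡 n) ∞ (fun z => (f z).proj) y := (contMDiffAt_totalSpace.1 hf).1
  have hf2 : ContMDiffAt I 𝓘(ℝ, Fib m) ∞ (fun z => (e (f z)).2) y :=
    (contMDiffAt_totalSpace.1 hf).2
  have hye : (f y).proj ∈ e.baseSet := FiberBundle.mem_baseSet_trivializationAt' _
  have hcoord : ∀ a : Fin m, ContMDiff 𝓘(ℝ, Fib m) 𝓘(ℝ, ℝ) ∞ (fun v : Fib m => v a) := fun a =>
    (EuclideanSpace.proj (𝕜 := ℝ) a).contDiff.contMDiff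
  -- The frame read in the trivialization. The frame coefficients of `f z` are `B⁻¹` applied to its
  -- coordinates there, and this expression is visibly smooth.
  let B : N → Matrix (Fin m) (Fin m) ℝ := fun z =>
    Matrix.of fun a α => (e (⟨(f z).proj, s α (f z).proj⟩ : TotalSpace (Fib m) E)).2 a
  have hB : ∀ a β, ContMDiffAt I 𝓘(ℝ, ℝ) ∞ (fun z => B z a β) y := fun a β =>
    (hcoord a).contMDiffAt.comp y
      (ContMDiffAt.comp (g := fun x => (e (⟨x, s β x⟩ : TotalSpace (Fib m) E)).2) y
        (contMDiffAt_triv_frame hs hU e hye hy β) hp)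
  have hdet : (B y).det ≠ 0 := frame_det_ne_zero hs e hye hy
  have hsm : ContMDiffAt I 𝓘(ℝ, ℝ) ∞ (fun z => ∑ a, (B z)⁻¹ α a * (e (f z)).2 a) y :=
    ContMDiffAt.sum fun a _ =>
      (ContMDiffAt.matrix_inv_apply hB hdet α a).mul ((hcoord a).contMDiffAt.comp y hf2)
  refine hsm.congr_of_eventuallyEq ?_
  filter_upwards [hp.continuousAt.eventually ((hU.inter e.open_baseSet).mem_nhds ⟨hy, hye⟩)]
    with z hz
  have hdz : (B z).det ≠ 0 := frame_det_ne_zero hs e hz.2 hz.1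
  have h1 : (fun a => (e (f z)).2 a) = (B z).mulVec (fun α => hs.coeff α (f z).proj (f z).2) := by
    ext a
    have h2 : (e (f z)).2 = (e (⟨(f z).proj, ∑ α, hs.coeff α (f z).proj (f z).2 •
        s α (f z).proj⟩ : TotalSpace (Fib m) E)).2 := by
      rw [frame_sum_coeff hs hz.1]
    rw [h2, triv_sum e hz.2]
    simp only [WithLp.ofLp_sum, Finset.sum_apply, PiLp.smul_apply, smul_eq_mul, Matrix.mulVec,
      dotProduct, B, Matrix.of_apply]
    exact Finset.sum_congr rfl fun i _ => mul_comm _ _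
  have h3 : (B z)⁻¹.mulVec (fun a => (e (f z)).2 a) = fun α => hs.coeff α (f z).proj (f z).2 := by
    rw [h1, Matrix.mulVec_mulVec, Matrix.nonsing_inv_mul _ (isUnit_iff_ne_zero.2 hdz),
      Matrix.one_mulVec]
  exact (congrFun h3 α).symm

lemma contMDiffAt_of_frame_coeff (hU : IsOpen U) {f : N → TotalSpace (Fib m) E} {y : N}
    (hp : ContMDiffAt I (𝓡 n) ∞ (fun z => (f z).proj) y) (hy : (f y).proj ∈ U)
    (hf : ∀ α, ContMDiffAt I 𝓘(ℝ, ℝ) ∞ (fun z => hs.coeff α (f z).proj (f z).2) y) :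
    ContMDiffAt I (IE n m) ∞ f y := by
  refine contMDiffAt_totalSpace.2 ⟨hp, ?_⟩
  set e := trivializationAt (Fib m) E (f y).proj
  have hye : (f y).proj ∈ e.baseSet := FiberBundle.mem_baseSet_trivializationAt' _
  have hsm : ContMDiffAt I 𝓘(ℝ, Fib m) ∞ (fun z => ∑ α, hs.coeff α (f z).proj (f z).2 •
      (e (⟨(f z).proj, s α (f z).proj⟩ : TotalSpace (Fib m) E)).2) y :=
    ContMDiffAt.sum fun α _ => (hf α).smul
      (ContMDiffAt.comp (g := fun x => (e (⟨x, s α x⟩ : TotalSpace (Fib m) E)).2) y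
        (contMDiffAt_triv_frame hs hU e hye hy α) hp)
  refine hsm.congr_of_eventuallyEq ?_
  filter_upwards [hp.continuousAt.eventually ((hU.inter e.open_baseSet).mem_nhds ⟨hy, hye⟩)]
    with z hz
  rw [← triv_sum e hz.2, frame_sum_coeff hs hz.1]

end Along

lemma sm_fibCoord (hU : IsOpen U) {w : TotalSpace (Fib m) E} (hw : w.proj ∈ U) (α : Fin m) :
    Sm (n := n) (fibCoord hs α) w :=
  contMDiffAt_frame_coeff hs hU (f := id) contMDiffAt_id hw α

lemma eventually_proj_mem {V : Set M} (hV : IsOpen V) {w : TotalSpace (Fib m) E}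
    (hw : w.proj ∈ V) : ∀ᶠ w' in 𝓝 w, w'.proj ∈ V :=
  (FiberBundle.continuous_proj (Fib m) E).continuousAt.eventually (hV.mem_nhds hw)

lemma mdifferentiableAt_proj (w : TotalSpace (Fib m) E) :
    MDifferentiableAt (IE n m) (𝓡 n) (TotalSpace.proj : TotalSpace (Fib m) E → M) w :=
  (contMDiffAt_proj (n := ∞) E).mdifferentiableAt (by simp)

variable (n) in
/-- The differential of the projection `E → M`. -/
abbrev Tproj (w : TotalSpace (Fib m) E) (v : TangentSpace (IE n m) w) :
    TangentSpace (𝓡 n) w.proj :=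
  mfderiv (IE n m) (𝓡 n) (TotalSpace.proj : TotalSpace (Fib m) E → M) w v

lemma mvfderiv_comp_proj {f : M → ℝ} {w : TotalSpace (Fib m) E}
    (hf : MDifferentiableAt (𝓡 n) 𝓘(ℝ, ℝ) f w.proj) (v : TangentSpace (IE n m) w) :
    mvfderiv (IE n m) (fun w => f w.proj) w v = mvfderiv (𝓡 n) f w.proj (Tproj n w v) :=
  mfderiv_comp_apply w hf (mdifferentiableAt_proj w) v

/-- In the charts of the total space, coordinate functions are affine along the fibres. -/
lemma exists_affine_coordinate (hU : IsOpen U) {w₀ : TotalSpace (Fib m) E} (hw : w₀.proj ∈ U)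
    (l : (EuclideanSpace ℝ (Fin n) × Fib m) →L[ℝ] ℝ) :
    ∃ (f₀ : M → ℝ) (f : Fin m → M → ℝ), ContMDiffAt (𝓡 n) 𝓘(ℝ, ℝ) ∞ f₀ w₀.proj ∧
      (∀ α, ContMDiffAt (𝓡 n) 𝓘(ℝ, ℝ) ∞ (f α) w₀.proj) ∧
      ∀ᶠ w in 𝓝 w₀, l (extChartAt (IE n m) w₀ w) =
        f₀ w.proj + ∑ α, fibCoord hs α w * f α w.proj := by
  let e := trivializationAt (Fib m) E w₀.proj
  have he : w₀.proj ∈ e.baseSet := FiberBundle.mem_baseSet_trivializationAt' _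
  let l₁ : EuclideanSpace ℝ (Fin n) →L[ℝ] ℝ := l.comp (ContinuousLinearMap.inl ℝ _ _)
  let l₂ : Fib m →L[ℝ] ℝ := l.comp (ContinuousLinearMap.inr ℝ _ _)
  refine ⟨fun x => l₁ (extChartAt (𝓡 n) w₀.proj x),
    fun α x => l₂ (e (⟨x, s α x⟩ : TotalSpace (Fib m) E)).2, ?_, fun α => ?_, ?_⟩
  · exact l₁.contDiff.contMDiff.contMDiffAt.comp _ contMDiffAt_extChartAt
  · exact l₂.contDiff.contMDiff.contMDiffAt.comp _ (contMDiffAt_triv_frame hs hU e he hw α)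
  · filter_upwards [eventually_proj_mem (hU.inter e.open_baseSet) ⟨hw, he⟩] with w hwU
    have h1 : extChartAt (IE n m) w₀ w = (extChartAt (𝓡 n) w₀.proj w.proj, (e w).2) := by
      rw [FiberBundle.extChartAt]
      simp only [PartialEquiv.trans_apply, PartialEquiv.prod_coe, PartialEquiv.refl_coe, id]
      rw [Prod.mk.injEq]
      refine ⟨congrArg _ (e.coe_fst' hwU.2), rfl⟩
    have h2 : (e w).2 = ∑ α, fibCoord hs α w • (e (⟨w.proj, s α w.proj⟩ :
        TotalSpace (Fib m) E)).2 := by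
      rw [← triv_sum e hwU.2]
      unfold fibCoord
      rw [frame_sum_coeff hs hwU.1]
    have h3 : ∀ p q, l (p, q) = l₁ p + l₂ q := fun p q => by
      simp [l₁, l₂, ← map_add]
    rw [h1, h3, h2, map_sum]
    simp

end Frames

/-! ### Differentiation rules for real functions. -/

section Rules

variable {𝔼 : Type*} [NormedAddCommGroup 𝔼] [NormedSpace ℝ 𝔼]
  {H : Type*} [TopologicalSpace H] {I : ModelWithCorners ℝ 𝔼 H}
  {N : Type*} [TopologicalSpace N] [ChartedSpace H N] {x : N}

lemma mvfderiv_mul_apply {f g : N → ℝ} (hf : MDifferentiableAt I 𝓘(ℝ, ℝ) f x)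
    (hg : MDifferentiableAt I 𝓘(ℝ, ℝ) g x) (v : TangentSpace I x) :
    mvfderiv I (fun y => f y * g y) x v = f x * mvfderiv I g x v + mvfderiv I f x v * g x := by
  have := congrArg (fun T => T v) (mvfderiv_mul hf hg)
  refine this.trans ?_
  simp [mul_comm]

lemma mvfderiv_add_apply {f g : N → ℝ} (hf : MDifferentiableAt I 𝓘(ℝ, ℝ) f x)
    (hg : MDifferentiableAt I 𝓘(ℝ, ℝ) g x) (v : TangentSpace I x) :
    mvfderiv I (fun y => f y + g y) x v = mvfderiv I f x v + mvfderiv I g x v :=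
  congrArg (fun T => T v) (mvfderiv_add hf hg)

lemma mvfderiv_sub_apply {f g : N → ℝ} (hf : MDifferentiableAt I 𝓘(ℝ, ℝ) f x)
    (hg : MDifferentiableAt I 𝓘(ℝ, ℝ) g x) (v : TangentSpace I x) :
    mvfderiv I (fun y => f y - g y) x v = mvfderiv I f x v - mvfderiv I g x v :=
  congrArg (fun T => T v) (mvfderiv_sub hf hg)

lemma mvfderiv_const_apply (c : ℝ) (v : TangentSpace I x) :
    mvfderiv I (fun _ : N => c) x v = 0 :=
  congrArg (fun T => T v) (mvfderiv_const c)

lemma mdifferentiableAt_sum_and_mvfderiv_sum {ι : Type*} (F : Finset ι) {f : ι → N → ℝ}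
    (hf : ∀ i, MDifferentiableAt I 𝓘(ℝ, ℝ) (f i) x) (v : TangentSpace I x) :
    MDifferentiableAt I 𝓘(ℝ, ℝ) (fun y => ∑ i ∈ F, f i y) x ∧
      mvfderiv I (fun y => ∑ i ∈ F, f i y) x v = ∑ i ∈ F, mvfderiv I (f i) x v := by
  classical
  induction F using Finset.induction_on with
  | empty =>
    simp only [Finset.sum_empty]
    exact ⟨mdifferentiableAt_const, mvfderiv_const_apply 0 v⟩
  | insert a F ha ih =>
    simp only [Finset.sum_insert ha]
    exact ⟨(hf a).add ih.1, by rw [mvfderiv_add_apply (hf a) ih.1, ih.2]⟩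

lemma mvfderiv_sum_apply {ι : Type*} [Fintype ι] {f : ι → N → ℝ}
    (hf : ∀ i, MDifferentiableAt I 𝓘(ℝ, ℝ) (f i) x) (v : TangentSpace I x) :
    mvfderiv I (fun y => ∑ i, f i y) x v = ∑ i, mvfderiv I (f i) x v :=
  (mdifferentiableAt_sum_and_mvfderiv_sum _ hf v).2

lemma _root_.ContMDiffAt.eventually_mdifferentiableAt [IsManifold I ∞ N] {f : N → ℝ}
    (hf : ContMDiffAt I 𝓘(ℝ, ℝ) ∞ f x) : ∀ᶠ y in 𝓝 x, MDifferentiableAt I 𝓘(ℝ, ℝ) f y := by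
  have i1 : IsManifold I 1 N := IsManifold.of_le (n := ∞) (by simp)
  have := (contMDiffAt_iff_contMDiffAt_nhds (n := 1) (by simp)).1 (hf.of_le (by simp))
  exact this.mono fun y hy => hy.mdifferentiableAt one_ne_zero

lemma _root_.ContMDiffAt.md {f : N → ℝ} (hf : ContMDiffAt I 𝓘(ℝ, ℝ) ∞ f x) :
    MDifferentiableAt I 𝓘(ℝ, ℝ) f x := hf.mdifferentiableAt (by simp)

end Rules

/-! ### Tangent vectors of the total space in a frame. -/

section FrameDeriv

variable {s : Fin m → ∀ x, E x} {U : Set M} (hs : IsLocalFrameOn (𝓡 n) (Fib m) ∞ s U)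

lemma mvfderiv_affine (hU : IsOpen U) {w : TotalSpace (Fib m) E} (hw : w.proj ∈ U)
    {f₀ : M → ℝ} {f : Fin m → M → ℝ} (h₀ : MDifferentiableAt (𝓡 n) 𝓘(ℝ, ℝ) f₀ w.proj)
    (hf : ∀ α, MDifferentiableAt (𝓡 n) 𝓘(ℝ, ℝ) (f α) w.proj) (v : TangentSpace (IE n m) w) :
    mvfderiv (IE n m) (fun w => f₀ w.proj + ∑ α, fibCoord hs α w * f α w.proj) w v =
      mvfderiv (𝓡 n) f₀ w.proj (Tproj n w v) +
        ∑ α, (fibCoord hs α w * mvfderiv (𝓡 n) (f α) w.proj (Tproj n w v)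
          + mvfderiv (IE n m) (fibCoord hs α) w v * f α w.proj) := by
  have hc : ∀ α, MDifferentiableAt (IE n m) 𝓘(ℝ, ℝ) (fibCoord hs α) w := fun α =>
    (sm_fibCoord hs hU hw α).md
  have hp : ∀ {g : M → ℝ}, MDifferentiableAt (𝓡 n) 𝓘(ℝ, ℝ) g w.proj →
      MDifferentiableAt (IE n m) 𝓘(ℝ, ℝ) (fun w : TotalSpace (Fib m) E => g w.proj) w :=
    fun hg => MDifferentiableAt.comp w hg (mdifferentiableAt_proj w)
  have hm : ∀ α, MDifferentiableAt (IE n m) 𝓘(ℝ, ℝ)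
      (fun w : TotalSpace (Fib m) E => fibCoord hs α w * f α w.proj) w := fun α =>
    (hc α).mul (hp (hf α))
  rw [mvfderiv_add_apply (hp h₀) (mdifferentiableAt_sum_and_mvfderiv_sum _ hm v).1,
    mvfderiv_sum_apply hm, mvfderiv_comp_proj h₀]
  congr 1
  refine Finset.sum_congr rfl fun α _ => ?_
  rw [mvfderiv_mul_apply (hc α) (hp (hf α)), mvfderiv_comp_proj (hf α)]

/-- A tangent vector of the total space is determined by its projection to the base and the
derivatives of the fibre coordinates. -/
lemma tangent_totalSpace_ext (hU : IsOpen U) {w : TotalSpace (Fib m) E} (hw : w.proj ∈ U)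
    {v v' : TangentSpace (IE n m) w} (h : Tproj n w v = Tproj n w v')
    (h' : ∀ α, mvfderiv (IE n m) (fibCoord hs α) w v = mvfderiv (IE n m) (fibCoord hs α) w v') :
    v = v' := by
  refine tangent_ext_of_mvfderiv fun l => ?_
  obtain ⟨f₀, f, h₀, hf, hl⟩ := exists_affine_coordinate hs hU hw l
  have hl' : (fun y => l (extChartAt (IE n m) w y)) =ᶠ[𝓝 w]
    fun w => f₀ w.proj + ∑ α, fibCoord hs α w * f α w.proj := hl
  rw [hl'.mvfderiv_eq, hl'.mvfderiv_eq, mvfderiv_affine hs hU hw h₀.md (fun α => (hf α).md),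
    mvfderiv_affine hs hU hw h₀.md (fun α => (hf α).md), h]
  simp only [h']

/-- A vector field on the total space is smooth if its projection to the base and the derivatives
of the fibre coordinates along it are. -/
lemma contMDiffAt_vectorField_totalSpace (hU : IsOpen U) {w₀ : TotalSpace (Fib m) E}
    (hw : w₀.proj ∈ U) {Y : ∀ w : TotalSpace (Fib m) E, TangentSpace (IE n m) w}
    (h : ContMDiffAt (IE n m) (𝓡 n).tangent ∞
      (fun w => (⟨w.proj, Tproj n w (Y w)⟩ : TangentBundle (𝓡 n) M)) w₀)
    (h' : ∀ α, Sm (n := n) (fun w => mvfderiv (IE n m) (fibCoord hs α) w (Y w)) w₀) :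
    ContMDiffAt (IE n m) (IE n m).tangent ∞
      (fun w => (⟨w, Y w⟩ : TangentBundle (IE n m) (TotalSpace (Fib m) E))) w₀ := by
  refine contMDiffAt_vectorField_of_mvfderiv fun l => ?_
  obtain ⟨f₀, f, h₀, hf, hl⟩ := exists_affine_coordinate hs hU hw l
  have hsm : Sm (n := n) (fun w => mvfderiv (𝓡 n) f₀ w.proj (Tproj n w (Y w)) +
        ∑ α, (fibCoord hs α w * mvfderiv (𝓡 n) (f α) w.proj (Tproj n w (Y w))
          + mvfderiv (IE n m) (fibCoord hs α) w (Y w) * f α w.proj)) w₀ := by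
    refine (ContMDiffAt.mvfderiv_comp_apply h₀ h).add (ContMDiffAt.sum fun α _ => ?_)
    refine ContMDiffAt.add ?_ ?_
    · exact (sm_fibCoord hs hU hw α).mul (ContMDiffAt.mvfderiv_comp_apply (hf α) h)
    · exact (h' α).mul ((hf α).comp w₀ (contMDiffAt_proj E))
  refine hsm.congr_of_eventuallyEq ?_
  have hc := (FiberBundle.continuous_proj (Fib m) E).continuousAt (x := w₀)
  filter_upwards [hl.eventually_nhds, eventually_proj_mem hU hw,
    hc.eventually h₀.eventually_mdifferentiableAt,
    hc.eventually (eventually_all.2 fun α => (hf α).eventually_mdifferentiableAt)]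
    with w h1 h2 h3 h4
  have h1' : (fun y => l (extChartAt (IE n m) w₀ y)) =ᶠ[𝓝 w]
    fun w => f₀ w.proj + ∑ α, fibCoord hs α w * f α w.proj := h1
  rw [h1'.mvfderiv_eq, mvfderiv_affine hs hU h2 h3 h4]

end FrameDeriv

/-! ### Vertical lifts as derivatives along lines in the fibres. -/

section Lines

lemma contMDiff_fiberLine (w : TotalSpace (Fib m) E) (a : E w.proj) :
    ContMDiff 𝓘(ℝ, ℝ) (IE n m) ∞ (fiberLine w a) := by
  intro t₀
  refine contMDiffAt_totalSpace.2 ⟨contMDiffAt_const, ?_⟩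
  set e := trivializationAt (Fib m) E (fiberLine w a t₀).proj
  have he : w.proj ∈ e.baseSet := FiberBundle.mem_baseSet_trivializationAt' _
  have : ∀ t, (e (fiberLine w a t)).2 = e.continuousLinearMapAt ℝ w.proj w.2
      + t • e.continuousLinearMapAt ℝ w.proj a := by
    intro t
    rw [← map_smul, ← map_add, e.continuousLinearMapAt_apply_of_mem (R := ℝ) he]
    rfl
  simp only [this]
  exact contMDiffAt_const.add (contMDiffAt_id.smul contMDiffAt_const)

lemma fiberLine_zero (w : TotalSpace (Fib m) E) (a : E w.proj) : fiberLine w a 0 = w := by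
  simp [fiberLine]

lemma mvfderiv_vlift {f : TotalSpace (Fib m) E → ℝ} {w : TotalSpace (Fib m) E}
    (hf : MDifferentiableAt (IE n m) 𝓘(ℝ, ℝ) f w) (a : E w.proj) :
    mvfderiv (IE n m) f w (vlift n w a) = deriv (fun t => f (fiberLine w a t)) 0 := by
  have h1 : MDifferentiableAt 𝓘(ℝ, ℝ) (IE n m) (fiberLine w a) 0 :=
    (contMDiff_fiberLine w a).contMDiffAt.mdifferentiableAt (by simp)
  have h2 := mfderiv_comp_apply_of_eq (0 : ℝ) hf h1 (fiberLine_zero w a) (1 : ℝ)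
  rw [mfderiv_eq_fderiv] at h2
  exact h2.symm

end Lines

/-! ### Components of the prolongation along `𝒳_α` and `𝒱_α`. -/

section Components

lemma anchor_eq_Tproj {w : TotalSpace (Fib m) E} (z : A.prolong w) :
    A.anchor w.proj z.1.1 = Tproj n w z.1.2 := z.2

/-- The derivative of `f` along elements of `𝒯_w E`. -/
def Dat (f : TotalSpace (Fib m) E → ℝ) (w : TotalSpace (Fib m) E) : A.prolong w →ₗ[ℝ] ℝ :=
  (mvfderiv (IE n m) f w).toLinearMap.comp
    ((LinearMap.snd ℝ (E w.proj) (TangentSpace (IE n m) w)).comp (A.prolong w).subtype)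

lemma D_eq_Dat (ρ : A.Sec) (f : TotalSpace (Fib m) E → ℝ) (w : TotalSpace (Fib m) E) :
    D ρ f w = Dat f w (ρ w) := rfl

lemma Dat_congr {f g : TotalSpace (Fib m) E → ℝ} {w : TotalSpace (Fib m) E} (h : f =ᶠ[𝓝 w] g)
    (z : A.prolong w) : Dat f w z = Dat g w z := h.mvfderiv_eq _

variable {s : Fin m → ∀ x, E x} {U : Set M} (hs : IsLocalFrameOn (𝓡 n) (Fib m) ∞ s U)

/-- The component of `z ∈ 𝒯_w E` along `𝒳_α`. -/
def uc (α : Fin m) (w : TotalSpace (Fib m) E) : A.prolong w →ₗ[ℝ] ℝ :=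
  (hs.coeff α w.proj).comp
    ((LinearMap.fst ℝ (E w.proj) (TangentSpace (IE n m) w)).comp (A.prolong w).subtype)

/-- The component of `z ∈ 𝒯_w E` along `𝒱_α`. -/
def vc (α : Fin m) (w : TotalSpace (Fib m) E) : A.prolong w →ₗ[ℝ] ℝ := Dat (fibCoord hs α) w

lemma uc_apply (α : Fin m) {w : TotalSpace (Fib m) E} (z : A.prolong w) :
    uc hs α w z = hs.coeff α w.proj z.1.1 := rfl

/-- The base part of the tangent component is the anchor of the `E`-component, so only the
derivatives of the fibre coordinates remain to be compared. -/
lemma prolong_ext (hU : IsOpen U) {w : TotalSpace (Fib m) E} (hw : w.proj ∈ U)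
    {z z' : A.prolong w} (hu : ∀ α, uc hs α w z = uc hs α w z')
    (hv : ∀ α, vc hs α w z = vc hs α w z') : z = z' := by
  have h1 : z.1.1 = z'.1.1 := frame_ext hs hw hu
  have h2 : z.1.2 = z'.1.2 := by
    refine tangent_totalSpace_ext hs hU hw ?_ hv
    rw [← anchor_eq_Tproj, ← anchor_eq_Tproj, h1]
  exact Subtype.ext (Prod.ext h1 h2)

lemma vc_vert (hU : IsOpen U) {w : TotalSpace (Fib m) E} (hw : w.proj ∈ U) (a : E w.proj)
    (α : Fin m) : vc hs α w (A.vert w a) = hs.coeff α w.proj a := by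
  have h1 := mvfderiv_vlift (sm_fibCoord hs hU hw α).md a
  refine h1.trans ?_
  have h2 : (fun t => fibCoord hs α (fiberLine w a t)) =
      fun t : ℝ => hs.coeff α w.proj w.2 + t * hs.coeff α w.proj a := by
    ext t
    show hs.coeff α w.proj (w.2 + t • a) = _
    rw [map_add, map_smul, smul_eq_mul]
  rw [h2]
  simp

lemma uc_vert (w : TotalSpace (Fib m) E) (a : E w.proj) (α : Fin m) :
    uc hs α w (A.vert w a) = 0 := by
  rw [uc_apply]; exact map_zero _

variable (A s) in
/-- The local section `𝒱_α = (0, ∂/∂y^α)`. -/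
def frameV (α : Fin m) : A.Sec := fun w => A.vert w (s α w.proj)

lemma vc_frameV (hU : IsOpen U) {w : TotalSpace (Fib m) E} (hw : w.proj ∈ U) (α β : Fin m) :
    vc hs α w (frameV A s β w) = if α = β then 1 else 0 :=
  (vc_vert hs hU hw _ α).trans (frame_coeff_self hs hw α β)

lemma uc_frameV (w : TotalSpace (Fib m) E) (α β : Fin m) : uc hs α w (frameV A s β w) = 0 :=
  uc_vert hs w _ α

lemma constSec_self {w : TotalSpace (Fib m) E} (hw : w.proj ∈ U) : constSec hs w w.proj = w := by
  unfold constSec fibCoord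
  rw [frame_sum_coeff hs hw]

lemma contMDiffAt_constSec (hU : IsOpen U) (w : TotalSpace (Fib m) E) {x : M} (hx : x ∈ U) :
    ContMDiffAt (𝓡 n) (IE n m) ∞ (constSec hs w) x := by
  refine contMDiffAt_of_frame_coeff hs hU contMDiffAt_id hx fun α => ?_
  refine (contMDiffAt_const (c := fibCoord hs α w)).congr_of_eventuallyEq ?_
  filter_upwards [hU.mem_nhds hx] with y hy
  exact frame_coeff_sum hs hy _ α

/-- `constSec` is a section of the projection, so its differential lifts `σ(s_α)`. Hence the default
value in `frameX` does not occur over `U`. -/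
lemma mem_prolong_frameX (hU : IsOpen U) {w : TotalSpace (Fib m) E} (hw : w.proj ∈ U)
    (α : Fin m) : ((s α w.proj, mfderiv (𝓡 n) (IE n m) (constSec hs w) w.proj
      (A.anchor w.proj (s α w.proj))) : E w.proj × TangentSpace (IE n m) w) ∈ A.prolong w := by
  show A.anchor w.proj (s α w.proj) = _
  have h1 : MDifferentiableAt (𝓡 n) (IE n m) (constSec hs w) w.proj :=
    (contMDiffAt_constSec hs hU w hw).mdifferentiableAt (by simp)
  have h2 := mfderiv_comp_apply_of_eq w.proj (mdifferentiableAt_proj (n := n) w) h1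
    (constSec_self hs hw) (A.anchor w.proj (s α w.proj))
  have h3 : (TotalSpace.proj : TotalSpace (Fib m) E → M) ∘ constSec hs w = id := rfl
  rw [h3, mfderiv_id] at h2
  exact h2

lemma frameX_val (hU : IsOpen U) {w : TotalSpace (Fib m) E} (hw : w.proj ∈ U) (α : Fin m) :
    (frameX A hs α w).1 = (s α w.proj, mfderiv (𝓡 n) (IE n m) (constSec hs w) w.proj
      (A.anchor w.proj (s α w.proj))) := by
  unfold frameX
  rw [dif_pos (mem_prolong_frameX hs hU hw α)]
  rfl

lemma D_frameX (hU : IsOpen U) {w : TotalSpace (Fib m) E} (hw : w.proj ∈ U) (α : Fin m)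
    {f : TotalSpace (Fib m) E → ℝ} (hf : MDifferentiableAt (IE n m) 𝓘(ℝ, ℝ) f w) :
    D (frameX A hs α) f w = dX hs A α f w := by
  have h1 : MDifferentiableAt (𝓡 n) (IE n m) (constSec hs w) w.proj :=
    (contMDiffAt_constSec hs hU w hw).mdifferentiableAt (by simp)
  have h2 := mvfderiv_comp_apply_of_eq w.proj hf h1
    (constSec_self hs hw) (A.anchor w.proj (s α w.proj))
  unfold D dX
  rw [frameX_val hs hU hw]
  exact h2.symm

lemma uc_frameX (hU : IsOpen U) {w : TotalSpace (Fib m) E} (hw : w.proj ∈ U) (α β : Fin m) :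
    uc hs α w (frameX A hs β w) = if α = β then 1 else 0 := by
  rw [uc_apply, frameX_val hs hU hw]
  exact frame_coeff_self hs hw α β

lemma vc_frameX (hU : IsOpen U) {w : TotalSpace (Fib m) E} (hw : w.proj ∈ U) (α β : Fin m) :
    vc hs α w (frameX A hs β w) = 0 := by
  have h1 := D_frameX (A := A) hs hU hw β (sm_fibCoord hs hU hw α).md
  refine h1.trans ?_
  have h2 : fibCoord hs α ∘ constSec hs w =ᶠ[𝓝 w.proj] fun _ => fibCoord hs α w := by
    filter_upwards [hU.mem_nhds hw] with y hy
    exact frame_coeff_sum hs hy _ α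
  unfold dX
  rw [h2.mvfderiv_eq]
  exact mvfderiv_const_apply _ _

lemma D_frameV {w : TotalSpace (Fib m) E} (α : Fin m)
    {f : TotalSpace (Fib m) E → ℝ} (hf : MDifferentiableAt (IE n m) 𝓘(ℝ, ℝ) f w) :
    D (frameV A s α) f w = dY s α f w := mvfderiv_vlift hf _

lemma prolong_decomp (hU : IsOpen U) {w : TotalSpace (Fib m) E} (hw : w.proj ∈ U)
    (z : A.prolong w) : z = ∑ α, uc hs α w z • frameX A hs α w
      + ∑ α, vc hs α w z • frameV A s α w := by
  refine prolong_ext hs hU hw (fun β => ?_) fun β => ?_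
  · simp [map_sum, uc_frameX hs hU hw, uc_frameV]
  · simp [map_sum, vc_frameX hs hU hw, vc_frameV hs hU hw]

lemma Dat_decomp (hU : IsOpen U) {w : TotalSpace (Fib m) E} (hw : w.proj ∈ U)
    (f : TotalSpace (Fib m) E → ℝ) (z : A.prolong w) :
    Dat f w z = ∑ α, uc hs α w z * D (frameX A hs α) f w
      + ∑ α, vc hs α w z * D (frameV A s α) f w := by
  conv_lhs => rw [prolong_decomp hs hU hw z]
  simp [map_sum, D_eq_Dat]

/-- Smoothness of a section of `𝒯E` at a point. -/
def SmoothAt (ρ : A.Sec) (w : TotalSpace (Fib m) E) : Prop :=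
  ContMDiffAt (IE n m) (IE n m) ∞
      (fun w => (⟨w.proj, (ρ w).1.1⟩ : TotalSpace (Fib m) E)) w ∧
    ContMDiffAt (IE n m) (IE n m).tangent ∞
      (fun w => (⟨w, (ρ w).1.2⟩ : TangentBundle (IE n m) (TotalSpace (Fib m) E))) w

lemma SmoothOn.smoothAt {ρ : A.Sec} {W : Set (TotalSpace (Fib m) E)} (h : SmoothOn ρ W)
    (hW : IsOpen W) {w : TotalSpace (Fib m) E} (hw : w ∈ W) : SmoothAt ρ w :=
  ⟨h.1.contMDiffAt (hW.mem_nhds hw), h.2.contMDiffAt (hW.mem_nhds hw)⟩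

lemma smoothOn_of_smoothAt {ρ : A.Sec} {W : Set (TotalSpace (Fib m) E)}
    (h : ∀ w ∈ W, SmoothAt ρ w) : SmoothOn ρ W :=
  ⟨fun w hw => (h w hw).1.contMDiffWithinAt, fun w hw => (h w hw).2.contMDiffWithinAt⟩

lemma SmoothAt.congr {ρ ρ' : A.Sec} {w : TotalSpace (Fib m) E} (h : SmoothAt ρ w)
    (h' : ∀ᶠ w' in 𝓝 w, ρ' w' = ρ w') : SmoothAt ρ' w :=
  ⟨h.1.congr_of_eventuallyEq (h'.mono fun y hy => by simp [hy]),
    h.2.congr_of_eventuallyEq (h'.mono fun y hy => by simp [hy])⟩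

lemma SmoothAt.D {ρ : A.Sec} {w : TotalSpace (Fib m) E} (h : SmoothAt ρ w)
    {f : TotalSpace (Fib m) E → ℝ} (hf : Sm (n := n) f w) : Sm (n := n) (D ρ f) w :=
  ContMDiffAt.mvfderiv_apply hf h.2

lemma SmoothAt.uc (hU : IsOpen U) {ρ : A.Sec} {w : TotalSpace (Fib m) E} (hw : w.proj ∈ U)
    (h : SmoothAt ρ w) (α : Fin m) : Sm (n := n) (fun w => uc hs α w (ρ w)) w :=
  contMDiffAt_frame_coeff hs hU h.1 hw α

lemma SmoothAt.vc (hU : IsOpen U) {ρ : A.Sec} {w : TotalSpace (Fib m) E} (hw : w.proj ∈ U)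
    (h : SmoothAt ρ w) (α : Fin m) : Sm (n := n) (fun w => vc hs α w (ρ w)) w :=
  h.D (sm_fibCoord hs hU hw α)

/-- Smoothness of the base part of the vector field is not an extra condition: it follows from that
of the `E`-component and of the anchor. -/
lemma smoothAt_of_components (hU : IsOpen U) {ρ : A.Sec} {w : TotalSpace (Fib m) E}
    (hw : w.proj ∈ U) (hu : ∀ α, Sm (n := n) (fun w => LieAlgebroid.uc hs α w (ρ w)) w)
    (hv : ∀ α, Sm (n := n) (fun w => LieAlgebroid.vc hs α w (ρ w)) w) : SmoothAt ρ w := by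
  have h1 : ContMDiffAt (IE n m) (IE n m) ∞
      (fun w => (⟨w.proj, (ρ w).1.1⟩ : TotalSpace (Fib m) E)) w :=
    contMDiffAt_of_frame_coeff hs hU (contMDiffAt_proj E) hw hu
  refine ⟨h1, contMDiffAt_vectorField_totalSpace hs hU hw ?_ hv⟩
  refine (A.anchor_smooth.contMDiffAt.comp w h1).congr_of_eventuallyEq ?_
  exact Eventually.of_forall fun y => by
    show (⟨y.proj, _⟩ : TangentBundle (𝓡 n) M) = ⟨y.proj, A.anchor y.proj (ρ y).1.1⟩
    rw [anchor_eq_Tproj]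

lemma smoothAt_frameX (hU : IsOpen U) {w : TotalSpace (Fib m) E} (hw : w.proj ∈ U) (β : Fin m) :
    SmoothAt (frameX A hs β) w :=
  smoothAt_of_components hs hU hw
    (fun α => contMDiffAt_const.congr_of_eventuallyEq
      ((eventually_proj_mem hU hw).mono fun _ hw' => uc_frameX hs hU hw' α β))
    (fun α => contMDiffAt_const.congr_of_eventuallyEq
      ((eventually_proj_mem hU hw).mono fun _ hw' => vc_frameX hs hU hw' α β))

lemma smoothAt_frameV (hs : IsLocalFrameOn (𝓡 n) (Fib m) ∞ s U) (hU : IsOpen U) {w : TotalSpace (Fib m) E} (hw : w.proj ∈ U) (β : Fin m) :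
    SmoothAt (frameV A s β) w :=
  smoothAt_of_components hs hU hw
    (fun α => contMDiffAt_const.congr_of_eventuallyEq
      ((eventually_proj_mem hU hw).mono fun w' _ => uc_frameV hs w' α β))
    (fun α => contMDiffAt_const.congr_of_eventuallyEq
      ((eventually_proj_mem hU hw).mono fun _ hw' => vc_frameV hs hU hw' α β))

end Components

/-! ### The `E`-component of the bracket in an arbitrary frame. -/

section Bracket

variable {s : Fin m → ∀ x, E x} {U : Set M} (hs : IsLocalFrameOn (𝓡 n) (Fib m) ∞ s U)

lemma contMDiffOn_triv_symm (e : Trivialization (Fib m) (TotalSpace.proj : TotalSpace (Fib m) E → M))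
    [MemTrivializationAtlas e] (c : Fib m) :
    ContMDiffOn (𝓡 n) (IE n m) ∞ (fun x => (⟨x, e.symm x c⟩ : TotalSpace (Fib m) E)) e.baseSet := by
  refine (e.contMDiffOn_section_iff e.open_baseSet subset_rfl).2 ?_
  refine (contMDiffOn_const (c := c)).congr fun x hx => ?_
  rw [e.apply_mk_symm hx]

lemma contMDiffOn_coeff_triv_symm (hU : IsOpen U)
    (e : Trivialization (Fib m) (TotalSpace.proj : TotalSpace (Fib m) E → M))
    [MemTrivializationAtlas e] (c : Fib m) (α : Fin m) :
    ContMDiffOn (𝓡 n) 𝓘(ℝ, ℝ) ∞ (fun x => hs.coeff α x (e.symm x c)) (U ∩ e.baseSet) :=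
  fun _ hx => (contMDiffAt_frame_coeff hs hU
    ((contMDiffOn_triv_symm e c).contMDiffAt (e.open_baseSet.mem_nhds hx.2)) hx.1
      α).contMDiffWithinAt

lemma coeff_triv_symm_eq_sum
    (e : Trivialization (Fib m) (TotalSpace.proj : TotalSpace (Fib m) E → M))
    [MemTrivializationAtlas e] (c : Fib m) (α : Fin m) {x : M} (hx : x ∈ e.baseSet) :
    hs.coeff α x (e.symm x c) =
      ∑ a, c a * hs.coeff α x (e.symm x (EuclideanSpace.single a (1 : ℝ))) := by
  have h1 : c = ∑ a, c a • EuclideanSpace.single a (1 : ℝ) := by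
    ext b
    simp [Pi.single_apply]
  have h2 : ∀ c, e.symm x c = e.symmₗ ℝ x c := fun c => (e.symmₗ_apply (R := ℝ) hx c).symm
  conv_lhs => rw [h1, h2, map_sum, map_sum]
  refine Finset.sum_congr rfl fun a _ => ?_
  rw [map_smul, map_smul, smul_eq_mul, ← h2]

/-- Differentiating a section along `π`, read in the trivialization, in terms of a frame. -/
lemma coeff_symm_mvfderiv_triv (hU : IsOpen U) {w : TotalSpace (Fib m) E} (hw : w.proj ∈ U)
    {r : ∀ w' : TotalSpace (Fib m) E, E w'.proj}
    (hr : ContMDiffAt (IE n m) (IE n m) ∞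
      (fun w' => (⟨w'.proj, r w'⟩ : TotalSpace (Fib m) E)) w)
    (v : TangentSpace (IE n m) w) (α : Fin m) :
    hs.coeff α w.proj ((trivializationAt (Fib m) E w.proj).symm w.proj (mvfderiv (IE n m)
      (fun w' => (trivializationAt (Fib m) E w.proj
        (⟨w'.proj, r w'⟩ : TotalSpace (Fib m) E)).2) w v)) =
      mvfderiv (IE n m) (fun w' => hs.coeff α w'.proj (r w')) w v -
        mvfderiv (𝓡 n) (fun x => hs.coeff α x ((trivializationAt (Fib m) E w.proj).symm x
          (trivializationAt (Fib m) E w.proj (⟨w.proj, r w⟩ : TotalSpace (Fib m) E)).2))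
          w.proj (Tproj n w v) := by
  set e := trivializationAt (Fib m) E w.proj with he'
  have he : w.proj ∈ e.baseSet := FiberBundle.mem_baseSet_trivializationAt' _
  set G : TotalSpace (Fib m) E → Fib m := fun w' => (e (⟨w'.proj, r w'⟩ :
    TotalSpace (Fib m) E)).2 with hG'
  have hG : ContMDiffAt (IE n m) 𝓘(ℝ, Fib m) ∞ G w := (contMDiffAt_totalSpace.1 hr).2
  have hGd : MDifferentiableAt (IE n m) 𝓘(ℝ, Fib m) G w := hG.mdifferentiableAt (by simp)
  have hGa : ∀ a, MDifferentiableAt (IE n m) 𝓘(ℝ, ℝ) (fun w' => G w' a) w := fun a =>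
    ((EuclideanSpace.proj (𝕜 := ℝ) a).contDiff.contMDiff.contMDiffAt.comp w hG).md
  have hGv : ∀ a, (mvfderiv (IE n m) G w v) a = mvfderiv (IE n m) (fun w' => G w' a) w v :=
    fun a => (mvfderiv_clm_comp (EuclideanSpace.proj (𝕜 := ℝ) a) hGd v).symm
  set κ : Fin m → M → ℝ := fun a x => hs.coeff α x (e.symm x (EuclideanSpace.single a (1 : ℝ)))
    with hκ'
  have hκ : ∀ a, MDifferentiableAt (𝓡 n) 𝓘(ℝ, ℝ) (κ a) w.proj := fun a =>
    ((contMDiffOn_coeff_triv_symm hs hU e _ α).contMDiffAt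
      ((hU.inter e.open_baseSet).mem_nhds ⟨hw, he⟩)).md
  have hκp : ∀ a, MDifferentiableAt (IE n m) 𝓘(ℝ, ℝ)
      (fun w' : TotalSpace (Fib m) E => κ a w'.proj) w :=
    fun a => MDifferentiableAt.comp w (hκ a) (mdifferentiableAt_proj w)
  -- The frame coefficient is `∑ G^a κ_a ∘ π`. In the product rule, the terms where `κ_a` is
  -- differentiated depend on `v` only through its projection. They are the derivative with `G`
  -- frozen at `w`, which the statement subtracts.
  have h1 : (fun w' => hs.coeff α w'.proj (r w')) =ᶠ[𝓝 w]
      fun w' => ∑ a, G w' a * κ a w'.proj := by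
    filter_upwards [eventually_proj_mem e.open_baseSet he] with w' hw'
    rw [← coeff_triv_symm_eq_sum hs e (G w') α hw', hG']
    rw [e.symm_apply_apply_mk hw']
  rw [h1.mvfderiv_eq, mvfderiv_sum_apply (f := fun a w' => G w' a * κ a w'.proj)
      (fun a => (hGa a).mul (hκp a)), coeff_triv_symm_eq_sum hs e _ _ he]
  have h2 : (fun x => hs.coeff α x (e.symm x (e (⟨w.proj, r w⟩ : TotalSpace (Fib m) E)).2))
      =ᶠ[𝓝 w.proj] fun x => ∑ a, (e (⟨w.proj, r w⟩ : TotalSpace (Fib m) E)).2 a * κ a x :=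
    (e.open_baseSet.eventually_mem he).mono fun x hx => coeff_triv_symm_eq_sum hs e _ α hx
  rw [h2.mvfderiv_eq, mvfderiv_sum_apply (f := fun a x => (e (⟨w.proj, r w⟩ : TotalSpace (Fib m) E)).2 a * κ a x)
    (fun a => mdifferentiableAt_const.mul (hκ a)), ← Finset.sum_sub_distrib]
  refine Finset.sum_congr rfl fun a _ => ?_
  rw [mvfderiv_mul_apply (hGa a) (hκp a), mvfderiv_comp_proj (hκ a),
    mvfderiv_mul_apply mdifferentiableAt_const (hκ a), mvfderiv_const_apply, hGv]
  simp only [hG', hκ']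
  ring

lemma coeff_fiberPart (hU : IsOpen U) {w : TotalSpace (Fib m) E} (hw : w.proj ∈ U)
    {z : A.prolong w} (hz : IsVertical z) (α : Fin m) :
    hs.coeff α w.proj (fiberPart n w z.1.2) = vc hs α w z := by
  have h0 : Tproj n w z.1.2 = 0 := by
    rw [← anchor_eq_Tproj, hz, map_zero]
  have h1 := coeff_symm_mvfderiv_triv hs hU hw (r := fun w' => w'.2) contMDiffAt_id z.1.2 α
  rw [h0, map_zero, sub_zero] at h1
  exact h1

variable [T2Space M]

lemma frame_hasSmoothGerm (hs : IsLocalFrameOn (𝓡 n) (Fib m) ∞ s U) (hU : IsOpen U) {x : M}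
    (hx : x ∈ U) (α : Fin m) :
    HasSmoothGerm n m (s α) x :=
  hasSmoothGerm_of_contMDiffOn hU (hs.contMDiffOn α) hx

lemma contMDiffAt_structFun (hU : IsOpen U) {x : M} (hx : x ∈ U) (γ α β : Fin m) :
    ContMDiffAt (𝓡 n) 𝓘(ℝ, ℝ) ∞ (structFun hs A γ α β) x :=
  contMDiffAt_frame_coeff hs hU (A.contMDiffAt_localBracket (frame_hasSmoothGerm hs hU hx α)
    (frame_hasSmoothGerm hs hU hx β)) hx γ

lemma structFun_skew (hU : IsOpen U) {x : M} (hx : x ∈ U) (γ α β : Fin m) :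
    structFun hs A γ α β x = -structFun hs A γ β α x := by
  unfold structFun
  rw [A.localBracket_skew (frame_hasSmoothGerm hs hU hx α) (frame_hasSmoothGerm hs hU hx β),
    map_neg]

/-- The bracket of two sections that are constant in a trivialization, rewritten in another frame by
the Leibniz rule. The two derivative terms measure the change of frame. -/
lemma coeff_localBracket_triv (hU : IsOpen U)
    (e : Trivialization (Fib m) (TotalSpace.proj : TotalSpace (Fib m) E → M))
    [MemTrivializationAtlas e] {x : M} (hx : x ∈ U) (hxe : x ∈ e.baseSet) (c d : Fib m)
    (γ : Fin m) :
    hs.coeff γ x (A.localBracket (fun x => e.symm x c) (fun x => e.symm x d) x) =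
      mvfderiv (𝓡 n) (fun x => hs.coeff γ x (e.symm x d)) x (A.anchor x (e.symm x c))
      - mvfderiv (𝓡 n) (fun x => hs.coeff γ x (e.symm x c)) x (A.anchor x (e.symm x d))
      + ∑ α, ∑ β, hs.coeff α x (e.symm x c) * hs.coeff β x (e.symm x d)
          * structFun hs A γ α β x := by
  have hg : ∀ c, HasSmoothGerm n m (fun x => e.symm x c) x := fun c =>
    hasSmoothGerm_of_contMDiffOn e.open_baseSet (contMDiffOn_triv_symm e c) hxe
  have hf : ∀ c α, HasSmoothFunGerm n (fun x => hs.coeff α x (e.symm x c)) x := fun c α =>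
    hasSmoothFunGerm_of_contMDiffOn (hU.inter e.open_baseSet)
      (contMDiffOn_coeff_triv_symm hs hU e c α) ⟨hx, hxe⟩
  have hsum : ∀ c, ∀ᶠ y in 𝓝 x, e.symm y c = ∑ α, hs.coeff α y (e.symm y c) • s α y := fun c =>
    (hU.eventually_mem hx).mono fun y hy => (frame_sum_coeff hs hy _).symm
  have hfr := frame_hasSmoothGerm hs hU hx
  rw [A.localBracket_sum_smul_left (hg d) hfr (hf c) (hg c) (hsum c), map_sum]
  have h1 : ∀ α, A.localBracket (s α) (fun x => e.symm x d) x = _ := fun α =>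
    A.localBracket_sum_smul_right (hfr α) hfr (hf d) (hsum d)
  simp only [h1, map_sub, map_smul, map_sum, map_add, smul_eq_mul, frame_coeff_self hs hx]
  have h2 : mvfderiv (𝓡 n) (fun x => hs.coeff γ x (e.symm x d)) x (A.anchor x (e.symm x c))
      = ∑ α, hs.coeff α x (e.symm x c) * mvfderiv (𝓡 n) (fun x => hs.coeff γ x (e.symm x d)) x
        (A.anchor x (s α x)) := by
    conv_lhs => rw [← frame_sum_coeff hs hx (e.symm x c)]
    simp only [map_sum, map_smul, smul_eq_mul]
  rw [h2]
  simp only [structFun, mul_ite, mul_one, mul_zero, Finset.sum_add_distrib, Finset.sum_sub_distrib,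
    Finset.sum_ite_eq, Finset.mem_univ, if_true, mul_add, Finset.mul_sum]
  simp only [mul_assoc]
  ring

/-- The `E`-component of the bracket of `𝒯E` in an arbitrary local frame. -/
lemma coeff_bracketFst (hU : IsOpen U) {w : TotalSpace (Fib m) E} (hw : w.proj ∈ U)
    {ρ ν : A.Sec} (hρ : SmoothAt ρ w) (hν : SmoothAt ν w) (γ : Fin m) :
    hs.coeff γ w.proj (bracketFst ρ ν w) =
      D ρ (fun w' => uc hs γ w' (ν w')) w - D ν (fun w' => uc hs γ w' (ρ w')) w
      + ∑ α, ∑ β, uc hs α w (ρ w) * uc hs β w (ν w) * structFun hs A γ α β w.proj := by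
  have he : w.proj ∈ (trivializationAt (Fib m) E w.proj).baseSet :=
    FiberBundle.mem_baseSet_trivializationAt' _
  have h1 := fun v => coeff_symm_mvfderiv_triv hs hU hw (r := fun w' => (ν w').1.1) hν.1 v γ
  have h2 := fun v => coeff_symm_mvfderiv_triv hs hU hw (r := fun w' => (ρ w').1.1) hρ.1 v γ
  have hsub : ∀ p q : Fib m, (trivializationAt (Fib m) E w.proj).symm w.proj (p - q) =
      (trivializationAt (Fib m) E w.proj).symm w.proj p
        - (trivializationAt (Fib m) E w.proj).symm w.proj q := fun p q => by
    simp only [← Trivialization.symmₗ_apply (R := ℝ) _ he, map_sub]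
  have h3 := coeff_localBracket_triv (A := A) hs hU (trivializationAt (Fib m) E w.proj) hw he
    (trivComp ρ w.proj w) (trivComp ν w.proj w) γ
  have hρs : (trivializationAt (Fib m) E w.proj).symm w.proj (trivComp ρ w.proj w) =
      (ρ w).1.1 := Trivialization.symm_apply_apply_mk _ he _
  have hνs : (trivializationAt (Fib m) E w.proj).symm w.proj (trivComp ν w.proj w) =
      (ν w).1.1 := Trivialization.symm_apply_apply_mk _ he _
  unfold bracketFst
  rw [map_add, hsub, map_sub, h3]
  -- Once the anchors are written as projections of the tangent components, the change-of-frame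
  -- terms of `h3` cancel those of `h1` and `h2`.
  rw [hρs, hνs, anchor_eq_Tproj, anchor_eq_Tproj]
  have h1' := h1 (ρ w).1.2
  have h2' := h2 (ν w).1.2
  unfold D
  simp only [uc_apply]
  unfold trivComp
  linarith

end Bracket

/-! ### The bracket of the prolongation and commutation of the frame derivatives. -/

section BracketComponents

variable [T2Space M] {s : Fin m → ∀ x, E x} {U : Set M}
  (hs : IsLocalFrameOn (𝓡 n) (Fib m) ∞ s U)

lemma contMDiffAt_anchor_frame (hs : IsLocalFrameOn (𝓡 n) (Fib m) ∞ s U) (hU : IsOpen U) {x : M}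
    (hx : x ∈ U) (α : Fin m) :
    ContMDiffAt (𝓡 n) (𝓡 n).tangent ∞
      (fun x => (⟨x, A.anchor x (s α x)⟩ : TangentBundle (𝓡 n) M)) x :=
  A.anchor_smooth.contMDiffAt.comp x (hs.contMDiffAt hU hx α)

lemma sm_comp_proj {f : M → ℝ} {w : TotalSpace (Fib m) E}
    (hf : ContMDiffAt (𝓡 n) 𝓘(ℝ, ℝ) ∞ f w.proj) :
    Sm (n := n) (fun w : TotalSpace (Fib m) E => f w.proj) w :=
  hf.comp w (contMDiffAt_proj E)

/-- The anchor being a homomorphism of brackets is what keeps the pair in `𝒯_w E`. Both vectors at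
the base point are compared on coordinate functions `f` of `M`, through the derivatives of `f ∘ π`.
-/
lemma mem_prolong_bracket (hs : IsLocalFrameOn (𝓡 n) (Fib m) ∞ s U) (hU : IsOpen U)
    {w : TotalSpace (Fib m) E} (hw : w.proj ∈ U)
    {ρ ν : A.Sec} (hρ : SmoothAt ρ w) (hν : SmoothAt ν w) :
    (bracketFst ρ ν w, bracketSnd ρ ν w) ∈ A.prolong w := by
  show A.anchor w.proj (bracketFst ρ ν w) = Tproj n w (bracketSnd ρ ν w)
  refine tangent_ext_of_mvfderiv fun l => ?_
  have hf : ContMDiffAt (𝓡 n) 𝓘(ℝ, ℝ) ∞ (fun y => l (extChartAt (𝓡 n) w.proj y)) w.proj :=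
    l.contDiff.contMDiff.contMDiffAt.comp w.proj contMDiffAt_extChartAt
  set f : M → ℝ := fun y => l (extChartAt (𝓡 n) w.proj y)
  set F : Fin m → M → ℝ := fun β x => mvfderiv (𝓡 n) f x (A.anchor x (s β x)) with hF'
  have hF : ∀ β, ContMDiffAt (𝓡 n) 𝓘(ℝ, ℝ) ∞ (F β) w.proj := fun β =>
    hf.mvfderiv_apply (contMDiffAt_anchor_frame hs hU hw β)
  have hexp : ∀ {x : M} (_ : x ∈ U) (g : M → ℝ) (v : E x), mvfderiv (𝓡 n) g x (A.anchor x v) =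
      ∑ β, hs.coeff β x v * mvfderiv (𝓡 n) g x (A.anchor x (s β x)) := by
    intro x hx g v
    conv_lhs => rw [← frame_sum_coeff hs hx v]
    simp only [map_sum, map_smul, smul_eq_mul]
  have hc := (FiberBundle.continuous_proj (Fib m) E).continuousAt (x := w)
  -- For any section `τ` of the prolongation, `σ¹(τ)(f ∘ π)` is the derivative of `f` along the
  -- anchor of its `E`-component, expanded in the frame.
  have hpull : ∀ τ : A.Sec, (fun w' => mvfderiv (IE n m) (fun w'' => f w''.proj) w' (τ w').1.2)
      =ᶠ[𝓝 w] fun w' => ∑ β, uc hs β w' (τ w') * F β w'.proj := by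
    intro τ
    filter_upwards [hc.eventually hf.eventually_mdifferentiableAt, eventually_proj_mem hU hw]
      with w' h1 h2
    rw [mvfderiv_comp_proj h1, ← anchor_eq_Tproj, hexp h2]
    rfl
  have hD : ∀ τ τ' : A.Sec, SmoothAt τ w → mvfderiv (IE n m)
      (fun w' => mvfderiv (IE n m) (fun w'' => f w''.proj) w' (τ w').1.2) w (τ' w).1.2 =
      ∑ β, (uc hs β w (τ w) * ∑ α, uc hs α w (τ' w) *
          mvfderiv (𝓡 n) (F β) w.proj (A.anchor w.proj (s α w.proj))
        + D τ' (fun w' => uc hs β w' (τ w')) w * F β w.proj) := by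
    intro τ τ' hτ
    rw [(hpull τ).mvfderiv_eq, mvfderiv_sum_apply (f := fun β w' => uc hs β w' (τ w') * F β w'.proj)
      fun β => ((hτ.uc hs hU hw β).mul (sm_comp_proj (hF β))).md]
    refine Finset.sum_congr rfl fun β _ => ?_
    rw [mvfderiv_mul_apply (hτ.uc hs hU hw β).md (sm_comp_proj (hF β)).md,
      mvfderiv_comp_proj (hF β).md, ← anchor_eq_Tproj, hexp hw]
    rfl
  -- The only use of `σ([s_α, s_β]) = [σ(s_α), σ(s_β)]`.
  have hstr : ∀ α β, ∑ γ, structFun hs A γ α β w.proj * F γ w.proj =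
      mvfderiv (𝓡 n) (F β) w.proj (A.anchor w.proj (s α w.proj))
        - mvfderiv (𝓡 n) (F α) w.proj (A.anchor w.proj (s β w.proj)) := by
    intro α β
    rw [← mvfderiv_mlieBracket hf (contMDiffAt_anchor_frame hs hU hw α)
      (contMDiffAt_anchor_frame hs hU hw β), ← A.anchor_localBracket
      (frame_hasSmoothGerm hs hU hw α) (frame_hasSmoothGerm hs hU hw β), hexp hw]
    rfl
  rw [← mvfderiv_comp_proj hf.md]
  unfold bracketSnd
  rw [mvfderiv_mlieBracket (sm_comp_proj hf) hρ.2 hν.2, hD ν ρ hν, hD ρ ν hρ, hexp hw]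
  simp only [coeff_bracketFst hs hU hw hρ hν]
  have e1 : ∑ γ, (∑ α, ∑ β, uc hs α w (ρ w) * uc hs β w (ν w) * structFun hs A γ α β w.proj)
      * F γ w.proj = ∑ α, ∑ β, uc hs α w (ρ w) * uc hs β w (ν w) *
        (mvfderiv (𝓡 n) (F β) w.proj (A.anchor w.proj (s α w.proj))
        - mvfderiv (𝓡 n) (F α) w.proj (A.anchor w.proj (s β w.proj))) := by
    simp only [← hstr, Finset.mul_sum, Finset.sum_mul]
    rw [Finset.sum_comm]
    refine Finset.sum_congr rfl fun α _ => ?_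
    rw [Finset.sum_comm]
    refine Finset.sum_congr rfl fun β _ => Finset.sum_congr rfl fun γ _ => ?_
    ring
  have e2 : ∑ β, uc hs β w (ν w) * ∑ α, uc hs α w (ρ w) *
      mvfderiv (𝓡 n) (F β) w.proj (A.anchor w.proj (s α w.proj)) =
      ∑ α, ∑ β, uc hs α w (ρ w) * uc hs β w (ν w) *
        mvfderiv (𝓡 n) (F β) w.proj (A.anchor w.proj (s α w.proj)) := by
    simp only [Finset.mul_sum]
    rw [Finset.sum_comm]
    refine Finset.sum_congr rfl fun α _ => Finset.sum_congr rfl fun β _ => ?_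
    ring
  have e3 : ∑ β, uc hs β w (ρ w) * ∑ α, uc hs α w (ν w) *
      mvfderiv (𝓡 n) (F β) w.proj (A.anchor w.proj (s α w.proj)) =
      ∑ α, ∑ β, uc hs α w (ρ w) * uc hs β w (ν w) *
        mvfderiv (𝓡 n) (F α) w.proj (A.anchor w.proj (s β w.proj)) := by
    simp only [Finset.mul_sum]
    refine Finset.sum_congr rfl fun α _ => Finset.sum_congr rfl fun β _ => ?_
    ring
  have e4 : ∀ γ, mvfderiv (𝓡 n) f w.proj (A.anchor w.proj (s γ w.proj)) = F γ w.proj :=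
    fun γ => rfl
  simp only [e4, add_mul, sub_mul, Finset.sum_add_distrib, Finset.sum_sub_distrib, e1, e2, e3,
    mul_sub]
  ring

lemma br_val (hs : IsLocalFrameOn (𝓡 n) (Fib m) ∞ s U) (hU : IsOpen U)
    {w : TotalSpace (Fib m) E} (hw : w.proj ∈ U)
    {ρ ν : A.Sec} (hρ : SmoothAt ρ w) (hν : SmoothAt ν w) :
    (br ρ ν w).1 = (bracketFst ρ ν w, bracketSnd ρ ν w) := by
  unfold br
  rw [dif_pos (mem_prolong_bracket hs hU hw hρ hν)]

lemma uc_br (hU : IsOpen U) {w : TotalSpace (Fib m) E} (hw : w.proj ∈ U)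
    {ρ ν : A.Sec} (hρ : SmoothAt ρ w) (hν : SmoothAt ν w) (γ : Fin m) :
    uc hs γ w (br ρ ν w) =
      D ρ (fun w' => uc hs γ w' (ν w')) w - D ν (fun w' => uc hs γ w' (ρ w')) w
      + ∑ α, ∑ β, uc hs α w (ρ w) * uc hs β w (ν w) * structFun hs A γ α β w.proj := by
  rw [uc_apply, br_val hs hU hw hρ hν]
  exact coeff_bracketFst hs hU hw hρ hν γ

/-- The anchor `σ¹` is a homomorphism: the second component of the bracket is a Lie bracket of
vector fields. -/
lemma Dat_br (hs : IsLocalFrameOn (𝓡 n) (Fib m) ∞ s U) (hU : IsOpen U)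
    {w : TotalSpace (Fib m) E} (hw : w.proj ∈ U)
    {ρ ν : A.Sec} (hρ : SmoothAt ρ w) (hν : SmoothAt ν w) {f : TotalSpace (Fib m) E → ℝ}
    (hf : Sm (n := n) f w) :
    Dat f w (br ρ ν w) = D ρ (D ν f) w - D ν (D ρ f) w := by
  show mvfderiv (IE n m) f w (br ρ ν w).1.2 = _
  rw [br_val hs hU hw hρ hν]
  exact mvfderiv_mlieBracket hf hρ.2 hν.2

lemma vc_br (hU : IsOpen U) {w : TotalSpace (Fib m) E} (hw : w.proj ∈ U)
    {ρ ν : A.Sec} (hρ : SmoothAt ρ w) (hν : SmoothAt ν w) (γ : Fin m) :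
    vc hs γ w (br ρ ν w) =
      D ρ (fun w' => vc hs γ w' (ν w')) w - D ν (fun w' => vc hs γ w' (ρ w')) w :=
  Dat_br hs hU hw hρ hν (sm_fibCoord hs hU hw γ)

/-- The frame of `E` given by the trivialization around `x`. -/
lemma exists_frame (x : M) : ∃ (s : Fin m → ∀ x, E x) (U : Set M), IsOpen U ∧ x ∈ U ∧
    IsLocalFrameOn (𝓡 n) (Fib m) ∞ s U :=
  ⟨_, _, (trivializationAt (Fib m) E x).open_baseSet, FiberBundle.mem_baseSet_trivializationAt' x,
    (trivializationAt (Fib m) E x).isLocalFrameOn_localFrame_baseSet (𝓡 n) ∞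
      (EuclideanSpace.basisFun (Fin m) ℝ).toBasis⟩

/-- The derivatives along `𝒱_β` commute with those along `𝒳_α` and `𝒱_α`. -/
lemma D_frameX_frameV_comm (hU : IsOpen U) {w : TotalSpace (Fib m) E} (hw : w.proj ∈ U)
    {f : TotalSpace (Fib m) E → ℝ} (hf : Sm (n := n) f w) (α β : Fin m) :
    D (frameX A hs α) (D (frameV A s β) f) w = D (frameV A s β) (D (frameX A hs α) f) w := by
  have hX := smoothAt_frameX (A := A) hs hU hw α
  have hV := smoothAt_frameV (A := A) hs hU hw β
  have h := Dat_br hs hU hw hX hV hf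
  have hev := eventually_proj_mem hU hw
  -- All components of the two frame sections are locally constant, and the structure functions do
  -- not contribute because `𝒱_β` has no `𝒳`-components.
  have h0 : br (frameX A hs α) (frameV A s β) w = 0 := by
    refine prolong_ext hs hU hw (fun γ => ?_) fun γ => ?_
    · rw [uc_br hs hU hw hX hV, D_eq_Dat, D_eq_Dat,
        Dat_congr (g := fun _ => 0) (hev.mono fun w' hw' => uc_frameV hs w' γ β),
        Dat_congr (g := fun _ => if γ = α then 1 else 0)
          (hev.mono fun w' hw' => uc_frameX hs hU hw' γ α)]
      simp only [uc_frameV, mul_zero, zero_mul, Finset.sum_const_zero, map_zero, add_zero]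
      simp [Dat, mvfderiv_const]
    · rw [vc_br hs hU hw hX hV, D_eq_Dat, D_eq_Dat,
        Dat_congr (g := fun _ => if γ = β then 1 else 0)
          (hev.mono fun w' hw' => vc_frameV hs hU hw' γ β),
        Dat_congr (g := fun _ => 0) (hev.mono fun w' hw' => vc_frameX hs hU hw' γ α)]
      simp [Dat, mvfderiv_const]
  rw [h0, map_zero] at h
  linarith

lemma D_frameV_frameV_comm (hs : IsLocalFrameOn (𝓡 n) (Fib m) ∞ s U) (hU : IsOpen U)
    {w : TotalSpace (Fib m) E} (hw : w.proj ∈ U)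
    {f : TotalSpace (Fib m) E → ℝ} (hf : Sm (n := n) f w) (α β : Fin m) :
    D (frameV A s α) (D (frameV A s β) f) w = D (frameV A s β) (D (frameV A s α) f) w := by
  have hV' := smoothAt_frameV (A := A) hs hU hw α
  have hV := smoothAt_frameV (A := A) hs hU hw β
  have h := Dat_br hs hU hw hV' hV hf
  have hev := eventually_proj_mem hU hw
  have h0 : br (frameV A s α) (frameV A s β) w = 0 := by
    refine prolong_ext hs hU hw (fun γ => ?_) fun γ => ?_
    · rw [uc_br hs hU hw hV' hV, D_eq_Dat, D_eq_Dat,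
        Dat_congr (g := fun _ => 0) (hev.mono fun w' hw' => uc_frameV hs w' γ β),
        Dat_congr (g := fun _ => 0) (hev.mono fun w' hw' => uc_frameV hs w' γ α)]
      simp only [uc_frameV, mul_zero, map_zero]
      simp [Dat, mvfderiv_const]
    · rw [vc_br hs hU hw hV' hV, D_eq_Dat, D_eq_Dat,
        Dat_congr (g := fun _ => if γ = β then 1 else 0)
          (hev.mono fun w' hw' => vc_frameV hs hU hw' γ β),
        Dat_congr (g := fun _ => if γ = α then 1 else 0)
          (hev.mono fun w' hw' => vc_frameV hs hU hw' γ α)]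
      simp [Dat, mvfderiv_const]
  rw [h0, map_zero] at h
  linarith

end BracketComponents

/-! ### Local expressions of the Hessian, of `θ_L` and of the energy. -/

section Lagrangian

lemma Dat_mul {f g : TotalSpace (Fib m) E → ℝ} {w : TotalSpace (Fib m) E} (hf : Sm (n := n) f w)
    (hg : Sm (n := n) g w) (z : A.prolong w) :
    Dat (fun w' => f w' * g w') w z = f w * Dat g w z + Dat f w z * g w :=
  mvfderiv_mul_apply hf.md hg.md _

lemma Dat_add {f g : TotalSpace (Fib m) E → ℝ} {w : TotalSpace (Fib m) E} (hf : Sm (n := n) f w)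
    (hg : Sm (n := n) g w) (z : A.prolong w) :
    Dat (fun w' => f w' + g w') w z = Dat f w z + Dat g w z :=
  mvfderiv_add_apply hf.md hg.md _

lemma Dat_sub {f g : TotalSpace (Fib m) E → ℝ} {w : TotalSpace (Fib m) E} (hf : Sm (n := n) f w)
    (hg : Sm (n := n) g w) (z : A.prolong w) :
    Dat (fun w' => f w' - g w') w z = Dat f w z - Dat g w z :=
  mvfderiv_sub_apply hf.md hg.md _

lemma Dat_sum {f : Fin m → TotalSpace (Fib m) E → ℝ} {w : TotalSpace (Fib m) E}
    (hf : ∀ α, Sm (n := n) (f α) w) (z : A.prolong w) :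
    Dat (fun w' => ∑ α, f α w') w z = ∑ α, Dat (f α) w z :=
  mvfderiv_sum_apply (f := f) (fun α => (hf α).md) _

lemma Dat_sum_mul {f g : Fin m → TotalSpace (Fib m) E → ℝ} {w : TotalSpace (Fib m) E}
    (hf : ∀ α, Sm (n := n) (f α) w) (hg : ∀ α, Sm (n := n) (g α) w) (z : A.prolong w) :
    Dat (fun w' => ∑ α, f α w' * g α w') w z =
      ∑ α, (f α w * Dat (g α) w z + Dat (f α) w z * g α w) := by
  rw [Dat_sum (f := fun α w' => f α w' * g α w') fun α => (hf α).mul (hg α)]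
  exact Finset.sum_congr rfl fun α _ => Dat_mul (hf α) (hg α) z

lemma Dat_const (c : ℝ) {w : TotalSpace (Fib m) E} (z : A.prolong w) :
    Dat (fun _ => c) w z = 0 :=
  mvfderiv_const_apply _ _

variable {s : Fin m → ∀ x, E x} {U : Set M} (hs : IsLocalFrameOn (𝓡 n) (Fib m) ∞ s U)
  {W : Set (TotalSpace (Fib m) E)} {L : TotalSpace (Fib m) E → ℝ}

lemma Dat_comp_proj_frameV {f : M → ℝ} {w : TotalSpace (Fib m) E}
    (hf : ContMDiffAt (𝓡 n) 𝓘(ℝ, ℝ) ∞ f w.proj) (α : Fin m) :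
    Dat (fun w' : TotalSpace (Fib m) E => f w'.proj) w (frameV A s α w) = 0 := by
  have h1 := mvfderiv_comp_proj (w := w) hf.md (frameV A s α w).1.2
  rw [← anchor_eq_Tproj] at h1
  refine h1.trans ?_
  show mvfderiv (𝓡 n) f w.proj (A.anchor w.proj 0) = 0
  rw [map_zero, map_zero]

lemma Dat_vert (hU : IsOpen U) {w : TotalSpace (Fib m) E} (hw : w.proj ∈ U)
    (f : TotalSpace (Fib m) E → ℝ) (a : E w.proj) :
    Dat f w (A.vert w a) = ∑ α, hs.coeff α w.proj a * D (frameV A s α) f w := by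
  rw [Dat_decomp hs hU hw]
  simp [uc_vert, vc_vert hs hU hw]

lemma sm_of_mem (hW : IsOpen W) (hL : ContMDiffOn (IE n m) 𝓘(ℝ, ℝ) ∞ L W)
    {w : TotalSpace (Fib m) E} (hw : w ∈ W) : Sm (n := n) L w :=
  hL.contMDiffAt (hW.mem_nhds hw)

lemma dY_eq_D (A : LieAlgebroid n m E) (hW : IsOpen W) (hL : ContMDiffOn (IE n m) 𝓘(ℝ, ℝ) ∞ L W)
    {w : TotalSpace (Fib m) E} (hw : w ∈ W) (α : Fin m) :
    dY s α L w = D (frameV A s α) L w :=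
  (D_frameV α (sm_of_mem hW hL hw).md).symm

lemma dY_eventuallyEq_D (A : LieAlgebroid n m E) (hW : IsOpen W) (hL : ContMDiffOn (IE n m) 𝓘(ℝ, ℝ) ∞ L W)
    {w : TotalSpace (Fib m) E} (hw : w ∈ W) (α : Fin m) :
    dY s α L =ᶠ[𝓝 w] D (frameV A s α) L :=
  (hW.eventually_mem hw).mono fun _ h => dY_eq_D A hW hL h α

lemma sm_dY (A : LieAlgebroid n m E) (hs : IsLocalFrameOn (𝓡 n) (Fib m) ∞ s U) (hU : IsOpen U) (hW : IsOpen W)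
    (hL : ContMDiffOn (IE n m) 𝓘(ℝ, ℝ) ∞ L W)
    {w : TotalSpace (Fib m) E} (hw : w ∈ W) (hwU : w.proj ∈ U) (α : Fin m) :
    Sm (n := n) (dY s α L) w :=
  ((smoothAt_frameV (A := A) hs hU hwU α).D (sm_of_mem hW hL hw)).congr_of_eventuallyEq
    (dY_eventuallyEq_D A hW hL hw α)

lemma gMat_eq_D (A : LieAlgebroid n m E) (hs : IsLocalFrameOn (𝓡 n) (Fib m) ∞ s U) (hU : IsOpen U) (hW : IsOpen W)
    (hL : ContMDiffOn (IE n m) 𝓘(ℝ, ℝ) ∞ L W)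
    {w : TotalSpace (Fib m) E} (hw : w ∈ W) (hwU : w.proj ∈ U) (α β : Fin m) :
    gMat s L w α β = D (frameV A s α) (dY s β L) w :=
  (D_frameV α (sm_dY A hs hU hW hL hw hwU β).md).symm

lemma sm_gMat (A : LieAlgebroid n m E) (hs : IsLocalFrameOn (𝓡 n) (Fib m) ∞ s U) (hU : IsOpen U) (hW : IsOpen W)
    (hL : ContMDiffOn (IE n m) 𝓘(ℝ, ℝ) ∞ L W)
    {w : TotalSpace (Fib m) E} (hw : w ∈ W) (hwU : w.proj ∈ U) (α β : Fin m) :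
    Sm (n := n) (fun w' => gMat s L w' α β) w :=
  ((smoothAt_frameV (A := A) hs hU hwU α).D (sm_dY A hs hU hW hL hw hwU β)).congr_of_eventuallyEq
    (((hW.eventually_mem hw).and (eventually_proj_mem hU hwU)).mono fun _ h =>
      gMat_eq_D A hs hU hW hL h.1 h.2 α β)

lemma fiberHess_eq (A : LieAlgebroid n m E) (hU : IsOpen U) (hW : IsOpen W)
    (hL : ContMDiffOn (IE n m) 𝓘(ℝ, ℝ) ∞ L W)
    {w : TotalSpace (Fib m) E} (hw : w ∈ W) (hwU : w.proj ∈ U) (a b : E w.proj) :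
    fiberHess L w a b =
      ∑ α, ∑ β, hs.coeff α w.proj a * hs.coeff β w.proj b * gMat s L w α β := by
  have hline : ContinuousAt (fiberLine w a) 0 :=
    (contMDiff_fiberLine (n := n) w a).continuous.continuousAt
  have hmem : ∀ᶠ t in 𝓝 (0 : ℝ), fiberLine w a t ∈ W :=
    hline.eventually (by rw [fiberLine_zero]; exact hW.eventually_mem hw)
  -- The inner derivative is that of `L` along a vertical lift at the moving point `fiberLine w a
  -- r`. It has to be known for all small `r`, where openness of `W` is used.
  have h1 : (fun r : ℝ => deriv (fun t : ℝ => L ⟨w.proj, w.2 + r • a + t • b⟩) 0) =ᶠ[𝓝 0]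
      fun r => (fun w' => ∑ β, hs.coeff β w.proj b * dY s β L w') (fiberLine w a r) := by
    filter_upwards [hmem] with r hr
    have h2 := mvfderiv_vlift (w := fiberLine w a r) (sm_of_mem hW hL hr).md b
    have h3 := Dat_vert (A := A) hs hU (w := fiberLine w a r) hwU L b
    refine h2.symm.trans (h3.trans ?_)
    exact Finset.sum_congr rfl fun β _ => by rw [dY_eq_D A hW hL hr]; rfl
  have hsm := sm_dY A hs hU hW hL hw hwU
  have h4 : Sm (n := n) (fun w' => ∑ β, hs.coeff β w.proj b * dY s β L w') w :=
    ContMDiffAt.sum fun β _ => contMDiffAt_const.mul (hsm β)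
  unfold fiberHess
  rw [h1.deriv_eq]
  refine (mvfderiv_vlift h4.md a).symm.trans ?_
  refine (Dat_vert (A := A) hs hU hwU _ a).trans ?_
  refine Finset.sum_congr rfl fun α _ => ?_
  rw [D_eq_Dat, Dat_sum_mul (f := fun β _ => hs.coeff β w.proj b)
    (fun _ => contMDiffAt_const) hsm, Finset.mul_sum]
  refine Finset.sum_congr rfl fun β _ => ?_
  rw [Dat_const, gMat_eq_D A hs hU hW hL hw hwU, D_eq_Dat]
  ring

/-- A nonzero left kernel vector of the matrix would give a nonzero element of the fibre in the
kernel of the Hessian. -/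
lemma gMat_det_ne_zero (A : LieAlgebroid n m E) (hs : IsLocalFrameOn (𝓡 n) (Fib m) ∞ s U) (hU : IsOpen U) (hW : IsOpen W)
    (hL : ContMDiffOn (IE n m) 𝓘(ℝ, ℝ) ∞ L W) (hreg : IsRegularOn L W)
    {w : TotalSpace (Fib m) E} (hw : w ∈ W) (hwU : w.proj ∈ U) : (gMat s L w).det ≠ 0 := by
  intro h
  obtain ⟨c, hc, hc0⟩ := Matrix.exists_vecMul_eq_zero_iff.2 h
  refine hc ?_
  have h1 : ∑ α, c α • s α w.proj = 0 := by
    refine hreg w hw _ fun b => ?_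
    rw [fiberHess_eq hs A hU hW hL hw hwU, Finset.sum_comm]
    refine Finset.sum_eq_zero fun β _ => ?_
    have h2 : ∑ α, c α * gMat s L w α β = 0 := congrFun hc0 β
    calc ∑ α, hs.coeff α w.proj (∑ α, c α • s α w.proj) * hs.coeff β w.proj b * gMat s L w α β
        = hs.coeff β w.proj b * ∑ α, c α * gMat s L w α β := by
          rw [Finset.mul_sum]
          refine Finset.sum_congr rfl fun α _ => ?_
          rw [frame_coeff_sum hs hwU]; ring
      _ = 0 := by rw [h2, mul_zero]
  ext α
  rw [← frame_coeff_sum hs hwU c α, h1, map_zero]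
  rfl

lemma uc_J (ρ : A.Sec) (w : TotalSpace (Fib m) E) (α : Fin m) : uc hs α w (J ρ w) = 0 :=
  uc_vert hs w _ α

lemma vc_J (hU : IsOpen U) {w : TotalSpace (Fib m) E} (hw : w.proj ∈ U) (ρ : A.Sec) (α : Fin m) :
    vc hs α w (J ρ w) = uc hs α w (ρ w) :=
  vc_vert hs hU hw _ α

lemma SmoothAt.J (hs : IsLocalFrameOn (𝓡 n) (Fib m) ∞ s U) (hU : IsOpen U)
    {w : TotalSpace (Fib m) E} (hw : w.proj ∈ U) {ρ : A.Sec}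
    (h : SmoothAt ρ w) : SmoothAt (J ρ) w :=
  smoothAt_of_components hs hU hw
    (fun α => contMDiffAt_const.congr_of_eventuallyEq
      (Eventually.of_forall fun w' => uc_J hs ρ w' α))
    (fun α => (h.uc hs hU hw α).congr_of_eventuallyEq
      ((eventually_proj_mem hU hw).mono fun _ hw' => vc_J hs hU hw' ρ α))

lemma uc_euler (w : TotalSpace (Fib m) E) (α : Fin m) : uc hs α w (A.euler w) = 0 :=
  uc_vert hs w _ α

lemma vc_euler (hU : IsOpen U) {w : TotalSpace (Fib m) E} (hw : w.proj ∈ U) (α : Fin m) :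
    vc hs α w (A.euler w) = fibCoord hs α w :=
  vc_vert hs hU hw _ α

lemma theta_eq (hU : IsOpen U) (hW : IsOpen W)
    (hL : ContMDiffOn (IE n m) 𝓘(ℝ, ℝ) ∞ L W)
    {w : TotalSpace (Fib m) E} (hw : w ∈ W) (hwU : w.proj ∈ U) (ρ : A.Sec) :
    theta L ρ w = ∑ α, uc hs α w (ρ w) * dY s α L w := by
  refine (Dat_vert (A := A) hs hU hwU L _).trans (Finset.sum_congr rfl fun α _ => ?_)
  rw [dY_eq_D A hW hL hw]
  rfl

lemma energy_eq (hU : IsOpen U) (hW : IsOpen W)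
    (hL : ContMDiffOn (IE n m) 𝓘(ℝ, ℝ) ∞ L W)
    {w : TotalSpace (Fib m) E} (hw : w ∈ W) (hwU : w.proj ∈ U) :
    A.energy L w = ∑ α, fibCoord hs α w * dY s α L w - L w := by
  refine congrArg (· - L w) ((Dat_vert (A := A) hs hU hwU L _).trans (Finset.sum_congr rfl fun α _ => ?_))
  rw [dY_eq_D A hW hL hw]
  rfl

lemma D_theta (hU : IsOpen U) (hW : IsOpen W)
    (hL : ContMDiffOn (IE n m) 𝓘(ℝ, ℝ) ∞ L W)
    {w : TotalSpace (Fib m) E} (hw : w ∈ W) (hwU : w.proj ∈ U) (ρ : A.Sec) {ν : A.Sec}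
    (hν : SmoothAt ν w) :
    D ρ (theta L ν) w = ∑ α, (uc hs α w (ν w) * D ρ (dY s α L) w
      + D ρ (fun w' => uc hs α w' (ν w')) w * dY s α L w) := by
  have h1 : theta L ν =ᶠ[𝓝 w] fun w' => ∑ α, uc hs α w' (ν w') * dY s α L w' :=
    ((hW.eventually_mem hw).and (eventually_proj_mem hU hwU)).mono fun _ h =>
      theta_eq hs hU hW hL h.1 h.2 ν
  have h2 := fun α => sm_dY A hs hU hW hL hw hwU α
  rw [D_eq_Dat, Dat_congr h1]
  exact Dat_sum_mul (f := fun α w' => uc hs α w' (ν w')) (hν.uc hs hU hwU) h2 _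

/-- Differentiating the factor `y^α` in `y^α ∂_α L` produces the vertical part of `dL`, which the
term `-L` cancels. -/
lemma D_energy (hU : IsOpen U) (hW : IsOpen W)
    (hL : ContMDiffOn (IE n m) 𝓘(ℝ, ℝ) ∞ L W)
    {w : TotalSpace (Fib m) E} (hw : w ∈ W) (hwU : w.proj ∈ U) (ν : A.Sec) :
    D ν (A.energy L) w = ∑ α, fibCoord hs α w * D ν (dY s α L) w
      - ∑ β, uc hs β w (ν w) * D (frameX A hs β) L w := by
  have h1 : A.energy L =ᶠ[𝓝 w] fun w' => (∑ α, fibCoord hs α w' * dY s α L w') - L w' :=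
    ((hW.eventually_mem hw).and (eventually_proj_mem hU hwU)).mono fun _ h =>
      energy_eq hs hU hW hL h.1 h.2
  have h2 := fun α => sm_dY A hs hU hW hL hw hwU α
  have h3 := sm_fibCoord (n := n) hs hU hwU
  have h4 : Sm (n := n) (fun w' => ∑ α, fibCoord hs α w' * dY s α L w') w :=
    ContMDiffAt.sum fun α _ => (h3 α).mul (h2 α)
  rw [D_eq_Dat, Dat_congr h1, Dat_sub h4 (sm_of_mem hW hL hw), Dat_sum_mul h3 h2,
    Dat_decomp hs hU hwU L]
  simp only [dY_eq_D A hW hL hw, Finset.sum_add_distrib]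
  simp only [D_eq_Dat, vc]
  ring

end Lagrangian

/-! ### The Cartan 2-section in components, and extension of vectors to sections. -/

section Omega

variable [T2Space M] {s : Fin m → ∀ x, E x} {U : Set M}
  (hs : IsLocalFrameOn (𝓡 n) (Fib m) ∞ s U)
  {W : Set (TotalSpace (Fib m) E)} {L : TotalSpace (Fib m) E → ℝ}

lemma gMat_symm (A : LieAlgebroid n m E) (hs : IsLocalFrameOn (𝓡 n) (Fib m) ∞ s U) (hU : IsOpen U) (hW : IsOpen W)
    (hL : ContMDiffOn (IE n m) 𝓘(ℝ, ℝ) ∞ L W)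
    {w : TotalSpace (Fib m) E} (hw : w ∈ W) (hwU : w.proj ∈ U) (α β : Fin m) :
    gMat s L w α β = gMat s L w β α := by
  rw [gMat_eq_D A hs hU hW hL hw hwU, gMat_eq_D A hs hU hW hL hw hwU, D_eq_Dat, D_eq_Dat,
    Dat_congr (dY_eventuallyEq_D A hW hL hw β), Dat_congr (dY_eventuallyEq_D A hW hL hw α)]
  exact D_frameV_frameV_comm hs hU hwU (sm_of_mem hW hL hw) α β

/-- The components of the Cartan 2-section; in particular it is tensorial. -/
lemma omega_eq (hU : IsOpen U) (hW : IsOpen W)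
    (hL : ContMDiffOn (IE n m) 𝓘(ℝ, ℝ) ∞ L W)
    {w : TotalSpace (Fib m) E} (hw : w ∈ W) (hwU : w.proj ∈ U) {ρ ν : A.Sec}
    (hρ : SmoothAt ρ w) (hν : SmoothAt ν w) :
    omega L ρ ν w = ∑ β, uc hs β w (ν w) * Dat (dY s β L) w (ρ w)
      - ∑ α, uc hs α w (ρ w) * Dat (dY s α L) w (ν w)
      - ∑ α, ∑ β, uc hs α w (ρ w) * uc hs β w (ν w)
        * ∑ γ, structFun hs A γ α β w.proj * dY s γ L w := by
  unfold omega
  rw [D_theta hs hU hW hL hw hwU ρ hν, D_theta hs hU hW hL hw hwU ν hρ,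
    theta_eq hs hU hW hL hw hwU]
  simp only [uc_br hs hU hwU hρ hν]
  -- The derivatives of the components of `ρ` and `ν` occur in `D_theta` and again in `θ_L([ρ, ν])`,
  -- and cancel. Of the latter only this structure-function term survives.
  have e1 : ∑ γ, (∑ α, ∑ β, uc hs α w (ρ w) * uc hs β w (ν w) * structFun hs A γ α β w.proj)
      * dY s γ L w = ∑ α, ∑ β, uc hs α w (ρ w) * uc hs β w (ν w)
        * ∑ γ, structFun hs A γ α β w.proj * dY s γ L w := by
    simp only [Finset.mul_sum, Finset.sum_mul]
    rw [Finset.sum_comm]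
    refine Finset.sum_congr rfl fun α _ => ?_
    rw [Finset.sum_comm]
    refine Finset.sum_congr rfl fun β _ => Finset.sum_congr rfl fun γ _ => ?_
    ring
  simp only [add_mul, sub_mul, Finset.sum_add_distrib, Finset.sum_sub_distrib, e1, D_eq_Dat]
  ring

/-- Every element of `𝒯_w E` extends to a global smooth section. -/
lemma exists_section {w : TotalSpace (Fib m) E} (z : A.prolong w) :
    ∃ ν : A.Sec, (∀ w', SmoothAt ν w') ∧ ν w = z ∧ (IsVertical z → ∀ w', IsVertical (ν w')) := by
  obtain ⟨s, U, hU, hwU, hs⟩ := exists_frame (n := n) (m := m) (E := E) w.proj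
  obtain ⟨χ, hχ, hsupp, hχ1⟩ := exists_bump (n := n) (hU.mem_nhds hwU)
  set ν : A.Sec := fun w' => χ w'.proj • (∑ α, uc hs α w z • frameX A hs α w'
      + ∑ α, vc hs α w z • frameV A s α w') with hν
  refine ⟨ν, fun w' => ?_, ?_, fun hz w' => ?_⟩
  · by_cases hw' : w'.proj ∈ U
    · have hχ' : Sm (n := n) (fun w' : TotalSpace (Fib m) E => χ w'.proj) w' :=
        sm_comp_proj hχ.contMDiffAt
      refine smoothAt_of_components hs hU hw' (fun β => ?_) fun β => ?_
      · refine (hχ'.mul (contMDiffAt_const (c := uc hs β w z))).congr_of_eventuallyEq ?_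
        filter_upwards [eventually_proj_mem hU hw'] with w'' hw''
        simp [hν, map_sum, uc_frameX hs hU hw'', uc_frameV]
      · refine (hχ'.mul (contMDiffAt_const (c := vc hs β w z))).congr_of_eventuallyEq ?_
        filter_upwards [eventually_proj_mem hU hw'] with w'' hw''
        simp [hν, map_sum, vc_frameX hs hU hw'', vc_frameV hs hU hw'']
    · obtain ⟨s', U', hU', hwU', hs'⟩ := exists_frame (n := n) (m := m) (E := E) w'.proj
      have h0 : ∀ᶠ w'' in 𝓝 w', ν w'' = 0 := by
        -- Over points outside `U` the section vanishes near `w'`, since the support of `χ` is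
        -- closed and contained in `U`.
        have hop : IsOpen (tsupport χ)ᶜ := (isClosed_tsupport χ).isOpen_compl
        filter_upwards [eventually_proj_mem hop (fun h => hw' (hsupp h))] with w'' hw''
        rw [hν]
        simp only [image_eq_zero_of_notMem_tsupport hw'', zero_smul]
      refine smoothAt_of_components hs' hU' hwU' (fun β => ?_) fun β => ?_
      · exact (contMDiffAt_const (c := (0 : ℝ))).congr_of_eventuallyEq
          (h0.mono fun w'' h => by simp only [h, map_zero])
      · exact (contMDiffAt_const (c := (0 : ℝ))).congr_of_eventuallyEq
          (h0.mono fun w'' h => by simp only [h, map_zero])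
  · have h1 : χ w.proj = 1 := hχ1.self_of_nhds
    rw [hν]
    simp only [h1, one_smul]
    exact (prolong_decomp hs hU hwU z).symm
  · have h1 : ∀ α, uc hs α w z = 0 := fun α => by rw [uc_apply, hz, map_zero]
    rw [hν]
    simp only [h1, zero_smul, Finset.sum_const_zero, zero_add]
    show ((χ w'.proj • ∑ α, vc hs α w z • frameV A s α w' : A.prolong w') :
      E w'.proj × TangentSpace (IE n m) w').1 = 0
    simp only [Submodule.coe_smul, Submodule.coe_sum, Prod.smul_fst, Prod.fst_sum]
    have h2 : ∀ α, ((frameV A s α w' : A.prolong w') :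
      E w'.proj × TangentSpace (IE n m) w').1 = 0 := fun α => rfl
    simp [h2]

end Omega

/-! ### The Euler–Lagrange section. -/

section EulerLagrange

variable [T2Space M] {s : Fin m → ∀ x, E x} {U : Set M}
  (hs : IsLocalFrameOn (𝓡 n) (Fib m) ∞ s U)
  {W : Set (TotalSpace (Fib m) E)} {L : TotalSpace (Fib m) E → ℝ}

/-- The Euler–Lagrange equations at `w`, in a local frame. -/
structure ELAt (L : TotalSpace (Fib m) E → ℝ) (w : TotalSpace (Fib m) E) (z : A.prolong w) :
    Prop where
  uc_eq : ∀ α, uc hs α w z = fibCoord hs α w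
  dat_eq : ∀ β, Dat (dY s β L) w z = D (frameX A hs β) L w
    + ∑ α, fibCoord hs α w * ∑ γ, structFun hs A γ α β w.proj * dY s γ L w

/-- Both sides of the symplectic equation are tensorial in `ν`, so global sections suffice to test
it on every `z ∈ 𝒯_w E`, in particular on frame elements. -/
lemma elAt_of_omega_eq (hU : IsOpen U) (hW : IsOpen W) (hL : ContMDiffOn (IE n m) 𝓘(ℝ, ℝ) ∞ L W)
    (hreg : IsRegularOn L W) {w : TotalSpace (Fib m) E} (hw : w ∈ W) (hwU : w.proj ∈ U)
    {S : A.Sec} (hS : SmoothAt S w)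
    (h : ∀ ν : A.Sec, (∀ w', SmoothAt ν w') → omega L S ν w = -D ν (A.energy L) w) :
    ELAt hs L w (S w) := by
  have H : ∀ z : A.prolong w, ∑ β, uc hs β w z * Dat (dY s β L) w (S w)
    - ∑ α, uc hs α w (S w) * Dat (dY s α L) w z
    - ∑ α, ∑ β, uc hs α w (S w) * uc hs β w z
      * ∑ γ, structFun hs A γ α β w.proj * dY s γ L w =
    -(∑ α, fibCoord hs α w * Dat (dY s α L) w z
    - ∑ β, uc hs β w z * D (frameX A hs β) L w) := by
    intro z
    obtain ⟨ν, hν, hνz, -⟩ := exists_section z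
    have h1 := h ν hν
    rw [omega_eq hs hU hW hL hw hwU hS (hν w), D_energy hs hU hW hL hw hwU] at h1
    simp only [D_eq_Dat ν, hνz] at h1
    exact h1
  have hu : ∀ α, uc hs α w (S w) = fibCoord hs α w := by
    -- Testing on `𝒱_δ` leaves only the Hessian terms.
    have h2 : (gMat s L w).mulVec (fun α => uc hs α w (S w) - fibCoord hs α w) = 0 := by
      ext δ
      have h3 := H (frameV A s δ w)
      simp only [uc_frameV, zero_mul, mul_zero, Finset.sum_const_zero, ← D_eq_Dat,
        ← gMat_eq_D A hs hU hW hL hw hwU] at h3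
      show ∑ α, gMat s L w δ α * (uc hs α w (S w) - fibCoord hs α w) = 0
      simp only [mul_comm (gMat s L w δ _), sub_mul, Finset.sum_sub_distrib]
      linarith
    intro α
    have h4 := congrFun (Matrix.eq_zero_of_mulVec_eq_zero
      (gMat_det_ne_zero A hs hU hW hL hreg hw hwU) h2) α
    exact sub_eq_zero.1 h4
  refine ⟨hu, fun δ => ?_⟩
  -- On `𝒳_δ`, now that `uc S = y`, the terms `y^α 𝒳_δ(∂_α L)` cancel between `ω_L` and `dE_L`.
  have h3 := H (frameX A hs δ w)
  simp only [uc_frameX hs hU hwU, hu, ite_mul, one_mul, zero_mul, mul_ite, mul_one, mul_zero,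
    Finset.sum_ite_eq', Finset.mem_univ, if_true] at h3
  linarith

lemma ELAt.omega_eq (hU : IsOpen U) (hW : IsOpen W)
    (hL : ContMDiffOn (IE n m) 𝓘(ℝ, ℝ) ∞ L W) {w : TotalSpace (Fib m) E} (hw : w ∈ W)
    (hwU : w.proj ∈ U) {S : A.Sec} (hS : SmoothAt S w) (h : ELAt hs L w (S w)) {ν : A.Sec}
    (hν : SmoothAt ν w) : omega L S ν w = -D ν (A.energy L) w := by
  rw [LieAlgebroid.omega_eq hs hU hW hL hw hwU hS hν, D_energy hs hU hW hL hw hwU]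
  simp only [h.uc_eq, h.dat_eq, D_eq_Dat ν, mul_add, Finset.sum_add_distrib]
  have e1 : ∑ α, ∑ β, fibCoord hs α w * uc hs β w (ν w)
      * ∑ γ, structFun hs A γ α β w.proj * dY s γ L w =
      ∑ β, uc hs β w (ν w) * ∑ α, fibCoord hs α w
        * ∑ γ, structFun hs A γ α β w.proj * dY s γ L w := by
    rw [Finset.sum_comm]
    refine Finset.sum_congr rfl fun β _ => ?_
    rw [Finset.mul_sum]
    exact Finset.sum_congr rfl fun α _ => by ring
  rw [e1]
  ring

/-- The difference of two solutions is vertical, and its contraction with `g` vanishes. -/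
lemma ELAt.unique (hU : IsOpen U) (hW : IsOpen W)
    (hL : ContMDiffOn (IE n m) 𝓘(ℝ, ℝ) ∞ L W) (hreg : IsRegularOn L W)
    {w : TotalSpace (Fib m) E} (hw : w ∈ W) (hwU : w.proj ∈ U) {z z' : A.prolong w}
    (h : ELAt hs L w z) (h' : ELAt hs L w z') : z = z' := by
  have hu : ∀ α, uc hs α w z = uc hs α w z' := fun α => by rw [h.uc_eq, h'.uc_eq]
  refine prolong_ext hs hU hwU hu fun α => ?_
  have h2 : Matrix.vecMul (fun α => vc hs α w z - vc hs α w z') (gMat s L w) = 0 := by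
    ext β
    have h3 := (h.dat_eq β).trans (h'.dat_eq β).symm
    simp only [Dat_decomp hs hU hwU (dY s β L), hu, ← gMat_eq_D A hs hU hW hL hw hwU] at h3
    show ∑ α, (vc hs α w z - vc hs α w z') * gMat s L w α β = 0
    simp only [sub_mul, Finset.sum_sub_distrib]
    linarith
  exact sub_eq_zero.1 (congrFun (Matrix.eq_zero_of_vecMul_eq_zero
    (gMat_det_ne_zero A hs hU hW hL hreg hw hwU) h2) α)

/-- The symplectic equation mentions no frame, so the change of frame passes through it instead of
through transformation rules. -/
lemma ELAt.change_frame (hU : IsOpen U) (hW : IsOpen W)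
    (hL : ContMDiffOn (IE n m) 𝓘(ℝ, ℝ) ∞ L W) (hreg : IsRegularOn L W)
    {w : TotalSpace (Fib m) E} (hw : w ∈ W) (hwU : w.proj ∈ U) {z : A.prolong w}
    (h : ELAt hs L w z) {s' : Fin m → ∀ x, E x} {U' : Set M}
    (hs' : IsLocalFrameOn (𝓡 n) (Fib m) ∞ s' U') (hU' : IsOpen U') (hwU' : w.proj ∈ U') :
    ELAt hs' L w z := by
  obtain ⟨S, hS, rfl, -⟩ := exists_section z
  exact elAt_of_omega_eq hs' hU' hW hL hreg hw hwU' (hS w) fun ν hν =>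
    h.omega_eq hs hU hW hL hw hwU (hS w) (hν w)

/-- The vertical components of the Euler–Lagrange section, contracted with the metric. -/
def elForce (A : LieAlgebroid n m E) (L : TotalSpace (Fib m) E → ℝ) (β : Fin m)
    (w : TotalSpace (Fib m) E) : ℝ :=
  D (frameX A hs β) L w
    + ∑ α, fibCoord hs α w * ∑ γ, structFun hs A γ α β w.proj * dY s γ L w
    - ∑ ε, fibCoord hs ε w * D (frameX A hs ε) (dY s β L) w

/-- The Euler–Lagrange section in a local frame. -/
def elSec (A : LieAlgebroid n m E) (L : TotalSpace (Fib m) E → ℝ) : A.Sec := fun w =>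
  ∑ α, fibCoord hs α w • frameX A hs α w
    + ∑ α, (∑ β, elForce hs A L β w * (gMat s L w)⁻¹ β α) • frameV A s α w

lemma uc_elSec (hU : IsOpen U) {w : TotalSpace (Fib m) E} (hwU : w.proj ∈ U) (α : Fin m) :
    uc hs α w (elSec hs A L w) = fibCoord hs α w := by
  simp [elSec, map_sum, uc_frameX hs hU hwU, uc_frameV]

lemma vc_elSec (hU : IsOpen U) {w : TotalSpace (Fib m) E} (hwU : w.proj ∈ U) (α : Fin m) :
    vc hs α w (elSec hs A L w) = ∑ β, elForce hs A L β w * (gMat s L w)⁻¹ β α := by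
  simp [elSec, map_sum, vc_frameX hs hU hwU, vc_frameV hs hU hwU]

lemma elAt_elSec (hU : IsOpen U) (hW : IsOpen W)
    (hL : ContMDiffOn (IE n m) 𝓘(ℝ, ℝ) ∞ L W) (hreg : IsRegularOn L W)
    {w : TotalSpace (Fib m) E} (hw : w ∈ W) (hwU : w.proj ∈ U) :
    ELAt hs L w (elSec hs A L w) := by
  refine ⟨uc_elSec hs hU hwU, fun β => ?_⟩
  rw [Dat_decomp hs hU hwU]
  simp only [uc_elSec hs hU hwU, vc_elSec hs hU hwU, ← gMat_eq_D A hs hU hW hL hw hwU]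
  have h1 : Matrix.vecMul (Matrix.vecMul (fun β => elForce hs A L β w) (gMat s L w)⁻¹)
      (gMat s L w) = fun β => elForce hs A L β w := by
    rw [Matrix.vecMul_vecMul, Matrix.nonsing_inv_mul _
      (gMat_det_ne_zero A hs hU hW hL hreg hw hwU).isUnit, Matrix.vecMul_one]
  have h2 : ∑ α, (∑ β, elForce hs A L β w * (gMat s L w)⁻¹ β α) * gMat s L w α β =
      elForce hs A L β w := congrFun h1 β
  rw [h2, elForce]
  ring

lemma smoothAt_elSec (hU : IsOpen U) (hW : IsOpen W)
    (hL : ContMDiffOn (IE n m) 𝓘(ℝ, ℝ) ∞ L W) (hreg : IsRegularOn L W)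
    {w : TotalSpace (Fib m) E} (hw : w ∈ W) (hwU : w.proj ∈ U) :
    SmoothAt (elSec hs A L) w := by
  have hev := eventually_proj_mem hU hwU
  have hy := sm_fibCoord (n := n) hs hU hwU
  have hX := fun α => smoothAt_frameX (A := A) hs hU hwU α
  have hd := sm_dY A hs hU hW hL hw hwU
  have hstr := fun γ α β => sm_comp_proj (contMDiffAt_structFun (A := A) hs hU hwU γ α β)
  have hF : ∀ β, Sm (n := n) (elForce hs A L β) w := fun β => by
    refine (((hX β).D (sm_of_mem hW hL hw)).add ?_).sub ?_
    · exact ContMDiffAt.sum fun α _ => (hy α).mul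
        (ContMDiffAt.sum fun γ _ => (hstr γ α β).mul (hd γ))
    · exact ContMDiffAt.sum fun ε _ => (hy ε).mul ((hX ε).D (hd β))
  refine smoothAt_of_components hs hU hwU (fun α => ?_) fun α => ?_
  · exact (hy α).congr_of_eventuallyEq (hev.mono fun _ h => uc_elSec hs hU h α)
  · refine ContMDiffAt.congr_of_eventuallyEq ?_ (hev.mono fun _ h => vc_elSec hs hU h α)
    exact ContMDiffAt.sum fun β _ => (hF β).mul (ContMDiffAt.matrix_inv_apply
      (sm_gMat A hs hU hW hL hw hwU) (gMat_det_ne_zero A hs hU hW hL hreg hw hwU) β α)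

/-- At each `w` the local solution is taken in a frame chosen for the point `π(w)`. Smoothness comes
from uniqueness: near `w` all these values agree with the solution in the single frame at `w`. -/
lemma exists_eulerLagrange (A : LieAlgebroid n m E) (hW : IsOpen W)
    (hL : ContMDiffOn (IE n m) 𝓘(ℝ, ℝ) ∞ L W) (hreg : IsRegularOn L W) :
    ∃ S : A.Sec, SmoothOn S W ∧ ∀ (s : Fin m → ∀ x, E x) (U : Set M)
      (hs : IsLocalFrameOn (𝓡 n) (Fib m) ∞ s U), IsOpen U → ∀ w ∈ W, w.proj ∈ U →
      ELAt hs L w (S w) := by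
  choose s U hU hxU hs using exists_frame (n := n) (m := m) (E := E)
  have hEL : ∀ (s' : Fin m → ∀ x, E x) (U' : Set M)
      (hs' : IsLocalFrameOn (𝓡 n) (Fib m) ∞ s' U'), IsOpen U' → ∀ w ∈ W, w.proj ∈ U' →
      ELAt hs' L w (elSec (hs w.proj) A L w) := fun s' U' hs' hU' w hw hwU' =>
    (elAt_elSec (hs w.proj) (hU _) hW hL hreg hw (hxU _)).change_frame (hs w.proj) (hU _) hW hL hreg
      hw (hxU _) hs' hU' hwU'
  refine ⟨fun w => elSec (hs w.proj) A L w, smoothOn_of_smoothAt fun w hw => ?_, hEL⟩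
  refine (smoothAt_elSec (hs w.proj) (hU _) hW hL hreg hw (hxU _)).congr ?_
  filter_upwards [hW.eventually_mem hw, eventually_proj_mem (hU w.proj) (hxU w.proj)]
    with w' hw' hwU'
  exact ELAt.unique (hs w.proj) (hU _) hW hL hreg hw' hwU' (hEL _ _ _ (hU _) w' hw' hwU')
    (elAt_elSec (hs w.proj) (hU _) hW hL hreg hw' hwU')

/-- The derivative of the Euler–Lagrange equations along the fibres. -/
lemma D_frameV_eulerLagrange (hU : IsOpen U) (hW : IsOpen W)
    (hL : ContMDiffOn (IE n m) 𝓘(ℝ, ℝ) ∞ L W)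
    {S : A.Sec} (hS : SmoothOn S W) (hEL : ∀ w ∈ W, w.proj ∈ U → ELAt hs L w (S w))
    {w : TotalSpace (Fib m) E} (hw : w ∈ W) (hwU : w.proj ∈ U) (δ β : Fin m) :
    D S (fun w' => gMat s L w' δ β) w + D (frameX A hs δ) (dY s β L) w
      + ∑ γ, D (frameV A s δ) (fun w' => vc hs γ w' (S w')) w * gMat s L w γ β =
    D (frameX A hs β) (dY s δ L) w + ∑ γ, structFun hs A γ δ β w.proj * dY s γ L w
      + ∑ α, fibCoord hs α w * ∑ γ, structFun hs A γ α β w.proj * gMat s L w δ γ := by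
  have hev : ∀ᶠ w' in 𝓝 w, w' ∈ W ∧ w'.proj ∈ U :=
    (hW.eventually_mem hw).and (eventually_proj_mem hU hwU)
  have hSw := hS.smoothAt hW hw
  have hV := smoothAt_frameV (A := A) hs hU hwU δ
  have hy := sm_fibCoord (n := n) hs hU hwU
  have hX := fun α => smoothAt_frameX (A := A) hs hU hwU α
  have hd := sm_dY A hs hU hW hL hw hwU
  have hstr := fun γ α β => sm_comp_proj (contMDiffAt_structFun (A := A) hs hU hwU γ α β)
  have hLw := sm_of_mem hW hL hw
  have hK : ∀ α, Sm (n := n)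
      (fun w' => ∑ γ, structFun hs A γ α β w'.proj * dY s γ L w') w := fun α =>
    ContMDiffAt.sum fun γ _ => (hstr γ α β).mul (hd γ)
  have h1 : D S (dY s β L) =ᶠ[𝓝 w] fun w' => D (frameX A hs β) L w'
      + ∑ α, fibCoord hs α w' * ∑ γ, structFun hs A γ α β w'.proj * dY s γ L w' :=
    hev.mono fun w' h => (hEL w' h.1 h.2).dat_eq β
  -- The Euler–Lagrange equation holds on a neighbourhood of `w`, so it may be differentiated along
  -- `𝒱_δ`.
  have h2 : Dat (D S (dY s β L)) w (frameV A s δ w) = _ := Dat_congr h1 _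
  have hsum : Sm (n := n) (fun w' => ∑ α, fibCoord hs α w'
      * ∑ γ, structFun hs A γ α β w'.proj * dY s γ L w') w :=
    ContMDiffAt.sum fun α _ => (hy α).mul (hK α)
  rw [Dat_add ((hX β).D hLw) hsum, Dat_sum_mul hy hK] at h2
  have h3 := Dat_br hs hU hwU hSw hV (hd β)
  -- With `h5` this says `[S, 𝒱_δ] = -𝒳_δ - (∂_δ S^γ) 𝒱_γ`. Applied to `∂_β L`, it converts
  -- `𝒱_δ(S(∂_β L))` into `S(g_{δβ})` plus the remaining terms on the left.
  have h4 : ∀ γ, vc hs γ w (br S (frameV A s δ) w) =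
      -D (frameV A s δ) (fun w' => vc hs γ w' (S w')) w := by
    intro γ
    rw [vc_br hs hU hwU hSw hV, D_eq_Dat, Dat_congr (g := fun _ => if γ = δ then 1 else 0)
          (hev.mono fun w' hw' => vc_frameV hs hU hw'.2 γ δ), Dat_const, zero_sub]
  have h5 : ∀ γ, uc hs γ w (br S (frameV A s δ) w) = -if γ = δ then 1 else 0 := by
    intro γ
    rw [uc_br hs hU hwU hSw hV, D_eq_Dat, Dat_congr (g := fun _ => 0)
      (hev.mono fun w' hw' => uc_frameV hs w' γ δ), Dat_const, zero_sub, D_eq_Dat,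
      Dat_congr (g := fibCoord hs γ) (hev.mono fun w' hw' => (hEL w' hw'.1 hw'.2).uc_eq γ)]
    simp only [uc_frameV, mul_zero, zero_mul, Finset.sum_const_zero, add_zero]
    exact congrArg Neg.neg (vc_frameV hs hU hwU γ δ)
  rw [Dat_decomp hs hU hwU] at h3
  simp only [h4, h5, ← gMat_eq_D A hs hU hW hL hw hwU, neg_mul, ite_mul, one_mul, zero_mul,
    Finset.sum_neg_distrib, Finset.sum_ite_eq', Finset.mem_univ, if_true] at h3
  have h6 : D S (D (frameV A s δ) (dY s β L)) w = D S (fun w' => gMat s L w' δ β) w :=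
    Dat_congr (hev.mono fun w' h => (gMat_eq_D A hs hU hW hL h.1 h.2 δ β).symm) _
  have h7 : Dat (D (frameX A hs β) L) w (frameV A s δ w) = D (frameX A hs β) (dY s δ L) w := by
    refine (D_frameX_frameV_comm hs hU hwU hLw β δ).symm.trans ?_
    exact (Dat_congr (dY_eventuallyEq_D A hW hL hw δ) _).symm
  have h8 : ∀ α, Dat (fun w' => ∑ γ, structFun hs A γ α β w'.proj * dY s γ L w') w
      (frameV A s δ w) = ∑ γ, structFun hs A γ α β w.proj * gMat s L w δ γ := by
    intro α
    rw [Dat_sum_mul (f := fun γ w' => structFun hs A γ α β w'.proj) (fun γ => hstr γ α β) hd]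
    refine Finset.sum_congr rfl fun γ _ => ?_
    rw [Dat_comp_proj_frameV (contMDiffAt_structFun hs hU hwU γ α β), zero_mul, add_zero,
      gMat_eq_D A hs hU hW hL hw hwU]
    rfl
  have h9 : ∀ α, Dat (fibCoord hs α) w (frameV A s δ w) = if α = δ then 1 else 0 := fun α =>
    vc_frameV hs hU hwU α δ
  simp only [h7, h8, h9, Finset.sum_add_distrib, ite_mul, one_mul, zero_mul,
    Finset.sum_ite_eq', Finset.mem_univ, if_true] at h2
  rw [D_eq_Dat (frameV A s δ) (D S (dY s β L)), h2, h6] at h3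
  linarith

end EulerLagrange

/-! ### The connection induced by a semispray, and connections in components. -/

section Connections

variable [T2Space M] {s : Fin m → ∀ x, E x} {U : Set M}
  (hs : IsLocalFrameOn (𝓡 n) (Fib m) ∞ s U)
  {W : Set (TotalSpace (Fib m) E)} {L : TotalSpace (Fib m) E → ℝ}

lemma IsVertical.uc_eq_zero {w : TotalSpace (Fib m) E} {z : A.prolong w} (hz : IsVertical z)
    (α : Fin m) : uc hs α w z = 0 := by
  rw [uc_apply, hz, map_zero]

lemma isVertical_of_uc {w : TotalSpace (Fib m) E} (hw : w.proj ∈ U) {z : A.prolong w}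
    (h : ∀ α, uc hs α w z = 0) : IsVertical z :=
  frame_ext hs hw fun α => (h α).trans (map_zero _).symm

/-- `∂S^γ/∂y^β + y^α L^γ_{αβ}`: the components of `-ℒ_S J` for a semispray `S`. -/
def inducedCoeff (S : A.Sec) (γ β : Fin m) (w : TotalSpace (Fib m) E) : ℝ :=
  D (frameV A s β) (fun w' => vc hs γ w' (S w')) w
    + ∑ α, fibCoord hs α w * structFun hs A γ α β w.proj

lemma sm_inducedCoeff (hU : IsOpen U) {w : TotalSpace (Fib m) E} (hwU : w.proj ∈ U) {S : A.Sec}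
    (hS : SmoothAt S w) (γ β : Fin m) : Sm (n := n) (inducedCoeff hs S γ β) w :=
  ((smoothAt_frameV hs hU hwU β).D (hS.vc hs hU hwU γ)).add
    (ContMDiffAt.sum fun α _ => (sm_fibCoord hs hU hwU α).mul
      (sm_comp_proj (contMDiffAt_structFun hs hU hwU γ α β)))

lemma Dat_of_isVertical (hU : IsOpen U) {w : TotalSpace (Fib m) E} (hwU : w.proj ∈ U)
    (f : TotalSpace (Fib m) E → ℝ) {z : A.prolong w} (hz : ∀ α, uc hs α w z = 0) :
    Dat f w z = ∑ α, vc hs α w z * D (frameV A s α) f w := by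
  rw [Dat_decomp hs hU hwU]
  simp [hz]

section Induced

variable {S : A.Sec}

/-- The semispray identity `J[S, Jρ] = -Jρ` in components. It comes from differentiating `uc S = y`
along `Jρ`. -/
lemma uc_br_J (hU : IsOpen U) {w : TotalSpace (Fib m) E} (hwU : w.proj ∈ U) (hS : SmoothAt S w)
    (hy : ∀ᶠ w' in 𝓝 w, ∀ α, uc hs α w' (S w') = fibCoord hs α w') {ρ : A.Sec}
    (hρ : SmoothAt ρ w) (γ : Fin m) : uc hs γ w (br S (J ρ) w) = -uc hs γ w (ρ w) := by
  rw [uc_br hs hU hwU hS (hρ.J hs hU hwU), D_eq_Dat, Dat_congr (g := fun _ => 0)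
      (Eventually.of_forall fun w' => uc_J hs ρ w' γ), Dat_const, zero_sub, D_eq_Dat,
      Dat_congr (g := fibCoord hs γ) (hy.mono fun w' h => h γ)]
  simp only [uc_J, mul_zero, zero_mul, Finset.sum_const_zero, add_zero]
  exact congrArg Neg.neg (vc_J hs hU hwU ρ γ)

lemma vc_br_J (hU : IsOpen U) {w : TotalSpace (Fib m) E} (hwU : w.proj ∈ U) (hS : SmoothAt S w)
    {ρ : A.Sec} (hρ : SmoothAt ρ w) (γ : Fin m) :
    vc hs γ w (br S (J ρ) w) = D S (fun w' => uc hs γ w' (ρ w')) w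
      - ∑ β, uc hs β w (ρ w) * D (frameV A s β) (fun w' => vc hs γ w' (S w')) w := by
  rw [vc_br hs hU hwU hS (hρ.J hs hU hwU), D_eq_Dat, Dat_congr
      ((eventually_proj_mem hU hwU).mono fun w' h => vc_J hs hU h ρ γ), D_eq_Dat (J ρ),
      Dat_of_isVertical hs hU hwU _ (uc_J hs ρ w)]
  simp only [vc_J hs hU hwU]
  rfl

lemma uc_br_semispray (hU : IsOpen U) {w : TotalSpace (Fib m) E} (hwU : w.proj ∈ U)
    (hS : SmoothAt S w) (hy : ∀ᶠ w' in 𝓝 w, ∀ α, uc hs α w' (S w') = fibCoord hs α w')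
    {ρ : A.Sec} (hρ : SmoothAt ρ w) (γ : Fin m) :
    uc hs γ w (br S ρ w) = D S (fun w' => uc hs γ w' (ρ w')) w - vc hs γ w (ρ w)
      + ∑ β, uc hs β w (ρ w) * ∑ α, fibCoord hs α w * structFun hs A γ α β w.proj := by
  rw [uc_br hs hU hwU hS hρ, D_eq_Dat ρ, Dat_congr (g := fibCoord hs γ) (hy.mono fun w' h => h γ),
    Finset.sum_comm]
  refine congrArg₂ _ rfl (Finset.sum_congr rfl fun β _ => ?_)
  rw [Finset.mul_sum]
  refine Finset.sum_congr rfl fun α _ => ?_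
  rw [hy.self_of_nhds α]
  ring

lemma uc_induced (hU : IsOpen U) {w : TotalSpace (Fib m) E} (hwU : w.proj ∈ U)
    (hS : SmoothAt S w) (hy : ∀ᶠ w' in 𝓝 w, ∀ α, uc hs α w' (S w') = fibCoord hs α w')
    {ρ : A.Sec} (hρ : SmoothAt ρ w) (γ : Fin m) :
    uc hs γ w (-br S (J ρ) w + J (br S ρ) w) = uc hs γ w (ρ w) := by
  rw [map_add, map_neg, uc_br_J hs hU hwU hS hy hρ, uc_J, neg_neg, add_zero]

/-- The terms `S(ρ^γ)` of the two brackets cancel, so `-ℒ_S J` depends only on the value of `ρ` at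
`w`. -/
lemma vc_induced (hU : IsOpen U) {w : TotalSpace (Fib m) E} (hwU : w.proj ∈ U)
    (hS : SmoothAt S w) (hy : ∀ᶠ w' in 𝓝 w, ∀ α, uc hs α w' (S w') = fibCoord hs α w')
    {ρ : A.Sec} (hρ : SmoothAt ρ w) (γ : Fin m) :
    vc hs γ w (-br S (J ρ) w + J (br S ρ) w) =
      -vc hs γ w (ρ w) + ∑ β, uc hs β w (ρ w) * inducedCoeff hs S γ β w := by
  rw [map_add, map_neg, vc_br_J hs hU hwU hS hρ, vc_J hs hU hwU,
    uc_br_semispray hs hU hwU hS hy hρ]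
  simp only [inducedCoeff, mul_add, Finset.sum_add_distrib]
  ring

/-- The endomorphism `-ℒ_S J` of `𝒯_w E`, in a local frame. -/
def inducedMap (S : A.Sec) (w : TotalSpace (Fib m) E) : A.prolong w →ₗ[ℝ] A.prolong w :=
  ∑ α, (uc hs α w).smulRight (frameX A hs α w)
    + ∑ α, (-vc hs α w + ∑ β, inducedCoeff hs S α β w • uc hs β w).smulRight (frameV A s α w)

lemma uc_inducedMap (hU : IsOpen U) {w : TotalSpace (Fib m) E} (hwU : w.proj ∈ U)
    (z : A.prolong w) (γ : Fin m) : uc hs γ w (inducedMap hs S w z) = uc hs γ w z := by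
  simp [inducedMap, map_sum, uc_frameX hs hU hwU, uc_frameV]

lemma vc_inducedMap (hU : IsOpen U) {w : TotalSpace (Fib m) E} (hwU : w.proj ∈ U)
    (z : A.prolong w) (γ : Fin m) : vc hs γ w (inducedMap hs S w z) =
      -vc hs γ w z + ∑ β, uc hs β w z * inducedCoeff hs S γ β w := by
  simp [inducedMap, map_sum, vc_frameX hs hU hwU, vc_frameV hs hU hwU, mul_comm]

lemma inducedMap_apply (hU : IsOpen U) {w : TotalSpace (Fib m) E} (hwU : w.proj ∈ U)
    (hS : SmoothAt S w) (hy : ∀ᶠ w' in 𝓝 w, ∀ α, uc hs α w' (S w') = fibCoord hs α w')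
    {ρ : A.Sec} (hρ : SmoothAt ρ w) :
    inducedMap hs S w (ρ w) = -br S (J ρ) w + J (br S ρ) w :=
  prolong_ext hs hU hwU
    (fun γ => by rw [uc_inducedMap hs hU hwU, uc_induced hs hU hwU hS hy hρ])
    (fun γ => by rw [vc_inducedMap hs hU hwU, vc_induced hs hU hwU hS hy hρ])

/-- The endomorphism at `w` is written in a frame chosen for `π(w)`. On smooth sections it equals
the frame-free expression `-[S, Jρ] + J[S, ρ]`, so smoothness near a point can be checked in one
frame. -/
lemma exists_inducedConnection (hW : IsOpen W) (hS : SmoothOn S W)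
    (hy : ∀ (s : Fin m → ∀ x, E x) (U : Set M) (hs : IsLocalFrameOn (𝓡 n) (Fib m) ∞ s U),
      IsOpen U → ∀ w ∈ W, w.proj ∈ U → ∀ α, uc hs α w (S w) = fibCoord hs α w) :
    ∃ N : A.NonlinearConnection W, N.IsInducedBy S := by
  choose s U hU hxU hs using exists_frame (n := n) (m := m) (E := E)
  have hyev : ∀ (s : Fin m → ∀ x, E x) (U : Set M) (hs : IsLocalFrameOn (𝓡 n) (Fib m) ∞ s U),
      IsOpen U → ∀ w ∈ W, w.proj ∈ U →
      ∀ᶠ w' in 𝓝 w, ∀ α, uc hs α w' (S w') = fibCoord hs α w' := by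
    intro s U hs hU w hw hwU
    filter_upwards [hW.eventually_mem hw, eventually_proj_mem hU hwU] with w' h1 h2
    exact hy s U hs hU w' h1 h2
  have hap : ∀ w ∈ W, ∀ ρ : A.Sec, SmoothAt ρ w →
      inducedMap (hs w.proj) S w (ρ w) = -br S (J ρ) w + J (br S ρ) w := fun w hw ρ hρ =>
    inducedMap_apply (hs w.proj) (hU _) (hxU _) (hS.smoothAt hW hw)
      (hyev _ _ _ (hU _) w hw (hxU _)) hρ
  refine ⟨⟨fun w => inducedMap (hs w.proj) S w, fun w _ z => ?_, fun w _ z => ⟨fun h => ?_,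
    fun h => ?_⟩, fun ρ hρ => smoothOn_of_smoothAt fun w hw => ?_⟩, fun ρ hρ w hw =>
      hap w hw ρ (hρ.smoothAt hW hw)⟩
  -- The map `(u, v) ↦ (u, -v + B u)` is an involution.
  · refine prolong_ext (hs w.proj) (hU _) (hxU _) (fun γ => ?_) fun γ => ?_
    · simp only [uc_inducedMap (hs w.proj) (hU _) (hxU _)]
    · simp only [uc_inducedMap (hs w.proj) (hU _) (hxU _),
        vc_inducedMap (hs w.proj) (hU _) (hxU _)]
      ring
  · refine isVertical_of_uc (hs w.proj) (hxU _) fun α => ?_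
    have h1 := congrArg (uc (hs w.proj) α w) h
    rw [map_add, uc_inducedMap (hs w.proj) (hU _) (hxU _), map_zero] at h1
    linarith
  · refine prolong_ext (hs w.proj) (hU _) (hxU _) (fun γ => ?_) fun γ => ?_
    · rw [map_add, uc_inducedMap (hs w.proj) (hU _) (hxU _), map_zero, h.uc_eq_zero, add_zero]
    · rw [map_add, vc_inducedMap (hs w.proj) (hU _) (hxU _), map_zero]
      simp [h.uc_eq_zero]
  · have hρw := hρ.smoothAt hW hw
    have hSw := hS.smoothAt hW hw
    have hfr := hU w.proj
    have hwU := hxU w.proj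
    have hev : ∀ᶠ w' in 𝓝 w, w' ∈ W ∧ w'.proj ∈ U w.proj :=
      (hW.eventually_mem hw).and (eventually_proj_mem hfr hwU)
    refine smoothAt_of_components (hs w.proj) hfr hwU (fun γ => ?_) fun γ => ?_
    -- The frame used at a nearby `w'` need not be the one at `w`. Rewriting with `hap` removes this
    -- dependence before components in the frame at `w` are taken.
    · refine (hρw.uc (hs w.proj) hfr hwU γ).congr_of_eventuallyEq (hev.mono fun w' h => ?_)
      have hρ' := hρ.smoothAt hW h.1
      simp only [hap w' h.1 ρ hρ']
      exact uc_induced (hs w.proj) hfr h.2 (hS.smoothAt hW h.1)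
        (hyev _ _ _ hfr w' h.1 h.2) hρ' γ
    · have h1 : Sm (n := n) (fun w' => -vc (hs w.proj) γ w' (ρ w')
          + ∑ β, uc (hs w.proj) β w' (ρ w') * inducedCoeff (hs w.proj) S γ β w') w :=
        (hρw.vc (hs w.proj) hfr hwU γ).neg.add (ContMDiffAt.sum fun β _ =>
          (hρw.uc (hs w.proj) hfr hwU β).mul (sm_inducedCoeff (hs w.proj) hfr hwU hSw γ β))
      refine h1.congr_of_eventuallyEq (hev.mono fun w' h => ?_)
      have hρ' := hρ.smoothAt hW h.1
      simp only [hap w' h.1 ρ hρ']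
      exact vc_induced (hs w.proj) hfr h.2 (hS.smoothAt hW h.1)
        (hyev _ _ _ hfr w' h.1 h.2) hρ' γ

end Induced

namespace NonlinearConnection

variable (N : A.NonlinearConnection W)

lemma toFun_of_isVertical {w : TotalSpace (Fib m) E} (hw : w ∈ W) {z : A.prolong w}
    (hz : IsVertical z) : N.toFun w z = -z :=
  (neg_eq_of_add_eq_zero_right ((N.ker w hw z).2 hz)).symm

/-- Since `N² = Id`, the vector `Nz - z` lies in `ker (Id + N)`, hence is vertical. -/
lemma uc_toFun {w : TotalSpace (Fib m) E} (hw : w ∈ W) (z : A.prolong w) (α : Fin m) :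
    uc hs α w (N.toFun w z) = uc hs α w z := by
  have h1 : IsVertical (N.toFun w z - z) := by
    refine (N.ker w hw _).1 ?_
    rw [map_sub, N.sq w hw]
    abel
  have h2 := h1.uc_eq_zero hs α
  rw [map_sub] at h2
  linarith

lemma coeff_eq (α β : Fin m) (hU : IsOpen U) {w : TotalSpace (Fib m) E} (hwU : w.proj ∈ U) :
    N.coeff hs α β w = -(1 / 2 : ℝ) * vc hs α w (N.toFun w (frameX A hs β w)) := by
  have h1 : N.coeff hs α β w = -vc hs α w ((1 / 2 : ℝ) • (frameX A hs β w
    + N.toFun w (frameX A hs β w))) := rfl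
  rw [h1, map_smul, map_add, vc_frameX hs hU hwU, smul_eq_mul]
  ring

/-- In components `N` is `(u, v) ↦ (u, -v - 2 N^α_β u^β)`; the factor `2` undoes the half in `h =
(Id + N) / 2`. -/
lemma vc_toFun (hU : IsOpen U) {w : TotalSpace (Fib m) E} (hw : w ∈ W) (hwU : w.proj ∈ U)
    (z : A.prolong w) (α : Fin m) : vc hs α w (N.toFun w z) =
      -vc hs α w z - 2 * ∑ β, N.coeff hs α β w * uc hs β w z := by
  have h1 : ∀ β, N.toFun w (frameV A s β w) = -frameV A s β w := fun β =>
    N.toFun_of_isVertical hw rfl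
  have h2 : ∀ β, vc hs α w (N.toFun w (frameX A hs β w)) = -2 * N.coeff hs α β w := fun β => by
    rw [N.coeff_eq hs α β hU hwU]; ring
  conv_lhs => rw [prolong_decomp hs hU hwU z]
  simp only [map_add, map_sum, map_smul, h1, h2, map_neg, vc_frameV hs hU hwU, smul_eq_mul,
    mul_neg, mul_ite, mul_one, mul_zero, Finset.sum_neg_distrib, Finset.sum_ite_eq,
    Finset.mem_univ, if_true, Finset.mul_sum]
  rw [add_comm, sub_eq_add_neg, ← Finset.sum_neg_distrib]
  refine congrArg₂ _ rfl (Finset.sum_congr rfl fun β _ => ?_)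
  ring

lemma uc_h {w : TotalSpace (Fib m) E} (hw : w ∈ W) (ρ : A.Sec) (α : Fin m) :
    uc hs α w (N.h ρ w) = uc hs α w (ρ w) := by
  unfold NonlinearConnection.h
  rw [map_smul, map_add, N.uc_toFun hs hw, smul_eq_mul]
  ring

lemma vc_h (hU : IsOpen U) {w : TotalSpace (Fib m) E} (hw : w ∈ W) (hwU : w.proj ∈ U)
    (ρ : A.Sec) (α : Fin m) :
    vc hs α w (N.h ρ w) = -∑ β, N.coeff hs α β w * uc hs β w (ρ w) := by
  unfold NonlinearConnection.h
  rw [map_smul, map_add, N.vc_toFun hs hU hw hwU, smul_eq_mul]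
  ring

lemma uc_v {w : TotalSpace (Fib m) E} (hw : w ∈ W) (ρ : A.Sec) (α : Fin m) :
    uc hs α w (N.v ρ w) = 0 := by
  unfold NonlinearConnection.v
  rw [map_smul, map_sub, N.uc_toFun hs hw, sub_self, smul_zero]

lemma vc_v (hU : IsOpen U) {w : TotalSpace (Fib m) E} (hw : w ∈ W) (hwU : w.proj ∈ U)
    (ρ : A.Sec) (α : Fin m) :
    vc hs α w (N.v ρ w) = vc hs α w (ρ w) + ∑ β, N.coeff hs α β w * uc hs β w (ρ w) := by
  unfold NonlinearConnection.v
  rw [map_smul, map_sub, N.vc_toFun hs hU hw hwU, smul_eq_mul]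
  ring

lemma smoothOn_h (hW : IsOpen W) {ρ : A.Sec} (hρ : SmoothOn ρ W) : SmoothOn (N.h ρ) W := by
  refine smoothOn_of_smoothAt fun w hw => ?_
  obtain ⟨s, U, hU, hwU, hs⟩ := exists_frame (n := n) (m := m) (E := E) w.proj
  have h1 := hρ.smoothAt hW hw
  have h2 := (N.smooth ρ hρ).smoothAt hW hw
  refine smoothAt_of_components hs hU hwU (fun α => ?_) fun α => ?_
  · refine ((contMDiffAt_const (c := (1 / 2 : ℝ))).mul
      ((h1.uc hs hU hwU α).add (h2.uc hs hU hwU α))).congr_of_eventuallyEq ?_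
    exact Eventually.of_forall fun w' => by
      simp only [NonlinearConnection.h, map_smul, map_add, smul_eq_mul, Pi.mul_apply, Pi.add_apply]
  · refine ((contMDiffAt_const (c := (1 / 2 : ℝ))).mul
      ((h1.vc hs hU hwU α).add (h2.vc hs hU hwU α))).congr_of_eventuallyEq ?_
    exact Eventually.of_forall fun w' => by
      simp only [NonlinearConnection.h, map_smul, map_add, smul_eq_mul, Pi.mul_apply, Pi.add_apply]

lemma h_of_isVertical {w : TotalSpace (Fib m) E} (hw : w ∈ W) {ρ : A.Sec}
    (hρ : IsVertical (ρ w)) : N.h ρ w = 0 := by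
  unfold NonlinearConnection.h
  rw [N.toFun_of_isVertical hw hρ, add_neg_cancel, smul_zero]

lemma v_of_isVertical {w : TotalSpace (Fib m) E} (hw : w ∈ W) {ρ : A.Sec}
    (hρ : IsVertical (ρ w)) : N.v ρ w = ρ w := by
  unfold NonlinearConnection.v
  rw [N.toFun_of_isVertical hw hρ, sub_neg_eq_add, ← two_smul ℝ (ρ w), smul_smul]
  norm_num

/-- A nonlinear connection is determined by its local coefficients. -/
lemma toFun_eq_of_coeff {N' : A.NonlinearConnection W} (hU : IsOpen U) {w : TotalSpace (Fib m) E}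
    (hw : w ∈ W) (hwU : w.proj ∈ U) (h : ∀ α β, N'.coeff hs α β w = N.coeff hs α β w) :
    N'.toFun w = N.toFun w := by
  ext1 z
  refine prolong_ext hs hU hwU (fun α => ?_) fun α => ?_
  · rw [uc_toFun hs _ hw, uc_toFun hs _ hw]
  · simp only [vc_toFun hs _ hU hw hwU, h]

lemma IsInducedBy.coeff_eq {N : A.NonlinearConnection W} {S : A.Sec} (hN : N.IsInducedBy S)
    (hU : IsOpen U) (hW : IsOpen W) (hS : SmoothOn S W)
    (hy : ∀ w ∈ W, w.proj ∈ U → ∀ α, uc hs α w (S w) = fibCoord hs α w)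
    {w : TotalSpace (Fib m) E} (hw : w ∈ W) (hwU : w.proj ∈ U) (α β : Fin m) :
    N.coeff hs α β w = -(1 / 2 : ℝ) * inducedCoeff hs S α β w := by
  -- `IsInducedBy` speaks of sections smooth on all of `W`, whereas `𝒳_β` is a frame section only
  -- over `U`. It is replaced by a global section with the same value at `w`.
  obtain ⟨ρ, hρ, hρw, -⟩ := exists_section (frameX A hs β w)
  have h1 := hN ρ (smoothOn_of_smoothAt fun w' _ => hρ w') w hw
  have hyev : ∀ᶠ w' in 𝓝 w, ∀ α, uc hs α w' (S w') = fibCoord hs α w' := by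
    filter_upwards [hW.eventually_mem hw, eventually_proj_mem hU hwU] with w' h1 h2
    exact hy w' h1 h2
  rw [N.coeff_eq hs α β hU hwU, ← hρw, h1,
    vc_induced hs hU hwU (hS.smoothAt hW hw) hyev (hρ w), hρw]
  simp [vc_frameX hs hU hwU, uc_frameX hs hU hwU]

end NonlinearConnection

end Connections

/-! ### Metric and symplectic connections as conditions on `N_{αβ}`. -/

section Characterization

variable [T2Space M] {s : Fin m → ∀ x, E x} {U : Set M}
  (hs : IsLocalFrameOn (𝓡 n) (Fib m) ∞ s U)
  {W : Set (TotalSpace (Fib m) E)} {L : TotalSpace (Fib m) E → ℝ}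

lemma metric_eq (hU : IsOpen U) (hW : IsOpen W) (hL : ContMDiffOn (IE n m) 𝓘(ℝ, ℝ) ∞ L W)
    {w : TotalSpace (Fib m) E} (hw : w ∈ W) (hwU : w.proj ∈ U) {ρ ν : A.Sec}
    (hρ : IsVertical (ρ w)) (hν : IsVertical (ν w)) :
    metric L ρ ν w = ∑ α, ∑ β, vc hs α w (ρ w) * vc hs β w (ν w) * gMat s L w α β := by
  unfold metric
  rw [fiberHess_eq hs A hU hW hL hw hwU]
  simp only [coeff_fiberPart hs hU hwU hρ, coeff_fiberPart hs hU hwU hν]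

lemma skewPart_eq (hU : IsOpen U) (hW : IsOpen W) (hL : ContMDiffOn (IE n m) 𝓘(ℝ, ℝ) ∞ L W)
    {w : TotalSpace (Fib m) E} (hw : w ∈ W) (hwU : w.proj ∈ U) (α β : Fin m) :
    skewPart hs A L α β w = D (frameX A hs β) (dY s α L) w - D (frameX A hs α) (dY s β L) w
      + ∑ γ, structFun hs A γ α β w.proj * dY s γ L w := by
  unfold skewPart
  rw [D_frameX hs hU hwU β (sm_dY A hs hU hW hL hw hwU α).md,
    D_frameX hs hU hwU α (sm_dY A hs hU hW hL hw hwU β).md]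

lemma skewPart_skew (hU : IsOpen U) {w : TotalSpace (Fib m) E} (hwU : w.proj ∈ U) (α β : Fin m) :
    skewPart hs A L α β w = -skewPart hs A L β α w := by
  unfold skewPart
  simp only [structFun_skew hs hU hwU _ α β, neg_mul, Finset.sum_neg_distrib]
  ring

lemma D_gMat_symm (hs : IsLocalFrameOn (𝓡 n) (Fib m) ∞ s U) (hU : IsOpen U) (hW : IsOpen W)
    (hL : ContMDiffOn (IE n m) 𝓘(ℝ, ℝ) ∞ L W)
    {w : TotalSpace (Fib m) E} (hw : w ∈ W) (hwU : w.proj ∈ U) (S : A.Sec) (α β : Fin m) :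
    D S (fun w' => gMat s L w' α β) w = D S (fun w' => gMat s L w' β α) w :=
  Dat_congr (((hW.eventually_mem hw).and (eventually_proj_mem hU hwU)).mono fun _ h =>
    gMat_symm A hs hU hW hL h.1 h.2 α β) _

lemma symPart_symm (hU : IsOpen U) (hW : IsOpen W) (hL : ContMDiffOn (IE n m) 𝓘(ℝ, ℝ) ∞ L W)
    {w : TotalSpace (Fib m) E} (hw : w ∈ W) (hwU : w.proj ∈ U) (S : A.Sec) (α β : Fin m) :
    symPart hs L S α β w = symPart hs L S β α w := by
  unfold symPart
  rw [D_gMat_symm hs hU hW hL hw hwU S α β]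
  refine congrArg₂ _ rfl (Finset.sum_congr rfl fun ε _ => Finset.sum_congr rfl fun γ _ => ?_)
  ring

/-- The derivative of the Euler–Lagrange equations along the fibres, in terms of the symmetric and
skew parts. -/
lemma sum_inducedCoeff_mul_gMat (hU : IsOpen U) (hW : IsOpen W)
    (hL : ContMDiffOn (IE n m) 𝓘(ℝ, ℝ) ∞ L W)
    {S : A.Sec} (hS : SmoothOn S W) (hEL : ∀ w ∈ W, w.proj ∈ U → ELAt hs L w (S w))
    {w : TotalSpace (Fib m) E} (hw : w ∈ W) (hwU : w.proj ∈ U) (a b : Fin m) :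
    ∑ γ, gMat s L w a γ * inducedCoeff hs S γ b w =
      -(symPart hs L S a b w + skewPart hs A L a b w) := by
  -- The indices are swapped because the direction of differentiation is the lower index `b` of
  -- `inducedCoeff`.
  have h1 := D_frameV_eulerLagrange hs hU hW hL hS hEL hw hwU b a
  rw [D_gMat_symm hs hU hW hL hw hwU S b a] at h1
  have e1 : ∑ γ, gMat s L w a γ * inducedCoeff hs S γ b w =
      ∑ γ, D (frameV A s b) (fun w' => vc hs γ w' (S w')) w * gMat s L w γ a
      - ∑ ε, ∑ γ, gMat s L w γ a * structFun hs A γ b ε w.proj * fibCoord hs ε w := by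
    rw [Finset.sum_comm, ← Finset.sum_sub_distrib]
    refine Finset.sum_congr rfl fun γ _ => ?_
    rw [inducedCoeff, gMat_symm A hs hU hW hL hw hwU a γ, mul_add, mul_comm, sub_eq_add_neg,
      ← Finset.sum_neg_distrib, Finset.mul_sum]
    refine congrArg₂ _ rfl (Finset.sum_congr rfl fun ε _ => ?_)
    rw [structFun_skew hs hU hwU γ ε b]
    ring
  have e2 : ∑ α, fibCoord hs α w * ∑ γ, structFun hs A γ α a w.proj * gMat s L w b γ =
      -∑ ε, ∑ γ, gMat s L w γ b * structFun hs A γ a ε w.proj * fibCoord hs ε w := by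
    rw [← Finset.sum_neg_distrib]
    refine Finset.sum_congr rfl fun ε _ => ?_
    rw [Finset.mul_sum, ← Finset.sum_neg_distrib]
    refine Finset.sum_congr rfl fun γ _ => ?_
    rw [structFun_skew hs hU hwU γ ε a, gMat_symm A hs hU hW hL hw hwU b γ]
    ring
  rw [skewPart_skew hs hU hwU, skewPart_eq hs hU hW hL hw hwU, symPart, e1]
  rw [e2] at h1
  simp only [add_mul, Finset.sum_add_distrib]
  linarith

namespace NonlinearConnection

variable (N : A.NonlinearConnection W)

/-- In `omega_eq` the horizontal lift differentiates `∂_β L` by `𝒳_α - N^γ_α 𝒱_γ`. The vertical part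
contributes `-N_{βα}` because `𝒱_γ(∂_β L) = g_{γβ}`, and what remains is `skewPart`. -/
lemma omega_h_h (hU : IsOpen U) (hW : IsOpen W) (hL : ContMDiffOn (IE n m) 𝓘(ℝ, ℝ) ∞ L W)
    {w : TotalSpace (Fib m) E} (hw : w ∈ W) (hwU : w.proj ∈ U) {ρ ν : A.Sec}
    (hρ : SmoothOn ρ W) (hν : SmoothOn ν W) :
    omega L (N.h ρ) (N.h ν) w = ∑ α, ∑ β, uc hs α w (ρ w) * uc hs β w (ν w) *
      (N.low hs L α β w - N.low hs L β α w - skewPart hs A L α β w) := by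
  have hDat : ∀ (τ : A.Sec) (β : Fin m), Dat (dY s β L) w (N.h τ w) =
      ∑ α, uc hs α w (τ w) * (D (frameX A hs α) (dY s β L) w - N.low hs L β α w) := by
    intro τ β
    rw [Dat_decomp hs hU hwU]
    simp only [N.uc_h hs hw, N.vc_h hs hU hw hwU, ← gMat_eq_D A hs hU hW hL hw hwU, mul_sub,
      Finset.sum_sub_distrib, low, neg_mul, Finset.sum_neg_distrib, ← sub_eq_add_neg]
    refine congrArg₂ _ rfl ?_
    simp only [Finset.sum_mul, Finset.mul_sum]
    rw [Finset.sum_comm]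
    refine Finset.sum_congr rfl fun α _ => Finset.sum_congr rfl fun γ _ => ?_
    rw [gMat_symm A hs hU hW hL hw hwU β γ]
    ring
  rw [omega_eq hs hU hW hL hw hwU ((N.smoothOn_h hW hρ).smoothAt hW hw)
    ((N.smoothOn_h hW hν).smoothAt hW hw)]
  simp only [N.uc_h hs hw, hDat, skewPart_eq hs hU hW hL hw hwU]
  have e1 : ∑ β, uc hs β w (ν w) * ∑ α, uc hs α w (ρ w) *
      (D (frameX A hs α) (dY s β L) w - N.low hs L β α w) =
      ∑ α, ∑ β, uc hs α w (ρ w) * uc hs β w (ν w) *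
        (D (frameX A hs α) (dY s β L) w - N.low hs L β α w) := by
    simp only [Finset.mul_sum]
    rw [Finset.sum_comm]
    refine Finset.sum_congr rfl fun α _ => Finset.sum_congr rfl fun β _ => ?_
    ring
  rw [e1, ← Finset.sum_sub_distrib, ← Finset.sum_sub_distrib]
  refine Finset.sum_congr rfl fun α _ => ?_
  rw [Finset.mul_sum, ← Finset.sum_sub_distrib, ← Finset.sum_sub_distrib]
  refine Finset.sum_congr rfl fun β _ => ?_
  ring

/-- Testing on global extensions of `𝒳_α` and `𝒳_β` isolates one coefficient of `omega_h_h`. -/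
lemma isSymplectic_iff (hW : IsOpen W) (hL : ContMDiffOn (IE n m) 𝓘(ℝ, ℝ) ∞ L W) :
    N.IsSymplectic L ↔ ∀ (U : Set M) (_ : IsOpen U) (s : Fin m → ∀ x, E x)
      (hs : IsLocalFrameOn (𝓡 n) (Fib m) ∞ s U), ∀ w ∈ W, w.proj ∈ U → ∀ α β : Fin m,
        N.low hs L α β w - N.low hs L β α w = skewPart hs A L α β w := by
  constructor
  · intro h U hU s hs w hw hwU α β
    obtain ⟨ρ, hρ, hρw, -⟩ := exists_section (frameX A hs α w)
    obtain ⟨ν, hν, hνw, -⟩ := exists_section (frameX A hs β w)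
    have hρ' : SmoothOn ρ W := smoothOn_of_smoothAt fun w' _ => hρ w'
    have hν' : SmoothOn ν W := smoothOn_of_smoothAt fun w' _ => hν w'
    have h1 := h ρ ν hρ' hν' w hw
    rw [N.omega_h_h hs hU hW hL hw hwU hρ' hν', hρw, hνw] at h1
    simp only [uc_frameX hs hU hwU, ite_mul, mul_ite, one_mul, mul_one, zero_mul, mul_zero,
      Finset.sum_ite_eq', Finset.mem_univ, if_true] at h1
    linarith
  · intro h ρ ν hρ hν w hw
    obtain ⟨s, U, hU, hwU, hs⟩ := exists_frame (n := n) (m := m) (E := E) w.proj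
    rw [N.omega_h_h hs hU hW hL hw hwU hρ hν]
    refine Finset.sum_eq_zero fun α _ => Finset.sum_eq_zero fun β _ => ?_
    rw [h U hU s hs w hw hwU, sub_self, mul_zero]

section Nabla

variable {S : A.Sec}

/-- `hρ` vanishes throughout the open set `W`, so its germ at `w` is zero and so is the bracket with
it. -/
lemma br_h_of_isVertical (hs : IsLocalFrameOn (𝓡 n) (Fib m) ∞ s U) (hU : IsOpen U) (hW : IsOpen W)
    (hS : SmoothOn S W) {ρ : A.Sec} (hρ : SmoothOn ρ W) (hρv : ∀ w ∈ W, IsVertical (ρ w))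
    {w : TotalSpace (Fib m) E} (hw : w ∈ W) (hwU : w.proj ∈ U) : br S (N.h ρ) w = 0 := by
  have hSw := hS.smoothAt hW hw
  have hhw := (N.smoothOn_h hW hρ).smoothAt hW hw
  have h0 := N.h_of_isVertical hw (hρv w hw)
  have hev : ∀ᶠ w' in 𝓝 w, N.h ρ w' = 0 :=
    (hW.eventually_mem hw).mono fun w' h => N.h_of_isVertical h (hρv w' h)
  refine prolong_ext hs hU hwU (fun γ => ?_) fun γ => ?_
  · rw [uc_br hs hU hwU hSw hhw, D_eq_Dat, Dat_congr (g := fun _ => 0)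
      (hev.mono fun w' h => by rw [h, map_zero]), Dat_const, D_eq_Dat, h0]
    simp
  · rw [vc_br hs hU hwU hSw hhw, D_eq_Dat, Dat_congr (g := fun _ => 0)
      (hev.mono fun w' h => by rw [h, map_zero]), Dat_const, D_eq_Dat, h0]
    simp

lemma nabla_of_isVertical (hs : IsLocalFrameOn (𝓡 n) (Fib m) ∞ s U) (hU : IsOpen U) (hW : IsOpen W)
    (hS : SmoothOn S W) {ρ : A.Sec} (hρ : SmoothOn ρ W) (hρv : ∀ w ∈ W, IsVertical (ρ w))
    {w : TotalSpace (Fib m) E} (hw : w ∈ W) (hwU : w.proj ∈ U) :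
    N.nabla S ρ w = N.v (br S (N.v ρ)) w := by
  have h1 : N.h (br S (N.h ρ)) w = 0 := by
    show (1 / 2 : ℝ) • (br S (N.h ρ) w + N.toFun w (br S (N.h ρ) w)) = 0
    rw [N.br_h_of_isVertical hs hU hW hS hρ hρv hw hwU, map_zero, add_zero, smul_zero]
  show N.h (br S (N.h ρ)) w + N.v (br S (N.v ρ)) w = _
  rw [h1, zero_add]

lemma isVertical_nabla (hs : IsLocalFrameOn (𝓡 n) (Fib m) ∞ s U) (hU : IsOpen U) (hW : IsOpen W)
    (hS : SmoothOn S W) {ρ : A.Sec} (hρ : SmoothOn ρ W) (hρv : ∀ w ∈ W, IsVertical (ρ w))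
    {w : TotalSpace (Fib m) E} (hw : w ∈ W) (hwU : w.proj ∈ U) : IsVertical (N.nabla S ρ w) := by
  refine isVertical_of_uc hs hwU fun α => ?_
  rw [N.nabla_of_isVertical hs hU hW hS hρ hρv hw hwU, N.uc_v hs hw]

/-- For vertical `ρ` the `𝒳`-components of `[S, ρ]` are `-ρ^β`, with `ρ^β = vc ρ`. Projecting by `v`
therefore adds `-N^γ_β ρ^β` to the vertical components of the bracket. -/
lemma vc_nabla (hU : IsOpen U) (hW : IsOpen W) (hS : SmoothOn S W)
    (hy : ∀ w ∈ W, w.proj ∈ U → ∀ α, uc hs α w (S w) = fibCoord hs α w)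
    {ρ : A.Sec} (hρ : SmoothOn ρ W) (hρv : ∀ w ∈ W, IsVertical (ρ w))
    {w : TotalSpace (Fib m) E} (hw : w ∈ W) (hwU : w.proj ∈ U) (γ : Fin m) :
    vc hs γ w (N.nabla S ρ w) = D S (fun w' => vc hs γ w' (ρ w')) w - ∑ β, vc hs β w (ρ w) *
      (D (frameV A s β) (fun w' => vc hs γ w' (S w')) w + N.coeff hs γ β w) := by
  have hSw := hS.smoothAt hW hw
  have hev : ∀ᶠ w' in 𝓝 w, N.v ρ w' = ρ w' :=
    (hW.eventually_mem hw).mono fun w' h => N.v_of_isVertical h (hρv w' h)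
  have hvw : SmoothAt (N.v ρ) w := (hρ.smoothAt hW hw).congr hev
  have h0 : N.v ρ w = ρ w := hev.self_of_nhds
  have hz : ∀ α, uc hs α w (ρ w) = 0 := fun α => (hρv w hw).uc_eq_zero hs α
  have hyev : ∀ᶠ w' in 𝓝 w, ∀ α, uc hs α w' (S w') = fibCoord hs α w' := by
    filter_upwards [hW.eventually_mem hw, eventually_proj_mem hU hwU] with w' h1 h2
    exact hy w' h1 h2
  have hu : ∀ β, uc hs β w (br S (N.v ρ) w) = -vc hs β w (ρ w) := by
    intro β
    rw [uc_br_semispray hs hU hwU hSw hyev hvw, D_eq_Dat, Dat_congr (g := fun _ => 0)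
      ((hW.eventually_mem hw).mono fun w' h => N.uc_v hs h ρ β), Dat_const, h0]
    simp [hz]
  rw [N.nabla_of_isVertical hs hU hW hS hρ hρv hw hwU, N.vc_v hs hU hw hwU,
    vc_br hs hU hwU hSw hvw, D_eq_Dat S, Dat_congr (g := fun w' => vc hs γ w' (ρ w'))
      (hev.mono fun w' h => by rw [h]), D_eq_Dat (N.v ρ), h0,
    Dat_of_isVertical hs hU hwU _ hz]
  simp only [hu, mul_add, Finset.sum_add_distrib, neg_mul, Finset.sum_neg_distrib,
    mul_comm (N.coeff hs γ _ w)]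
  rw [D_eq_Dat S]
  ring

/-- The defect of the metric condition in a local frame. -/
lemma D_metric_sub (hU : IsOpen U) (hW : IsOpen W) (hL : ContMDiffOn (IE n m) 𝓘(ℝ, ℝ) ∞ L W)
    (hS : SmoothOn S W)
    (hy : ∀ w ∈ W, w.proj ∈ U → ∀ α, uc hs α w (S w) = fibCoord hs α w)
    {ρ ν : A.Sec} (hρ : SmoothOn ρ W) (hν : SmoothOn ν W) (hρv : ∀ w ∈ W, IsVertical (ρ w))
    (hνv : ∀ w ∈ W, IsVertical (ν w)) {w : TotalSpace (Fib m) E} (hw : w ∈ W)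
    (hwU : w.proj ∈ U) :
    D S (metric L ρ ν) w - (metric L (N.nabla S ρ) ν w + metric L ρ (N.nabla S ν) w) =
      ∑ α, ∑ β, vc hs α w (ρ w) * vc hs β w (ν w) * (D S (fun w' => gMat s L w' α β) w
        + ∑ γ, gMat s L w γ β * (D (frameV A s α) (fun w' => vc hs γ w' (S w')) w
          + N.coeff hs γ α w)
        + ∑ γ, gMat s L w α γ * (D (frameV A s β) (fun w' => vc hs γ w' (S w')) w
          + N.coeff hs γ β w)) := by
  have hρw := (hρ.smoothAt hW hw).vc hs hU hwU
  have hνw := (hν.smoothAt hW hw).vc hs hU hwU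
  have hg := sm_gMat A hs hU hW hL hw hwU
  have h1 : metric L ρ ν =ᶠ[𝓝 w] fun w' => ∑ α, vc hs α w' (ρ w') *
      ∑ β, vc hs β w' (ν w') * gMat s L w' α β := by
    filter_upwards [hW.eventually_mem hw, eventually_proj_mem hU hwU] with w' h1 h2
    rw [metric_eq hs hU hW hL h1 h2 (hρv w' h1) (hνv w' h1)]
    refine Finset.sum_congr rfl fun α _ => ?_
    rw [Finset.mul_sum]
    exact Finset.sum_congr rfl fun β _ => mul_assoc _ _ _
  have hK : ∀ α, Sm (n := n) (fun w' => ∑ β, vc hs β w' (ν w') * gMat s L w' α β) w := fun α =>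
    ContMDiffAt.sum fun β _ => (hνw β).mul (hg α β)
  -- The product rule for `ρ^α ν^β g_{αβ}`. The terms in which `S` differentiates a component of `ρ`
  -- or `ν` reappear in `g(∇ρ, ν) + g(ρ, ∇ν)` and cancel.
  have h2 : D S (metric L ρ ν) w = ∑ α, ∑ β,
      (vc hs α w (ρ w) * vc hs β w (ν w) * D S (fun w' => gMat s L w' α β) w
        + vc hs α w (ρ w) * D S (fun w' => vc hs β w' (ν w')) w * gMat s L w α β
        + D S (fun w' => vc hs α w' (ρ w')) w * vc hs β w (ν w) * gMat s L w α β) := by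
    rw [D_eq_Dat, Dat_congr h1, Dat_sum_mul (f := fun α w' => vc hs α w' (ρ w')) hρw hK]
    refine Finset.sum_congr rfl fun α _ => ?_
    rw [Dat_sum_mul (f := fun β w' => vc hs β w' (ν w')) (g := fun β w' => gMat s L w' α β)
      hνw (hg α), Finset.mul_sum, Finset.mul_sum, ← Finset.sum_add_distrib]
    refine Finset.sum_congr rfl fun β _ => ?_
    simp only [D_eq_Dat]
    ring
  have e1 : ∀ Q : Fin m → Fin m → ℝ, ∑ α, ∑ β, vc hs α w (ρ w) * vc hs β w (ν w)
      * ∑ γ, gMat s L w γ β * Q γ α =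
      ∑ α, ∑ β, (∑ γ, vc hs γ w (ρ w) * Q α γ) * vc hs β w (ν w) * gMat s L w α β := by
    intro Q
    rw [Finset.sum_comm, Finset.sum_comm (f := fun α β => (∑ γ, vc hs γ w (ρ w) * Q α γ)
      * vc hs β w (ν w) * gMat s L w α β)]
    refine Finset.sum_congr rfl fun β _ => ?_
    simp only [Finset.mul_sum, Finset.sum_mul]
    rw [Finset.sum_comm]
    refine Finset.sum_congr rfl fun γ _ => Finset.sum_congr rfl fun α _ => ?_
    ring
  have e2 : ∀ Q : Fin m → Fin m → ℝ, ∑ α, ∑ β, vc hs α w (ρ w) * vc hs β w (ν w)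
      * ∑ γ, gMat s L w α γ * Q γ β =
      ∑ α, ∑ β, vc hs α w (ρ w) * (∑ γ, vc hs γ w (ν w) * Q β γ) * gMat s L w α β := by
    intro Q
    refine Finset.sum_congr rfl fun α _ => ?_
    simp only [Finset.mul_sum, Finset.sum_mul]
    rw [Finset.sum_comm]
    refine Finset.sum_congr rfl fun γ _ => Finset.sum_congr rfl fun β _ => ?_
    ring
  rw [h2, metric_eq hs hU hW hL hw hwU (N.isVertical_nabla hs hU hW hS hρ hρv hw hwU) (hνv w hw),
    metric_eq hs hU hW hL hw hwU (hρv w hw) (N.isVertical_nabla hs hU hW hS hν hνv hw hwU)]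
  simp only [N.vc_nabla hs hU hW hS hy hρ hρv hw hwU, N.vc_nabla hs hU hW hS hy hν hνv hw hwU]
  simp only [mul_add _ (D S (fun w' => gMat s L w' _ _) w + _),
    mul_add _ (D S (fun w' => gMat s L w' _ _) w), Finset.sum_add_distrib]
  rw [e1 fun γ α => D (frameV A s α) (fun w' => vc hs γ w' (S w')) w + N.coeff hs γ α w,
    e2 fun γ α => D (frameV A s α) (fun w' => vc hs γ w' (S w')) w + N.coeff hs γ α w]
  simp only [sub_mul, mul_sub, Finset.sum_sub_distrib]
  ring

/-- The defect of the metric condition in terms of the symmetric part of `N_{αβ}`. -/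
lemma metric_defect (hU : IsOpen U) (hW : IsOpen W) (hL : ContMDiffOn (IE n m) 𝓘(ℝ, ℝ) ∞ L W)
    (hS : SmoothOn S W) (hEL : ∀ w ∈ W, w.proj ∈ U → ELAt hs L w (S w))
    {w : TotalSpace (Fib m) E} (hw : w ∈ W) (hwU : w.proj ∈ U) (α β : Fin m) :
    D S (fun w' => gMat s L w' α β) w
        + ∑ γ, gMat s L w γ β * (D (frameV A s α) (fun w' => vc hs γ w' (S w')) w
          + N.coeff hs γ α w)
        + ∑ γ, gMat s L w α γ * (D (frameV A s β) (fun w' => vc hs γ w' (S w')) w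
          + N.coeff hs γ β w) =
      N.low hs L α β w + N.low hs L β α w - symPart hs L S α β w := by
  -- The identity is used for both orders of the indices and added: the skew parts cancel and `-2
  -- symPart` appears. The terms `y^ε L^γ_{εβ}` contained in `inducedCoeff`, together with
  -- `S(g_{αβ})`, give back one `symPart`.
  have h1 := sum_inducedCoeff_mul_gMat hs hU hW hL hS hEL hw hwU α β
  have h2 := sum_inducedCoeff_mul_gMat hs hU hW hL hS hEL hw hwU β α
  rw [symPart_symm hs hU hW hL hw hwU S β α, skewPart_skew hs hU hwU β α] at h2
  have e1 : ∑ γ, gMat s L w β γ * ∑ ε, fibCoord hs ε w * structFun hs A γ ε α w.proj =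
      -∑ ε, ∑ γ, gMat s L w γ β * structFun hs A γ α ε w.proj * fibCoord hs ε w := by
    rw [Finset.sum_comm, ← Finset.sum_neg_distrib]
    refine Finset.sum_congr rfl fun γ _ => ?_
    rw [Finset.mul_sum, ← Finset.sum_neg_distrib]
    refine Finset.sum_congr rfl fun ε _ => ?_
    rw [structFun_skew hs hU hwU γ ε α, gMat_symm A hs hU hW hL hw hwU β γ]
    ring
  have e2 : ∑ γ, gMat s L w α γ * ∑ ε, fibCoord hs ε w * structFun hs A γ ε β w.proj =
      -∑ ε, ∑ γ, gMat s L w γ α * structFun hs A γ β ε w.proj * fibCoord hs ε w := by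
    rw [Finset.sum_comm, ← Finset.sum_neg_distrib]
    refine Finset.sum_congr rfl fun γ _ => ?_
    rw [Finset.mul_sum, ← Finset.sum_neg_distrib]
    refine Finset.sum_congr rfl fun ε _ => ?_
    rw [structFun_skew hs hU hwU γ ε β, gMat_symm A hs hU hW hL hw hwU α γ]
    ring
  simp only [inducedCoeff, mul_add, Finset.sum_add_distrib] at h1 h2
  rw [e2] at h1
  rw [e1] at h2
  simp only [symPart, add_mul, Finset.sum_add_distrib] at h1 h2 ⊢
  simp only [gMat_symm A hs hU hW hL hw hwU _ β, mul_add, Finset.sum_add_distrib, low]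
  simp only [gMat_symm A hs hU hW hL hw hwU _ β] at h1 h2
  linarith

/-- Testing on global vertical extensions of `𝒱_α` and `𝒱_β` isolates one coefficient of the defect.
-/
lemma isMetric_iff (hW : IsOpen W) (hL : ContMDiffOn (IE n m) 𝓘(ℝ, ℝ) ∞ L W)
    (hS : SmoothOn S W) (hEL : ∀ (s : Fin m → ∀ x, E x) (U : Set M)
      (hs : IsLocalFrameOn (𝓡 n) (Fib m) ∞ s U), IsOpen U → ∀ w ∈ W, w.proj ∈ U →
      ELAt hs L w (S w)) :
    N.IsMetric L S ↔ ∀ (U : Set M) (_ : IsOpen U) (s : Fin m → ∀ x, E x)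
      (hs : IsLocalFrameOn (𝓡 n) (Fib m) ∞ s U), ∀ w ∈ W, w.proj ∈ U → ∀ α β : Fin m,
        N.low hs L α β w + N.low hs L β α w = symPart hs L S α β w := by
  constructor
  · intro h U hU s hs w hw hwU α β
    obtain ⟨ρ, hρ, hρw, hρv⟩ := exists_section (frameV A s α w)
    obtain ⟨ν, hν, hνw, hνv⟩ := exists_section (frameV A s β w)
    have hρ' : SmoothOn ρ W := smoothOn_of_smoothAt fun w' _ => hρ w'
    have hν' : SmoothOn ν W := smoothOn_of_smoothAt fun w' _ => hν w'
    have hρv' : ∀ w ∈ W, IsVertical (ρ w) := fun w' _ => hρv rfl w'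
    have hνv' : ∀ w ∈ W, IsVertical (ν w) := fun w' _ => hνv rfl w'
    have h1 := N.D_metric_sub hs hU hW hL hS (fun w' h h' => (hEL s U hs hU w' h h').uc_eq)
      hρ' hν' hρv' hνv' hw hwU
    rw [h ρ ν hρ' hν' hρv' hνv' w hw, sub_self, hρw, hνw] at h1
    simp only [vc_frameV hs hU hwU, ite_mul, mul_ite, one_mul, mul_one, zero_mul, mul_zero,
      Finset.sum_ite_eq', Finset.mem_univ, if_true,
      N.metric_defect hs hU hW hL hS (hEL s U hs hU) hw hwU] at h1
    linarith
  · intro h ρ ν hρ hν hρv hνv w hw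
    obtain ⟨s, U, hU, hwU, hs⟩ := exists_frame (n := n) (m := m) (E := E) w.proj
    refine sub_eq_zero.1 ((N.D_metric_sub hs hU hW hL hS
      (fun w' h h' => (hEL s U hs hU w' h h').uc_eq) hρ hν hρv hνv hw hwU).trans ?_)
    refine Finset.sum_eq_zero fun α _ => Finset.sum_eq_zero fun β _ => ?_
    rw [N.metric_defect hs hU hW hL hS (hEL s U hs hU) hw hwU, h U hU s hs w hw hwU, sub_self,
      mul_zero]

/-- Combines `N^γ_β = -B^γ_β / 2` with the differentiated Euler–Lagrange equations. The canonical
`N_{αβ}` thereby has the prescribed symmetric and skew parts. -/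
lemma IsInducedBy.low_eq {N : A.NonlinearConnection W} (hN : N.IsInducedBy S) (hU : IsOpen U)
    (hW : IsOpen W) (hL : ContMDiffOn (IE n m) 𝓘(ℝ, ℝ) ∞ L W)
    (hS : SmoothOn S W) (hEL : ∀ w ∈ W, w.proj ∈ U → ELAt hs L w (S w))
    {w : TotalSpace (Fib m) E} (hw : w ∈ W) (hwU : w.proj ∈ U) (α β : Fin m) :
    N.low hs L α β w = (1 / 2 : ℝ) * (symPart hs L S α β w + skewPart hs A L α β w) := by
  have h1 := sum_inducedCoeff_mul_gMat hs hU hW hL hS hEL hw hwU α β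
  unfold low
  simp only [hN.coeff_eq hs hU hW hS (fun w' h h' => (hEL w' h h').uc_eq) hw hwU,
    mul_left_comm (gMat s L w α _), ← Finset.mul_sum, h1]
  ring

end Nabla

lemma coeff_eq_sum_low (hU : IsOpen U) (hW : IsOpen W)
    (hL : ContMDiffOn (IE n m) 𝓘(ℝ, ℝ) ∞ L W) (hreg : IsRegularOn L W)
    {w : TotalSpace (Fib m) E} (hw : w ∈ W) (hwU : w.proj ∈ U) (α β : Fin m) :
    N.coeff hs α β w = ∑ ε, (gMat s L w)⁻¹ α ε * N.low hs L ε β w := by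
  have h1 : (gMat s L w)⁻¹.mulVec ((gMat s L w).mulVec fun γ => N.coeff hs γ β w) =
      fun γ => N.coeff hs γ β w := by
    rw [Matrix.mulVec_mulVec, Matrix.nonsing_inv_mul _
      (gMat_det_ne_zero A hs hU hW hL hreg hw hwU).isUnit, Matrix.one_mulVec]
  exact (congrFun h1 α).symm

end NonlinearConnection

end Characterization

end LieAlgebroid

end

/-! ### Assembly of the theorem. -/

theorem theorem1p4p2 {n m : ℕ} {M : Type*} [TopologicalSpace M] [T2Space M]
    [ChartedSpace (EuclideanSpace ℝ (Fin n)) M] [IsManifold (𝓡 n) ∞ M]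
    {E : M → Type*} [TopologicalSpace (TotalSpace (Fib m) E)]
    [∀ x, AddCommGroup (E x)] [∀ x, Module ℝ (E x)] [∀ x, TopologicalSpace (E x)]
    [FiberBundle (Fib m) E] [VectorBundle ℝ (Fib m) E]
    [ContMDiffVectorBundle ∞ (Fib m) E (𝓡 n)]
    (A : LieAlgebroid n m E)
    (W : Set (TotalSpace (Fib m) E)) (hW : IsOpen W)
    (L : TotalSpace (Fib m) E → ℝ) (hL : ContMDiffOn (IE n m) 𝓘(ℝ, ℝ) ∞ L W)
    (hreg : IsRegularOn L W) :
    -- the Euler–Lagrange section exists, is unique on `W`, and is a semispray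
    ∃ S : A.Sec, LieAlgebroid.IsEulerLagrange L S W ∧
      (∀ S' : A.Sec, LieAlgebroid.IsEulerLagrange L S' W → ∀ w ∈ W, S' w = S w) ∧
      LieAlgebroid.IsSemispray S W ∧
      -- the canonical nonlinear connection, with its local coefficients
      ∃ N : A.NonlinearConnection W, N.IsInducedBy S ∧
        (∀ (U : Set M) (_ : IsOpen U) (s : Fin m → ∀ x, E x)
          (hs : IsLocalFrameOn (𝓡 n) (Fib m) ∞ s U),
          ∀ w ∈ W, w.proj ∈ U → ∀ α β : Fin m,
            N.coeff hs α β w = (1 / 2 : ℝ) * ∑ ε, (LieAlgebroid.gMat s L w)⁻¹ α ε *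
              (LieAlgebroid.D S (fun w' => LieAlgebroid.gMat s L w' ε β) w
                + LieAlgebroid.dX hs A β (LieAlgebroid.dY s ε L) w
                - LieAlgebroid.dX hs A ε (LieAlgebroid.dY s β L) w
                - ∑ γ, LieAlgebroid.structFun hs A γ β ε w.proj * LieAlgebroid.dY s γ L w
                + ∑ θ, ∑ γ,
                  (LieAlgebroid.gMat s L w γ ε * LieAlgebroid.structFun hs A γ β θ w.proj
                    + LieAlgebroid.gMat s L w γ β * LieAlgebroid.structFun hs A γ ε θ w.proj)
                    * LieAlgebroid.fibCoord hs θ w)) ∧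
        -- it is metric and compatible with `ω_L`, and it is the only such connection
        N.IsMetric L S ∧ N.IsSymplectic L ∧
        (∀ N' : A.NonlinearConnection W, N'.IsMetric L S → N'.IsSymplectic L →
          ∀ w ∈ W, N'.toFun w = N.toFun w) ∧
        -- the metric condition amounts to prescribing the symmetric part of `N_{αβ}`,
        -- the symplectic condition to prescribing its skew part
        (∀ N' : A.NonlinearConnection W,
          (N'.IsMetric L S ↔
            ∀ (U : Set M) (_ : IsOpen U) (s : Fin m → ∀ x, E x)
              (hs : IsLocalFrameOn (𝓡 n) (Fib m) ∞ s U),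
              ∀ w ∈ W, w.proj ∈ U → ∀ α β : Fin m,
                (1 / 2 : ℝ) * (N'.low hs L α β w + N'.low hs L β α w) =
                  (1 / 2 : ℝ) * LieAlgebroid.symPart hs L S α β w) ∧
          (N'.IsSymplectic L ↔
            ∀ (U : Set M) (_ : IsOpen U) (s : Fin m → ∀ x, E x)
              (hs : IsLocalFrameOn (𝓡 n) (Fib m) ∞ s U),
              ∀ w ∈ W, w.proj ∈ U → ∀ α β : Fin m,
                (1 / 2 : ℝ) * (N'.low hs L α β w - N'.low hs L β α w) =
                  (1 / 2 : ℝ) * LieAlgebroid.skewPart hs A L α β w)) := by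
  obtain ⟨S, hS, hEL⟩ := LieAlgebroid.exists_eulerLagrange A hW hL hreg
  have hy : ∀ (s : Fin m → ∀ x, E x) (U : Set M) (hs : IsLocalFrameOn (𝓡 n) (Fib m) ∞ s U),
      IsOpen U → ∀ w ∈ W, w.proj ∈ U → ∀ α, LieAlgebroid.uc hs α w (S w) =
        LieAlgebroid.fibCoord hs α w := fun s U hs hU w hw hwU => (hEL s U hs hU w hw hwU).uc_eq
  obtain ⟨N, hN⟩ := LieAlgebroid.exists_inducedConnection hW hS hy
  have hlow : ∀ (U : Set M) (_ : IsOpen U) (s : Fin m → ∀ x, E x)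
      (hs : IsLocalFrameOn (𝓡 n) (Fib m) ∞ s U), ∀ w ∈ W, w.proj ∈ U → ∀ α β : Fin m,
      N.low hs L α β w = (1 / 2 : ℝ) *
        (LieAlgebroid.symPart hs L S α β w + LieAlgebroid.skewPart hs A L α β w) :=
    fun U hU s hs w hw hwU => hN.low_eq hs hU hW hL hS (hEL s U hs hU) hw hwU
  have hM := fun N' : A.NonlinearConnection W => N'.isMetric_iff hW hL hS hEL
  have hΩ := fun N' : A.NonlinearConnection W => N'.isSymplectic_iff hW hL
  refine ⟨S, ⟨hS, fun ν hν w hw => ?_⟩, fun S' hS' w hw => ?_, fun w hw => ?_, N, hN,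
    fun U hU s hs w hw hwU α β => ?_, (hM N).2 fun U hU s hs w hw hwU α β => ?_,
    (hΩ N).2 fun U hU s hs w hw hwU α β => ?_, fun N' hN'm hN's w hw => ?_, fun N' => ⟨?_, ?_⟩⟩
  · obtain ⟨s, U, hU, hwU, hs⟩ := LieAlgebroid.exists_frame (n := n) (m := m) (E := E) w.proj
    exact (hEL s U hs hU w hw hwU).omega_eq hs hU hW hL hw hwU (hS.smoothAt hW hw)
      (hν.smoothAt hW hw)
  · obtain ⟨s, U, hU, hwU, hs⟩ := LieAlgebroid.exists_frame (n := n) (m := m) (E := E) w.proj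
    refine LieAlgebroid.ELAt.unique hs hU hW hL hreg hw hwU ?_ (hEL s U hs hU w hw hwU)
    exact LieAlgebroid.elAt_of_omega_eq hs hU hW hL hreg hw hwU (hS'.smooth.smoothAt hW hw)
      fun ν hν => hS'.eq ν (LieAlgebroid.smoothOn_of_smoothAt fun w' _ => hν w') w hw
  · obtain ⟨s, U, hU, hwU, hs⟩ := LieAlgebroid.exists_frame (n := n) (m := m) (E := E) w.proj
    refine LieAlgebroid.prolong_ext hs hU hwU (fun α => ?_) fun α => ?_
    · rw [LieAlgebroid.uc_J, LieAlgebroid.uc_euler]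
    · rw [LieAlgebroid.vc_J hs hU hwU, LieAlgebroid.vc_euler hs hU hwU, hy s U hs hU w hw hwU]
  · rw [N.coeff_eq_sum_low hs hU hW hL hreg hw hwU, Finset.mul_sum]
    refine Finset.sum_congr rfl fun ε _ => ?_
    rw [hlow U hU s hs w hw hwU, LieAlgebroid.symPart, LieAlgebroid.skewPart]
    simp only [LieAlgebroid.structFun_skew hs hU hwU _ β ε, neg_mul, Finset.sum_neg_distrib,
      add_comm (LieAlgebroid.gMat s L w _ ε * LieAlgebroid.structFun hs A _ β _ w.proj)]
    ring
  · rw [hlow U hU s hs w hw hwU, hlow U hU s hs w hw hwU,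
      LieAlgebroid.symPart_symm hs hU hW hL hw hwU S β α, LieAlgebroid.skewPart_skew hs hU hwU β α]
    ring
  · rw [hlow U hU s hs w hw hwU, hlow U hU s hs w hw hwU,
      LieAlgebroid.symPart_symm hs hU hW hL hw hwU S β α, LieAlgebroid.skewPart_skew hs hU hwU β α]
    ring
  · obtain ⟨s, U, hU, hwU, hs⟩ := LieAlgebroid.exists_frame (n := n) (m := m) (E := E) w.proj
    refine N.toFun_eq_of_coeff hs hU hw hwU fun α β => ?_
    rw [N.coeff_eq_sum_low hs hU hW hL hreg hw hwU, N'.coeff_eq_sum_low hs hU hW hL hreg hw hwU]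
    refine Finset.sum_congr rfl fun ε _ => ?_
    -- The two properties prescribe the sum and the difference of `N'_{εβ}` and `N'_{βε}`, hence
    -- `N'_{εβ}` itself.
    have h1 := (hM N').1 hN'm U hU s hs w hw hwU ε β
    have h2 := (hΩ N').1 hN's U hU s hs w hw hwU ε β
    rw [hlow U hU s hs w hw hwU, ← h1, ← h2]
    ring
  · rw [hM N']
    simp only [mul_right_inj' (one_div_ne_zero (two_ne_zero (α := ℝ)))]
  · rw [hΩ N']
    simp only [mul_right_inj' (one_div_ne_zero (two_ne_zero (α := ℝ)))]
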